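/- Let $\Delta$ be a $2$-dimensional disk (a space homeomorphic to the closed unit disk in the plane, with boundary circle $\partial\Delta$), let $J$ be a simple closed curve (a space homeomorphic to the circle), and let $f:\partial\Delta\to J$ be a continuous map. Suppose there is a point $v\in J$ such that $f^{-1}(\{v\})$ is finite with at least $3$ elements and $f$ maps each connected component of $\partial\Delta\setminus f^{-1}(\{v\})$ homeomorphically onto $J\setminus\{v\}$. The adjunction space $D=\Delta\cup_f J$ is called a generalized dunce hat. A triangulation of $D$ is a finite simplicial complex $K$ in some $\mathbb{R}^n$ together with a homeomorphism $h:|K|\to D$. With respect to such a triangulation, a subset $A\subseteq D$ is a subpolyhedron if $h^{-1}(A)=|L|$ for some finite simplicial complex $L$ in $\mathbb{R}^n$ (equivalently, $h^{-1}(A)$ is the underlying space of a subcomplex of a subdivision of $K$). It is collapsible if such an $L$ can be chosen that collapses simplicially to a single vertex. Proposition. Every generalized dunce hat $D$ can be triangulated, and for every triangulation of $D$ there are three proper collapsible subpolyhedra $A_1,A_2,A_3\subsetneq D$ with $D=A_1\cup A_2\cup A_3$. -/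

import Mathlib

open Set Topology

namespace DunceHat

/-! ### Adjunction spaces -/

/-- The relation on `X ⊔ Y` that relates each `x ∈ B ⊆ X` to `f x ∈ Y`. -/
def GlueRel {X Y : Type*} {B : Set X} (f : B → Y) : X ⊕ Y → X ⊕ Y → Prop :=
  fun a b => ∃ x : B, a = Sum.inl (x : X) ∧ b = Sum.inr (f x)

/-- The adjunction space `X ∪_f Y`: the quotient of `X ⊔ Y` by the equivalence relation
generated by `x ∼ f x` for `x ∈ B`. -/
def AdjunctionSpace {X Y : Type*} {B : Set X} (f : B → Y) : Type _ :=
  Quot (GlueRel f)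

/-- The adjunction space carries the quotient topology of the disjoint union topology. -/
instance {X Y : Type*} [TopologicalSpace X] [TopologicalSpace Y] {B : Set X} (f : B → Y) :
    TopologicalSpace (AdjunctionSpace f) :=
  inferInstanceAs (TopologicalSpace (Quot (GlueRel f)))

/-! ### Generalized dunce hats -/

/-- The boundary circle of the disk `Δ`, where `φ` is a homeomorphism from the closed unit disk
in the plane onto `Δ`. -/
def boundary {Δ : Type*} [TopologicalSpace Δ] (φ : Metric.closedBall (0 : ℂ) 1 ≃ₜ Δ) : Set Δ :=
  φ '' {z | ‖(z : ℂ)‖ = 1}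

/-- The condition on the attaching map `f` of a generalized dunce hat with singular vertex `v`:
`f` is continuous, the fibre over `v` is finite with at least three points, and `f` maps every
connected component of the complement of that fibre homeomorphically onto `J - {v}`. -/
structure IsDunceAttachingMap {S J : Type*} [TopologicalSpace S] [TopologicalSpace J]
    (f : S → J) (v : J) : Prop where
  continuous : Continuous f
  finite_fibre : (f ⁻¹' {v}).Finite
  three_le_ncard : 3 ≤ (f ⁻¹' {v}).ncard
  isEmbedding_component : ∀ x, f x ≠ v →
    IsEmbedding ((connectedComponentIn (f ⁻¹' {v})ᶜ x).domRestrict f)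
  image_component : ∀ x, f x ≠ v →
    f '' connectedComponentIn (f ⁻¹' {v})ᶜ x = {v}ᶜ

/-! ### Simplicial collapse -/

/-- `K` collapses to `L` by one elementary collapse: `s` is a free face of `K`, properly contained
in exactly one simplex `t` of `K`, of one dimension more, and `L` is `K` with `s` and `t`
removed. -/
def ElementaryCollapse {n : ℕ} (K L : Geometry.SimplicialComplex ℝ (Fin n → ℝ)) : Prop :=
  ∃ s ∈ K.faces, ∃ t ∈ K.faces, s ⊂ t ∧ t.card = s.card + 1 ∧
    (∀ u ∈ K.faces, s ⊂ u → u = t) ∧ L.faces = K.faces \ {s, t}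

/-- A complex is collapsible if finitely many elementary collapses reduce it to one vertex. -/
def CollapsibleComplex {n : ℕ} (K : Geometry.SimplicialComplex ℝ (Fin n → ℝ)) : Prop :=
  ∃ (L : Geometry.SimplicialComplex ℝ (Fin n → ℝ)) (w : Fin n → ℝ),
    L.faces = {{w}} ∧ Relation.ReflTransGen ElementaryCollapse K L

/-! ### Triangulated spaces, subpolyhedra, collapsibility -/

/-- A (finite) triangulation of a topological space `X`: a finite simplicial complex in some
`ℝⁿ` together with a homeomorphism of its underlying space onto `X`. -/
structure Triangulation (X : Type*) [TopologicalSpace X] where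
  n : ℕ
  complex : Geometry.SimplicialComplex ℝ (Fin n → ℝ)
  finite_faces : complex.faces.Finite
  homeo : complex.space ≃ₜ X

variable {X : Type*} [TopologicalSpace X]

/-- The subset of `ℝⁿ` that corresponds to `A ⊆ X` under the triangulation. -/
def Triangulation.trace (T : Triangulation X) (A : Set X) : Set (Fin T.n → ℝ) :=
  Subtype.val '' (T.homeo ⁻¹' A)

/-- `A ⊆ X` is a subpolyhedron of `X` with respect to the piecewise linear structure given by `T`:
it corresponds to the underlying space of a finite simplicial complex, whose simplices are
linear in the underlying space of `T` but need not be simplices of `T`. -/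
def IsSubpolyhedron (T : Triangulation X) (A : Set X) : Prop :=
  ∃ L : Geometry.SimplicialComplex ℝ (Fin T.n → ℝ), L.faces.Finite ∧ L.space = T.trace A

/-- `A ⊆ X` is collapsible with respect to the piecewise linear structure given by `T`: some
finite simplicial complex that triangulates it piecewise linearly collapses to a vertex. -/
def IsCollapsible (T : Triangulation X) (A : Set X) : Prop :=
  ∃ L : Geometry.SimplicialComplex ℝ (Fin T.n → ℝ), L.faces.Finite ∧ L.space = T.trace A ∧
    CollapsibleComplex L

end DunceHat

/-!
Three collapsible subpolyhedra cover a generalized dunce hat `D` for a reason that has little to do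
with its attaching map: they exist in every connected complex `K` of dimension two
(`exists_three_collapsible`). Let `K'` and `K''` be the first and second barycentric subdivisions.
A vertex of `K'` is the barycenter of a simplex of `K`, and the number of vertices of that simplex
is its colour, so that each simplex of `K'` has at most one vertex of each of the three colours.
Choose a spanning tree `T` of the 1-skeleton of `K'`, and let `A i` be the union of the subdivided
tree with the stars in `K''` of the vertices of `K'` of colour `i`. Every simplex of `K''` is a flag
of simplices of `K'`, and lies in the star of every vertex of the smallest member of the flag, so
the `A i` cover `K`. Stars of vertices of the same colour are disjoint, because these vertices are
not joined by edges, and each star is a cone that collapses onto its intersection with the tree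
(`starUnion_collapses`); the tree collapses to a vertex. No `A i` is everything, because a triangle
of `K'` has a vertex of another colour.

It remains to see that every triangulation of `D` has dimension two. The open disk is dense in `D`,
so the relative interior of a facet, which is open in `D`, contains an open copy of
a finite-dimensional real vector space that embeds openly in the plane. Such a vector space has
dimension two (`finrank_eq_two_of_isOpenEmbedding`): in any other dimension, `z ↦ z - z₀` would have
a continuous logarithm on a punctured neighbourhood of `z₀`, hence along a circle around `z₀`.

For the existence of a triangulation (`nonempty_triangulation`), identify `J` with the boundary of
a triangle, in such a way that `v` becomes a vertex with a small star (`exists_isTriangleCoord`).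
Then the attaching map is simplicial for the subdivision of the boundary of the disk by the
preimages of the three vertices (`IsDunceAttachingMap.exists_isRing`). The disk is the cone on
a copy of that boundary at radius 1/2, together with the annulus outside, and the image of
the annulus in `D` is the mapping cylinder of a simplicial map, triangulated by the staircase
subdivision of its prisms. The barycentric coordinates that result, `diskCoord`, descend to
an injective map from `D` to a standard simplex, and the image is a union of closed faces; these
faces form the required complex (`nonempty_triangulation_of_coordinates`).
-/

namespace DunceHat

/-! ### Geometric realization of abstract complexes -/

section Realization

variable {I E : Type*} [DecidableEq I] [DecidableEq E] [AddCommGroup E] [Module ℝ E]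

/-- `w` is a system of barycentric weights carried by the finite set `c`. -/
structure IsWeight (c : Finset I) (w : I → ℝ) : Prop where
  nonneg : ∀ i, 0 ≤ w i
  eq_zero : ∀ i, i ∉ c → w i = 0
  sum_eq_one : ∑ i ∈ c, w i = 1

omit [DecidableEq I] in
lemma IsWeight.mono {c d : Finset I} {w : I → ℝ} (h : IsWeight c w) (hcd : c ⊆ d) :
    IsWeight d w where
  nonneg := h.nonneg
  eq_zero i hi := h.eq_zero i fun h' => hi (hcd h')
  sum_eq_one := by
    rw [← h.sum_eq_one]
    exact (Finset.sum_subset hcd fun i _ hi => h.eq_zero i hi).symm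

omit [DecidableEq I] [DecidableEq E] in
lemma IsWeight.sum_smul_eq {c d : Finset I} {w : I → ℝ} (h : IsWeight c w) (hcd : c ⊆ d)
    (p : I → E) : ∑ i ∈ c, w i • p i = ∑ i ∈ d, w i • p i :=
  Finset.sum_subset hcd fun i _ hi => by rw [h.eq_zero i hi, zero_smul]

omit [DecidableEq I] in
lemma IsWeight.restrict {c d : Finset I} {w : I → ℝ} (h : IsWeight c w) (hdc : d ⊆ c)
    (hd : ∀ i, i ∉ d → w i = 0) : IsWeight d w where
  nonneg := h.nonneg
  eq_zero := hd
  sum_eq_one := by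
    rw [← h.sum_eq_one]
    exact Finset.sum_subset hdc fun i _ hi => hd i hi

omit [DecidableEq I] in
lemma IsWeight.nonempty {c : Finset I} {w : I → ℝ} (h : IsWeight c w) : c.Nonempty := by
  rw [Finset.nonempty_iff_ne_empty]
  rintro rfl
  simpa using h.sum_eq_one

lemma isWeight_single {c : Finset I} {i : I} (hi : i ∈ c) :
    IsWeight c (Pi.single i (1 : ℝ)) where
  nonneg j := by
    by_cases h : j = i
    · subst h; simp
    · simp [h]
  eq_zero j hj := by
    have : j ≠ i := fun h => hj (h ▸ hi)
    simp [this]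
  sum_eq_one := by simp [Pi.single_apply, hi]

lemma mem_convexHull_image {c : Finset I} {p : I → E} {x : E} :
    x ∈ convexHull ℝ ((c.image p : Finset E) : Set E) ↔
      ∃ w, IsWeight c w ∧ ∑ i ∈ c, w i • p i = x := by
  constructor
  · intro hx
    have hconv : Convex ℝ {x : E | ∃ w, IsWeight c w ∧ ∑ i ∈ c, w i • p i = x} := by
      rintro _ ⟨w, hw, rfl⟩ _ ⟨w', hw', rfl⟩ a b ha hb hab
      refine ⟨fun i => a * w i + b * w' i, ⟨fun i => ?_, fun i hi => ?_, ?_⟩, ?_⟩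
      · exact add_nonneg (mul_nonneg ha (hw.nonneg i)) (mul_nonneg hb (hw'.nonneg i))
      · rw [hw.eq_zero i hi, hw'.eq_zero i hi]; simp
      · rw [Finset.sum_add_distrib, ← Finset.mul_sum, ← Finset.mul_sum, hw.sum_eq_one,
          hw'.sum_eq_one]
        simpa using hab
      · simp only [add_smul, mul_smul, Finset.sum_add_distrib, Finset.smul_sum]
    refine convexHull_min ?_ hconv hx
    intro y hy
    obtain ⟨i, hi, rfl⟩ := Finset.mem_image.1 (Finset.mem_coe.1 hy)
    refine ⟨Pi.single i 1, isWeight_single hi, ?_⟩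
    rw [Finset.sum_eq_single i (fun j _ hj => by simp [hj]) (fun h => (h hi).elim)]
    simp
  · rintro ⟨w, hw, rfl⟩
    exact (convex_convexHull ℝ _).sum_mem (fun i _ => hw.nonneg i) hw.sum_eq_one fun i hi =>
      subset_convexHull ℝ _ (Finset.mem_coe.2 (Finset.mem_image_of_mem p hi))

omit [DecidableEq E] in
lemma mem_convexHull_iff_isWeight [DecidableEq E] {c : Finset E} {x : E} :
    x ∈ convexHull ℝ (c : Set E) ↔ ∃ w, IsWeight c w ∧ ∑ i ∈ c, w i • i = x := by
  simpa using mem_convexHull_image (c := c) (p := id) (x := x)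

/-- An abstract complex whose vertices are points of a vector space is a geometric complex as soon
as its simplices meet properly: by Radon's theorem, affinely dependent vertices of a simplex would
split into two faces with disjoint vertex sets and intersecting convex hulls. -/
def ofInter (A : PreAbstractSimplicialComplex E)
    (h : ∀ {s t : Finset E}, s ∈ A.faces → t ∈ A.faces →
      convexHull ℝ (s : Set E) ∩ convexHull ℝ (t : Set E) ⊆ convexHull ℝ (s ∩ t : Set E)) :
    Geometry.SimplicialComplex ℝ E where
  toPreAbstractSimplicialComplex := A
  inter_subset_convexHull := h
  indep := by
    intro s hs
    by_contra hdep
    obtain ⟨J, x, hx₁, hx₂⟩ := Convex.radon_partition hdep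
    classical
    have key : ∀ J : Set s, ∀ x, x ∈ convexHull ℝ ((↑) '' J : Set E) →
        (s.attach.filter (· ∈ J)).image (↑) ∈ A.faces ∧
        (((s.attach.filter (· ∈ J)).image (↑) : Finset E) : Set E) = (↑) '' J := by
      intro J x hx
      have hcoe : (((s.attach.filter (· ∈ J)).image (↑) : Finset E) : Set E) = (↑) '' J := by
        ext y; simp
      refine ⟨(A.isRelLowerSet_faces hs).2 ?_ ?_, hcoe⟩
      · intro y hy
        obtain ⟨z, -, rfl⟩ := Finset.mem_image.1 hy
        exact z.2
      · rw [← Finset.coe_nonempty, hcoe]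
        exact convexHull_nonempty_iff.1 ⟨x, hx⟩
    obtain ⟨h₁, e₁⟩ := key J x hx₁
    obtain ⟨h₂, e₂⟩ := key Jᶜ x hx₂
    have := h h₁ h₂ ⟨by rwa [e₁], by rwa [e₂]⟩
    rw [e₁, e₂, ← Set.image_inter Subtype.val_injective, Set.inter_compl_self, Set.image_empty,
      convexHull_empty] at this
    exact this

/-- The points `p i` realize the abstract complex `A`: barycentric weights carried by simplices
of `A` are determined by the point that they represent. -/
def UniqueWeights (p : I → E) (A : PreAbstractSimplicialComplex I) : Prop :=
  ∀ c ∈ A.faces, ∀ c' ∈ A.faces, ∀ w w' : I → ℝ, IsWeight c w → IsWeight c' w' →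
    ∑ i ∈ c, w i • p i = ∑ i ∈ c', w' i • p i → w = w'

omit [DecidableEq I] [DecidableEq E] in
lemma UniqueWeights.mono {p : I → E} {A B : PreAbstractSimplicialComplex I}
    (h : UniqueWeights p A) (hBA : B.faces ⊆ A.faces) : UniqueWeights p B :=
  fun c hc c' hc' => h c (hBA hc) c' (hBA hc')

omit [DecidableEq E] in
/-- The vertex map is injective on the vertices of the complex. -/
lemma UniqueWeights.injOn {p : I → E} {A : PreAbstractSimplicialComplex I}
    (h : UniqueWeights p A) {s t : Finset I} (hs : s ∈ A.faces) (ht : t ∈ A.faces) {i j : I}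
    (hi : i ∈ s) (hj : j ∈ t) (hij : p i = p j) : i = j := by
  have sum_single : ∀ {s : Finset I} {i : I}, i ∈ s →
      ∑ k ∈ s, (Pi.single i (1 : ℝ) : I → ℝ) k • p k = p i := by
    intro s i hi
    rw [Finset.sum_eq_single i (fun j _ hj => by simp [hj]) (fun h => (h hi).elim)]
    simp
  have := h s hs t ht _ _ (isWeight_single hi) (isWeight_single hj)
    (by rw [sum_single hi, sum_single hj, hij])
  by_contra hne
  have h' := congrFun this i
  simp [hne] at h'

/-- The geometric complex with the vertices `p i` spanned by an abstract complex. -/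
def realize (p : I → E) (A : PreAbstractSimplicialComplex I) (h : UniqueWeights p A) :
    Geometry.SimplicialComplex ℝ E :=
  ofInter (A.map p) (by
    rintro _ _ ⟨s, hs, rfl⟩ ⟨t, ht, rfl⟩ x ⟨hx₁, hx₂⟩
    obtain ⟨w, hw, rfl⟩ := mem_convexHull_image.1 hx₁
    obtain ⟨w', hw', hww'⟩ := mem_convexHull_image.1 hx₂
    obtain rfl := h s hs t ht w w' hw hw' hww'.symm
    have hw₀ : IsWeight (s ∩ t) w := hw.restrict Finset.inter_subset_left fun i hi => by
      rw [Finset.mem_inter, not_and_or] at hi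
      exact hi.elim (hw.eq_zero i) (hw'.eq_zero i)
    rw [← hw₀.sum_smul_eq Finset.inter_subset_left]
    have : ∑ i ∈ s ∩ t, w i • p i ∈ convexHull ℝ (((s ∩ t).image p : Finset E) : Set E) :=
      mem_convexHull_image.2 ⟨w, hw₀, rfl⟩
    refine convexHull_mono ?_ this
    rw [← Finset.coe_inter, Finset.coe_subset]
    exact Finset.image_inter_subset p s t)

lemma realize_faces (p : I → E) (A : PreAbstractSimplicialComplex I) (h : UniqueWeights p A) :
    (realize p A h).faces = (fun s : Finset I => s.image p) '' A.faces := rfl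

lemma mem_space_realize {p : I → E} {A : PreAbstractSimplicialComplex I} {h : UniqueWeights p A}
    {x : E} : x ∈ (realize p A h).space ↔
      ∃ c ∈ A.faces, ∃ w, IsWeight c w ∧ ∑ i ∈ c, w i • p i = x := by
  rw [Geometry.SimplicialComplex.mem_space_iff, realize_faces]
  simp only [Set.exists_mem_image, mem_convexHull_image]

end Realization

/-! ### Collapses of abstract complexes -/

/-- The elementary collapse of abstract complexes. -/
def AbsCollapse {I : Type*} (A B : PreAbstractSimplicialComplex I) : Prop :=
  ∃ s ∈ A.faces, ∃ t ∈ A.faces, s ⊂ t ∧ t.card = s.card + 1 ∧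
    (∀ u ∈ A.faces, s ⊂ u → u = t) ∧ B.faces = A.faces \ {s, t}

lemma AbsCollapse.faces_subset {I : Type*} {A B : PreAbstractSimplicialComplex I}
    (h : AbsCollapse A B) : B.faces ⊆ A.faces := by
  obtain ⟨s, -, t, -, -, -, -, h⟩ := h
  rw [h]
  exact Set.sdiff_subset

lemma reflTransGen_faces_subset {I : Type*} {A B : PreAbstractSimplicialComplex I}
    (h : Relation.ReflTransGen AbsCollapse A B) : B.faces ⊆ A.faces := by
  induction h with
  | refl => exact subset_rfl
  | tail _ h ih => exact h.faces_subset.trans ih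

section Transport

variable {I : Type*} [DecidableEq I] {n : ℕ}

lemma AbsCollapse.realize {p : I → Fin n → ℝ} {A B : PreAbstractSimplicialComplex I}
    (h : AbsCollapse A B) (hA : UniqueWeights p A) :
    ElementaryCollapse (realize p A hA) (DunceHat.realize p B (hA.mono h.faces_subset)) := by
  obtain ⟨s, hs, t, ht, hst, hcard, huniq, hB⟩ := h
  have hinj : ∀ {u}, u ∈ A.faces → Set.InjOn p (u : Set I) := fun hu i hi j hj hij =>
    hA.injOn hu hu hi hj hij
  -- images of simplices are contained in each other only if the simplices are
  have hsub : ∀ {u v}, u ∈ A.faces → v ∈ A.faces → u.image p ⊆ v.image p → u ⊆ v := by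
    intro u v hu hv huv i hi
    obtain ⟨j, hj, hij⟩ := Finset.mem_image.1 (huv (Finset.mem_image_of_mem p hi))
    rwa [← hA.injOn hv hu hj hi hij]
  have hssub : ∀ {u v}, u ∈ A.faces → v ∈ A.faces → (u.image p ⊂ v.image p ↔ u ⊂ v) := by
    intro u v hu hv
    constructor
    · exact fun h => ⟨hsub hu hv h.1, fun h' => h.2 (Finset.image_subset_image h')⟩
    · exact fun h => ⟨Finset.image_subset_image h.1, fun h' => h.2 (hsub hv hu h')⟩
  refine ⟨s.image p, ⟨s, hs, rfl⟩, t.image p, ⟨t, ht, rfl⟩, (hssub hs ht).2 hst, ?_, ?_, ?_⟩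
  · rw [Finset.card_image_of_injOn (hinj hs), Finset.card_image_of_injOn (hinj ht), hcard]
  · rintro _ ⟨u, hu, rfl⟩ hsu
    rw [huniq u hu ((hssub hs hu).1 hsu)]
  · rw [realize_faces, realize_faces, hB]
    ext x
    simp only [Set.mem_image, Set.mem_sdiff, Set.mem_insert_iff, Set.mem_singleton_iff]
    constructor
    · rintro ⟨u, ⟨hu, hne⟩, rfl⟩
      refine ⟨⟨u, hu, rfl⟩, fun h => hne ?_⟩
      rcases h with h | h
      · exact Or.inl ((hsub hu hs h.subset).antisymm (hsub hs hu h.symm.subset))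
      · exact Or.inr ((hsub hu ht h.subset).antisymm (hsub ht hu h.symm.subset))
    · rintro ⟨⟨u, hu, rfl⟩, hne⟩
      exact ⟨u, ⟨hu, fun h => hne (h.imp (fun e => by rw [e]) fun e => by rw [e])⟩, rfl⟩

lemma collapsibleComplex_realize {p : I → Fin n → ℝ} {A B : PreAbstractSimplicialComplex I}
    (h : Relation.ReflTransGen AbsCollapse A B) {i : I} (hB : B.faces = {{i}})
    (hA : UniqueWeights p A) : CollapsibleComplex (realize p A hA) := by
  refine ⟨realize p B (hA.mono (reflTransGen_faces_subset h)), p i, ?_, ?_⟩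
  · rw [realize_faces, hB]; simp
  · induction h using Relation.ReflTransGen.head_induction_on with
    | refl => exact Relation.ReflTransGen.refl
    | head h' _ ih => exact (ih (hA.mono h'.faces_subset)).head (h'.realize hA)

end Transport

/-! ### Collapsing unions of stars -/

section AbstractCollapse

variable {I : Type*} [DecidableEq I]

omit [DecidableEq I] in
lemma mem_faces_of_subset (A : PreAbstractSimplicialComplex I) {s t : Finset I}
    (hs : s ∈ A.faces) (hts : t ⊆ s) (ht : t.Nonempty) : t ∈ A.faces :=
  (A.isRelLowerSet_faces hs).2 hts ht

omit [DecidableEq I] in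
lemma nonempty_of_mem_faces (A : PreAbstractSimplicialComplex I) {s : Finset I}
    (hs : s ∈ A.faces) : s.Nonempty :=
  (A.isRelLowerSet_faces hs).1

omit [DecidableEq I] in
lemma singleton_mem_faces (A : PreAbstractSimplicialComplex I) {s : Finset I}
    (hs : s ∈ A.faces) {i : I} (hi : i ∈ s) : {i} ∈ A.faces :=
  mem_faces_of_subset A hs (Finset.singleton_subset_iff.2 hi) (Finset.singleton_nonempty i)

lemma absCollapse_of_faces_eq_union {A B : PreAbstractSimplicialComplex I} {s : Finset I} {a : I}
    (hs : s.Nonempty) (hsB : s ∉ B.faces) (ha : a ∉ s)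
    (hA : A.faces = B.faces ∪ {s, insert a s}) : AbsCollapse A B := by
  have hlow : ∀ u ∈ B.faces, ¬ s ⊆ u := fun u hu hsu => hsB (mem_faces_of_subset B hu hsu hs)
  refine ⟨s, by simp [hA], insert a s, by simp [hA], Finset.ssubset_insert ha,
    Finset.card_insert_of_notMem ha, ?_, ?_⟩
  · intro u hu hsu
    rw [hA] at hu
    rcases hu with hu | rfl | rfl
    · exact (hlow u hu hsu.1).elim
    · exact (hsu.2 subset_rfl).elim
    · rfl
  · rw [hA]
    ext u
    simp only [Set.mem_sdiff, Set.mem_union, Set.mem_insert_iff, Set.mem_singleton_iff]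
    constructor
    · intro hu
      refine ⟨Or.inl hu, ?_⟩
      rintro (rfl | rfl)
      · exact hsB hu
      · exact hlow _ hu (Finset.subset_insert a s)
    · rintro ⟨h | h, h'⟩
      · exact h
      · exact (h' h).elim

/-- The simplices of `A` that are not in the subcomplex `B` are matched in pairs `f`, `f ∪ {a f}`,
where the apex `a f` is the same for all simplices comparable with `f`. Removing the pairs in order
of decreasing dimension collapses `A` to `B`. -/
lemma reflTransGen_absCollapse_of_apex {B : PreAbstractSimplicialComplex I} (a : Finset I → I)
    (A : PreAbstractSimplicialComplex I) (hfin : A.faces.Finite) (hBA : B.faces ⊆ A.faces)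
    (hins : ∀ f ∈ A.faces \ B.faces, insert (a f) f ∈ A.faces)
    (hera : ∀ f ∈ A.faces \ B.faces, f.erase (a f) ∈ A.faces \ B.faces)
    (ha : ∀ f ∈ A.faces \ B.faces, ∀ g ∈ A.faces \ B.faces, f ⊆ g → a f = a g) :
    Relation.ReflTransGen AbsCollapse A B := by
  induction hn : (A.faces \ B.faces).ncard using Nat.strong_induction_on generalizing A with
  | _ n ih =>
  subst hn
  rcases (A.faces \ B.faces).eq_empty_or_nonempty with hemp | hne
  · have : A = B := PreAbstractSimplicialComplex.ext
      ((Set.sdiff_eq_empty.1 hemp).antisymm hBA)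
    rw [this]
  have hfin' : (A.faces \ B.faces).Finite := hfin.subset Set.sdiff_subset
  have hup : ∀ f ∈ A.faces \ B.faces, ∀ g ∈ A.faces, f ⊆ g → g ∈ A.faces \ B.faces :=
    fun f hf g hg hfg => ⟨hg, fun hgB => hf.2 (mem_faces_of_subset B hgB hfg
      (nonempty_of_mem_faces A hf.1))⟩
  obtain ⟨g, hg, hmax⟩ := Set.exists_max_image _ Finset.card hfin' hne
  have hag : a g ∈ g := by
    by_contra h
    have := hmax _ (hup g hg _ (hins g hg) (Finset.subset_insert _ _))
    rw [Finset.card_insert_of_notMem h] at this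
    omega
  obtain ⟨s, hs_def⟩ : ∃ s, s = g.erase (a g) := ⟨_, rfl⟩
  have hs : s ∈ A.faces \ B.faces := hs_def ▸ hera g hg
  have hgs : insert (a g) s = g := by rw [hs_def, Finset.insert_erase hag]
  have has : a g ∉ s := by simp [hs_def]
  have hsg : s ⊆ g := hgs ▸ Finset.subset_insert _ _
  -- `g` is a facet and `s` is a free face of it
  have hfacet : ∀ u ∈ A.faces, g ⊆ u → u = g := fun u hu hgu =>
    (Finset.eq_of_subset_of_card_le hgu (hmax u (hup g hg u hu hgu))).symm
  have hfree : ∀ u ∈ A.faces, s ⊂ u → u = g := by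
    intro u hu hsu
    have hu' := hup s hs u hu hsu.1
    have hau : a u = a g := (ha s hs u hu' hsu.1).symm.trans (ha s hs g hg hsg)
    have h₁ : insert (a u) u = g := by
      refine hfacet _ (hins u hu') ?_
      rw [← hgs, hau]
      exact Finset.insert_subset_insert _ hsu.1
    have h₂ : u ⊆ g := h₁ ▸ Finset.subset_insert _ _
    refine Finset.eq_of_subset_of_card_le h₂ ?_
    rw [← hgs, Finset.card_insert_of_notMem has]
    exact Finset.card_lt_card hsu
  let A' : PreAbstractSimplicialComplex I :=
    { faces := A.faces \ {s, g}
      isRelLowerSet_faces := by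
        rintro u ⟨hu, hne⟩
        refine ⟨nonempty_of_mem_faces A hu, fun v hvu hv => ⟨mem_faces_of_subset A hu hvu hv, ?_⟩⟩
        rintro (rfl | rfl)
        · rcases hvu.lt_or_eq with h | h
          · exact hne (Or.inr (hfree u hu h))
          · exact hne (Or.inl h.symm)
        · exact hne (Or.inr (hfacet u hu hvu)) }
  have hA' : A'.faces = A.faces \ {s, g} := rfl
  have hBA' : B.faces ⊆ A'.faces := fun u hu => ⟨hBA hu, by
    rintro (rfl | rfl)
    · exact hs.2 hu
    · exact hg.2 hu⟩
  have hsub : A'.faces \ B.faces ⊆ A.faces \ B.faces := fun u hu => ⟨hu.1.1, hu.2⟩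
  have hstep : AbsCollapse A A' := by
    refine ⟨s, hs.1, g, hg.1, ⟨hsg, fun h => has (h hag)⟩, ?_, hfree, rfl⟩
    rw [← hgs, Finset.card_insert_of_notMem has]
  refine Relation.ReflTransGen.head hstep (ih _ ?_ A' ?_ hBA' ?_ ?_ ?_ rfl)
  · refine Set.ncard_lt_ncard ⟨hsub, fun h => ?_⟩ hfin'
    exact (h hg).1.2 (Or.inr rfl)
  · exact hfin.subset Set.sdiff_subset
  · intro f hf
    refine ⟨hins f (hsub hf), ?_⟩
    rintro (h | h)
    · have hfs : f ⊆ s := h ▸ Finset.subset_insert _ _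
      refine has ?_
      rw [← ha f (hsub hf) g hg (hfs.trans hsg), ← h]
      exact Finset.mem_insert_self _ _
    · have hfg : f ⊆ g := h ▸ Finset.subset_insert _ _
      have hafg := ha f (hsub hf) g hg hfg
      by_cases haf : a f ∈ f
      · exact hf.1.2 (Or.inr (by rw [← h, Finset.insert_eq_of_mem haf]; rfl))
      · refine hf.1.2 (Or.inl ?_)
        have h' : insert (a f) f = g := h
        rw [hs_def, ← hafg, ← h', Finset.erase_insert haf]
  · intro f hf
    refine ⟨⟨(hera f (hsub hf)).1, ?_⟩, (hera f (hsub hf)).2⟩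
    rintro (h | h)
    · have hafg : a f = a g := by
        rw [← ha s hs f (hsub hf) (h ▸ Finset.erase_subset _ _), ha s hs g hg hsg]
      by_cases haf : a f ∈ f
      · exact hf.1.2 (Or.inr (by rw [← hgs, ← h, ← hafg, Finset.insert_erase haf]; rfl))
      · exact hf.1.2 (Or.inl (by rw [← h, Finset.erase_eq_of_notMem haf]))
    · have hgf : g ⊆ f := h ▸ Finset.erase_subset _ _
      exact hf.1.2 (Or.inr (hfacet f hf.1.1 hgf))
  · exact fun f hf g hg => ha f (hsub hf) g (hsub hg)

/-- The flags of `A`, that is, the simplices of its barycentric subdivision. -/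
def flags (A : PreAbstractSimplicialComplex I) : PreAbstractSimplicialComplex (Finset I) where
  faces := {f | f.Nonempty ∧ (∀ τ ∈ f, τ ∈ A.faces) ∧ IsChain (· ⊆ ·) (f : Set (Finset I))}
  isRelLowerSet_faces := by
    intro f hf
    exact ⟨hf.1, fun g hgf hg => ⟨hg, fun τ hτ => hf.2.1 τ (hgf hτ),
      hf.2.2.mono (Finset.coe_subset.2 hgf)⟩⟩

omit [DecidableEq I] in
lemma flags_mono {A B : PreAbstractSimplicialComplex I} (h : B.faces ⊆ A.faces) :
    (flags B).faces ⊆ (flags A).faces :=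
  fun _ hf => ⟨hf.1, fun τ hτ => h (hf.2.1 τ hτ), hf.2.2⟩

omit [DecidableEq I] in
lemma finite_flags {A : PreAbstractSimplicialComplex I} (h : A.faces.Finite) :
    (flags A).faces.Finite := by
  refine (h.toFinset.powerset.finite_toSet).subset fun f hf => ?_
  rw [Finset.mem_coe, Finset.mem_powerset]
  exact fun τ hτ => h.mem_toFinset.2 (hf.2.1 τ hτ)

/-- The union of the barycentric subdivision of `T` and the closed stars, in the barycentric
subdivision of `A`, of the vertices in `X`. -/
def starUnion (A T : PreAbstractSimplicialComplex I) (X : Set I) :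
    PreAbstractSimplicialComplex (Finset I) where
  faces := {f | f ∈ (flags A).faces ∧ ((∀ τ ∈ f, τ ∈ T.faces) ∨ ∃ x ∈ X, ∀ τ ∈ f, x ∈ τ)}
  isRelLowerSet_faces := fun _ hf => ⟨hf.1.1, fun _ hgf hg =>
    ⟨mem_faces_of_subset _ hf.1 hgf hg, hf.2.imp (fun h τ hτ => h τ (hgf hτ))
      fun ⟨x, hx, h⟩ => ⟨x, hx, fun τ hτ => h τ (hgf hτ)⟩⟩⟩

/-- If no two vertices in `X` are joined by an edge, then their stars in the subdivision are
disjoint cones, and each of them collapses to its intersection with the subdivision of `T`. -/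
lemma starUnion_collapses {A T : PreAbstractSimplicialComplex I} {X : Set I}
    (hfin : A.faces.Finite) (hTA : T.faces ⊆ A.faces) (hXT : ∀ x ∈ X, {x} ∈ T.faces)
    (hX : ∀ τ ∈ A.faces, ∀ x ∈ X, ∀ y ∈ X, x ∈ τ → y ∈ τ → x = y) :
    Relation.ReflTransGen AbsCollapse (starUnion A T X) (flags T) := by
  classical
  let a : Finset (Finset I) → Finset I := fun f =>
    if h : ∃ x ∈ X, ∀ τ ∈ f, x ∈ τ then {h.choose} else ∅
  have ha : ∀ f ∈ (flags A).faces, ∀ x ∈ X, (∀ τ ∈ f, x ∈ τ) → a f = {x} := by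
    intro f hf x hx hxf
    have h : ∃ x ∈ X, ∀ τ ∈ f, x ∈ τ := ⟨x, hx, hxf⟩
    obtain ⟨τ, hτ⟩ := hf.1
    have : a f = {h.choose} := dif_pos h
    rw [this, hX τ (hf.2.1 τ hτ) _ h.choose_spec.1 x hx (h.choose_spec.2 τ hτ) (hxf τ hτ)]
  have hmem : ∀ f ∈ (starUnion A T X).faces \ (flags T).faces,
      f ∈ (flags A).faces ∧ (∃ τ ∈ f, τ ∉ T.faces) ∧ ∃ x ∈ X, (∀ τ ∈ f, x ∈ τ) ∧ a f = {x} := by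
    rintro f ⟨⟨hfA, hf⟩, hfT⟩
    have hnot : ¬ ∀ τ ∈ f, τ ∈ T.faces := fun h => hfT ⟨hfA.1, h, hfA.2.2⟩
    obtain ⟨x, hx, hxf⟩ := hf.resolve_left hnot
    push Not at hnot
    exact ⟨hfA, hnot, x, hx, hxf, ha f hfA x hx hxf⟩
  refine reflTransGen_absCollapse_of_apex a _ ?_ ?_ ?_ ?_ ?_
  · exact (finite_flags hfin).subset fun f hf => hf.1
  · exact fun f hf => ⟨flags_mono hTA hf, Or.inl hf.2.1⟩
  · intro f hf
    obtain ⟨hfA, -, x, hx, hxf, hax⟩ := hmem f hf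
    rw [hax]
    have hxf' : ∀ τ ∈ insert {x} f, x ∈ τ := by
      intro τ hτ
      rcases Finset.mem_insert.1 hτ with rfl | hτ
      · simp
      · exact hxf τ hτ
    refine ⟨⟨Finset.insert_nonempty _ _, fun τ hτ => ?_, ?_⟩, Or.inr ⟨x, hx, hxf'⟩⟩
    · rcases Finset.mem_insert.1 hτ with rfl | hτ
      · exact hTA (hXT x hx)
      · exact hfA.2.1 τ hτ
    · rw [Finset.coe_insert]
      exact hfA.2.2.insert fun τ hτ _ => Or.inl (Finset.singleton_subset_iff.2 (hxf τ hτ))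
  · intro f hf
    obtain ⟨hfA, ⟨τ, hτ, hτT⟩, x, hx, hxf, hax⟩ := hmem f hf
    have hτ' : τ ∈ f.erase (a f) := by
      refine Finset.mem_erase.2 ⟨?_, hτ⟩
      rintro rfl
      exact hτT (hax ▸ hXT x hx)
    exact ⟨mem_faces_of_subset _ hf.1 (Finset.erase_subset _ _) ⟨τ, hτ'⟩,
      fun h => hτT (h.2.1 τ hτ')⟩
  · intro f hf g hg hfg
    obtain ⟨-, -, x, hx, hxg, hax⟩ := hmem g hg
    rw [hax]
    exact ha f hf.1.1 x hx fun τ hτ => hxg τ (hfg hτ)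

/-! ### Spanning trees -/

/-- `T` is a subcomplex of `A` of dimension at most one whose barycentric subdivision collapses to
a vertex: a tree in the 1-skeleton of `A`. -/
structure IsTreeIn (A T : PreAbstractSimplicialComplex I) : Prop where
  subset : T.faces ⊆ A.faces
  card_le : ∀ τ ∈ T.faces, τ.card ≤ 2
  collapses : ∃ (B : PreAbstractSimplicialComplex (Finset I)) (i : I), {i} ∈ T.faces ∧
    B.faces = {{{i}}} ∧ Relation.ReflTransGen AbsCollapse (flags T) B

omit [DecidableEq I] in
lemma exists_isTreeIn_singleton {A : PreAbstractSimplicialComplex I} {i : I}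
    (hi : {i} ∈ A.faces) : ∃ T, IsTreeIn A T := by
  let T : PreAbstractSimplicialComplex I :=
    { faces := {{i}}
      isRelLowerSet_faces := by
        rintro _ rfl
        exact ⟨Finset.singleton_nonempty i, fun t ht hne =>
          (Finset.Nonempty.subset_singleton_iff hne).1 ht⟩ }
  refine ⟨T, ?_, ?_, flags T, i, rfl, ?_, Relation.ReflTransGen.refl⟩
  · rintro _ rfl
    exact hi
  · rintro _ rfl
    simp
  · ext f
    constructor
    · rintro ⟨hne, hf, -⟩
      exact Finset.eq_singleton_iff_nonempty_unique_mem.2 ⟨hne, hf⟩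
    · rintro rfl
      exact ⟨Finset.singleton_nonempty _, fun τ hτ => Finset.mem_singleton.1 hτ, by simp⟩

/-- Attaching a leaf `y` at the vertex `x` of a tree gives a tree. -/
lemma IsTreeIn.attach_leaf {A T : PreAbstractSimplicialComplex I} (hT : IsTreeIn A T) {x y : I}
    (hx : {x} ∈ T.faces) (hy : {y} ∉ T.faces) (hxy : {x, y} ∈ A.faces) :
    ∃ T', IsTreeIn A T' ∧ T'.faces = T.faces ∪ {{y}, {x, y}} := by
  have hne : x ≠ y := by rintro rfl; exact hy hx
  have hyT : ∀ τ ∈ T.faces, y ∉ τ := fun τ hτ h => hy (singleton_mem_faces T hτ h)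
  have hsub : ∀ t : Finset I, t.Nonempty → t ⊆ {x, y} → t = {x} ∨ t = {y} ∨ t = {x, y} := by
    intro t ht h
    by_cases h₁ : x ∈ t <;> by_cases h₂ : y ∈ t
    · exact Or.inr (Or.inr (h.antisymm (by simp [Finset.insert_subset_iff, h₁, h₂])))
    · refine Or.inl (Finset.eq_singleton_iff_nonempty_unique_mem.2 ⟨ht, fun z hz => ?_⟩)
      have := h hz
      simp only [Finset.mem_insert, Finset.mem_singleton] at this
      exact this.resolve_right fun e => h₂ (e ▸ hz)
    · refine Or.inr (Or.inl (Finset.eq_singleton_iff_nonempty_unique_mem.2 ⟨ht, fun z hz => ?_⟩))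
      have := h hz
      simp only [Finset.mem_insert, Finset.mem_singleton] at this
      exact this.resolve_left fun e => h₁ (e ▸ hz)
    · obtain ⟨z, hz⟩ := ht
      have := h hz
      simp only [Finset.mem_insert, Finset.mem_singleton] at this
      rcases this with rfl | rfl
      · exact (h₁ hz).elim
      · exact (h₂ hz).elim
  let T' : PreAbstractSimplicialComplex I :=
    { faces := T.faces ∪ {{y}, {x, y}}
      isRelLowerSet_faces := by
        intro s hs
        have hsne : s.Nonempty := by
          rcases hs with hs | rfl | rfl
          · exact nonempty_of_mem_faces T hs
          · simp
          · simp
        refine ⟨hsne, fun t hts ht => ?_⟩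
        rcases hs with hs | rfl | rfl
        · exact Or.inl (mem_faces_of_subset T hs hts ht)
        · exact Or.inr (Or.inl ((Finset.Nonempty.subset_singleton_iff ht).1 hts))
        · rcases hsub t ht hts with rfl | rfl | rfl
          · exact Or.inl hx
          · exact Or.inr (Or.inl rfl)
          · exact Or.inr (Or.inr rfl) }
  have hT' : ∀ τ, τ ∈ T'.faces ↔ τ ∈ T.faces ∨ τ = {y} ∨ τ = {x, y} := fun τ => Iff.rfl
  -- the flags of `T'` that do not contain the vertex `y`
  let M : PreAbstractSimplicialComplex (Finset I) :=
    { faces := {f | f ∈ (flags T').faces ∧ {y} ∉ f}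
      isRelLowerSet_faces := fun f hf => ⟨hf.1.1, fun g hgf hg =>
        ⟨mem_faces_of_subset _ hf.1 hgf hg, fun h => hf.2 (hgf h)⟩⟩ }
  have hM : ∀ f, f ∈ M.faces ↔ f ∈ (flags T').faces ∧ {y} ∉ f := fun f => Iff.rfl
  have hpair : ∀ {σ τ : Finset I}, σ ⊆ τ → σ ∈ T'.faces → τ ∈ T'.faces →
      {σ, τ} ∈ (flags T').faces := by
    intro σ τ h hσ hτ
    refine ⟨by simp, ?_, ?_⟩
    · simp [hσ, hτ]
    · rw [Finset.coe_pair]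
      exact IsChain.pair h
  have hcx : ({x} : Finset I) ⊆ {x, y} := by simp
  have hcy : ({y} : Finset I) ⊆ {x, y} := by simp
  have hxy_ne_y : ({x, y} : Finset I) ≠ {y} := by
    intro h; have : x ∈ ({y} : Finset I) := h ▸ by simp
    exact hne (Finset.mem_singleton.1 this)
  have hxy_ne_x : ({x, y} : Finset I) ≠ {x} := by
    intro h; have : y ∈ ({x} : Finset I) := h ▸ by simp
    exact hne (Finset.mem_singleton.1 this).symm
  have hxyT : {x, y} ∉ T.faces := fun h => hyT _ h (by simp)
  have two : ∀ {f : Finset (Finset I)} {σ τ : Finset I}, σ ∈ f →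
      (∀ ρ ∈ f, ρ = σ ∨ ρ = τ) → f = {σ} ∨ f = {τ, σ} := by
    intro f σ τ hσ h
    by_cases hτ : τ ∈ f
    · right
      ext ρ
      simp only [Finset.mem_insert, Finset.mem_singleton]
      constructor
      · exact fun hρ => (h ρ hρ).symm
      · rintro (rfl | rfl) <;> assumption
    · left
      refine Finset.eq_singleton_iff_unique_mem.2 ⟨hσ, fun ρ hρ => (h ρ hρ).resolve_right ?_⟩
      rintro rfl
      exact hτ hρ
  have h₁ : AbsCollapse (flags T') M := by
    refine absCollapse_of_faces_eq_union (s := {{y}}) (a := {x, y}) (by simp)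
      (fun h => h.2 (by simp)) (by simpa using hxy_ne_y) ?_
    ext f
    constructor
    · intro hf
      by_cases hyf : {y} ∈ f
      · right
        refine two hyf fun ρ hρ => ?_
        rcases (hT' ρ).1 (hf.2.1 ρ hρ) with h | h | h
        · rcases hf.2.2.total hyf hρ with h' | h'
          · exact (hyT ρ h (h' (by simp))).elim
          · exact Or.inl ((Finset.Nonempty.subset_singleton_iff (nonempty_of_mem_faces T h)).1 h')
        · exact Or.inl h
        · exact Or.inr h
      · exact Or.inl ⟨hf, hyf⟩
    · rintro (h | rfl | rfl)
      · exact h.1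
      · simpa using hpair (subset_refl {y}) ((hT' _).2 (by simp)) ((hT' _).2 (by simp))
      · rw [Finset.pair_comm]
        exact hpair hcy ((hT' _).2 (by simp)) ((hT' _).2 (by simp))
  have h₂ : AbsCollapse M (flags T) := by
    refine absCollapse_of_faces_eq_union (s := {{x, y}}) (a := {x}) (by simp)
      (fun h => hxyT (h.2.1 _ (by simp))) (by simpa using hxy_ne_x.symm) ?_
    ext f
    constructor
    · rintro ⟨hf, hyf⟩
      by_cases hxyf : {x, y} ∈ f
      · right
        refine two hxyf fun ρ hρ => ?_
        rcases (hT' ρ).1 (hf.2.1 ρ hρ) with h | h | h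
        · rcases hf.2.2.total hxyf hρ with h' | h'
          · exact (hyT ρ h (h' (by simp))).elim
          · rcases hsub ρ (nonempty_of_mem_faces T h) h' with rfl | rfl | rfl
            · exact Or.inr rfl
            · exact (hyf hρ).elim
            · exact Or.inl rfl
        · exact (hyf (h ▸ hρ)).elim
        · exact Or.inl h
      · refine Or.inl ⟨hf.1, fun ρ hρ => ?_, hf.2.2⟩
        rcases (hT' ρ).1 (hf.2.1 ρ hρ) with h | rfl | rfl
        · exact h
        · exact (hyf hρ).elim
        · exact (hxyf hρ).elim
    · rintro (h | rfl | rfl)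
      · exact ⟨flags_mono (A := T') (fun τ hτ => Or.inl hτ) h, fun hyf => hy (h.2.1 _ hyf)⟩
      · refine ⟨?_, by simpa using hxy_ne_y.symm⟩
        simpa using hpair (subset_refl {x, y}) ((hT' _).2 (by simp)) ((hT' _).2 (by simp))
      · refine ⟨hpair hcx ((hT' _).2 (Or.inl hx)) ((hT' _).2 (by simp)), ?_⟩
        simpa [hne.symm] using hxy_ne_y.symm
  obtain ⟨B, i, hi, hB, hcol⟩ := hT.collapses
  refine ⟨T', ⟨?_, ?_, B, i, Or.inl hi, hB, (hcol.head h₂).head h₁⟩, rfl⟩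
  · rintro τ (h | rfl | rfl)
    · exact hT.subset h
    · exact singleton_mem_faces A hxy (by simp)
    · exact hxy
  · rintro τ (h | rfl | rfl)
    · exact hT.card_le τ h
    · simp
    · exact Finset.card_le_two

/-- A finite complex with connected 1-skeleton contains a spanning tree. -/
lemma exists_spanning_tree {A : PreAbstractSimplicialComplex I} (hfin : A.faces.Finite)
    (hne : A.faces.Nonempty)
    (hconn : ∀ W : Set I, (∃ i ∈ W, {i} ∈ A.faces) →
      (∀ i ∈ W, ∀ j, {i, j} ∈ A.faces → j ∈ W) → ∀ j, {j} ∈ A.faces → j ∈ W) :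
    ∃ T, IsTreeIn A T ∧ ∀ i, {i} ∈ A.faces → {i} ∈ T.faces := by
  have key : ∀ k : ℕ, ∃ T, IsTreeIn A T ∧
      ((∀ i, {i} ∈ A.faces → {i} ∈ T.faces) ∨ k ≤ T.faces.ncard) := by
    intro k
    induction k with
    | zero =>
      obtain ⟨s, hs⟩ := hne
      obtain ⟨i, hi⟩ := nonempty_of_mem_faces A hs
      obtain ⟨T, hT⟩ := exists_isTreeIn_singleton (singleton_mem_faces A hs hi)
      exact ⟨T, hT, Or.inr (Nat.zero_le _)⟩
    | succ k ih =>
      obtain ⟨T, hT, h | h⟩ := ih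
      · exact ⟨T, hT, Or.inl h⟩
      by_cases hspan : ∀ i, {i} ∈ A.faces → {i} ∈ T.faces
      · exact ⟨T, hT, Or.inl hspan⟩
      have : ∃ x y, {x} ∈ T.faces ∧ {y} ∉ T.faces ∧ {x, y} ∈ A.faces := by
        by_contra hcon
        push Not at hcon
        obtain ⟨B, i, hi, -, -⟩ := hT.collapses
        refine hspan (hconn {i | ({i} : Finset I) ∈ T.faces} ⟨i, hi, hT.subset hi⟩ fun i hi j hij => ?_)
        by_contra hj
        exact hcon i j hi hj hij
      obtain ⟨x, y, hx, hy, hxy⟩ := this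
      obtain ⟨T', hT', hf⟩ := hT.attach_leaf hx hy hxy
      refine ⟨T', hT', Or.inr (h.trans_lt (Set.ncard_lt_ncard ?_ (hfin.subset hT'.subset)))⟩
      rw [hf]
      exact ⟨Set.subset_union_left, fun h => hy (h (Or.inr (Or.inl rfl)))⟩
  obtain ⟨T, hT, h | h⟩ := key (A.faces.ncard + 1)
  · exact ⟨T, hT, h⟩
  · exact absurd (Set.ncard_le_ncard hT.subset hfin) (by omega)

end AbstractCollapse

/-! ### Barycentric subdivision -/

section Layers

variable {V : Type*} [DecidableEq V]

omit [DecidableEq V] in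
/-- In a chain of finite sets, every nonempty member has a point outside all smaller members. -/
lemma exists_mem_forall_ssubset_notMem {D : Finset (Finset V)}
    (hD : IsChain (· ⊆ ·) (D : Set (Finset V))) {s : Finset V} (hs : s.Nonempty) :
    ∃ v ∈ s, ∀ t ∈ D, t ⊂ s → v ∉ t := by
  classical
  rcases (D.filter (· ⊂ s)).eq_empty_or_nonempty with h | h
  · obtain ⟨v, hv⟩ := hs
    refine ⟨v, hv, fun t ht hts => ?_⟩
    exact absurd (Finset.mem_filter.2 ⟨ht, hts⟩) (h ▸ Finset.notMem_empty t)
  · obtain ⟨t₁, ht₁, hmax⟩ := Finset.exists_max_image _ Finset.card h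
    obtain ⟨ht₁D, ht₁s⟩ := Finset.mem_filter.1 ht₁
    obtain ⟨v, hv, hvt⟩ := Finset.exists_of_ssubset ht₁s
    refine ⟨v, hv, fun t ht hts hvt' => hvt ?_⟩
    rcases hD.total ht ht₁D with h' | h'
    · exact h' hvt'
    · rwa [Finset.eq_of_subset_of_card_le h' (hmax t (Finset.mem_filter.2 ⟨ht, hts⟩))]

/-- The function `∑ μ s • χ_s` determines the nonnegative coefficients `μ`, if the sets `s` with
nonzero coefficient are nonempty and form a chain: they are superlevel sets of that function. -/
lemma layer_unique {c c' : Finset (Finset V)} (hc : IsChain (· ⊆ ·) (c : Set (Finset V)))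
    (hc' : IsChain (· ⊆ ·) (c' : Set (Finset V))) (hne : ∀ s ∈ c, s.Nonempty)
    (hne' : ∀ s ∈ c', s.Nonempty) {μ μ' : Finset V → ℝ} (hμ : ∀ s, 0 ≤ μ s) (hμ' : ∀ s, 0 ≤ μ' s)
    (h0 : ∀ s, s ∉ c → μ s = 0) (h0' : ∀ s, s ∉ c' → μ' s = 0)
    (h : ∀ v, ∑ s ∈ c, (if v ∈ s then μ s else 0) = ∑ s ∈ c', (if v ∈ s then μ' s else 0)) :
    μ = μ' := by
  -- members of the chain with positive coefficient are strict superlevel sets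
  have upper : ∀ {c : Finset (Finset V)} {μ : Finset V → ℝ},
      IsChain (· ⊆ ·) (c : Set (Finset V)) → (∀ s, 0 ≤ μ s) → ∀ s ∈ c, 0 < μ s →
      ∀ v ∈ s, ∀ u ∉ s, ∑ t ∈ c, (if u ∈ t then μ t else 0) <
        ∑ t ∈ c, (if v ∈ t then μ t else 0) := by
    intro c μ hc hμ s hs hpos v hv u hu
    refine Finset.sum_lt_sum (fun t ht => ?_) ⟨s, hs, by simp [hv, hu, hpos]⟩
    by_cases hut : u ∈ t
    · have hst : s ⊆ t := (hc.total hs ht).resolve_right fun h => hu (h hut)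
      simp [hut, hst hv]
    · rw [if_neg hut]
      split_ifs
      · exact hμ t
      · exact le_rfl
  let C := (c ∪ c').filter fun s => 0 < μ s ∨ 0 < μ' s
  have hCmem : ∀ s ∈ C, s.Nonempty ∧ ∀ v ∈ s, ∀ u ∉ s,
      ∑ t ∈ c, (if u ∈ t then μ t else 0) < ∑ t ∈ c, (if v ∈ t then μ t else 0) := by
    intro s hs
    obtain ⟨-, hs | hs⟩ := Finset.mem_filter.1 hs
    · have hsc : s ∈ c := by by_contra hn; exact hs.ne' (h0 s hn)
      exact ⟨hne s hsc, upper hc hμ s hsc hs⟩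
    · have hsc : s ∈ c' := by by_contra hn; exact hs.ne' (h0' s hn)
      refine ⟨hne' s hsc, fun v hv u hu => ?_⟩
      rw [h, h]
      exact upper hc' hμ' s hsc hs v hv u hu
  have hchain : IsChain (· ⊆ ·) (C : Set (Finset V)) := by
    intro s hs t ht _
    by_contra hcon
    rw [not_or, Finset.not_subset, Finset.not_subset] at hcon
    obtain ⟨⟨v, hvs, hvt⟩, u, hut, hus⟩ := hcon
    exact lt_asymm ((hCmem s hs).2 v hvs u hus) ((hCmem t ht).2 u hut v hvt)
  have hsumC : ∀ v, ∑ s ∈ C, (if v ∈ s then μ s - μ' s else 0) = 0 := by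
    intro v
    have h₁ : ∑ s ∈ C, (if v ∈ s then μ s else 0) = ∑ s ∈ c, (if v ∈ s then μ s else 0) := by
      rw [Finset.sum_subset (s₁ := c) (s₂ := c ∪ c') Finset.subset_union_left
        (fun s _ hs => by rw [h0 s hs, ite_self])]
      refine Finset.sum_subset (Finset.filter_subset _ _) fun s hs hsC => ?_
      have : μ s = 0 := by
        by_contra hn
        exact hsC (Finset.mem_filter.2 ⟨hs, Or.inl ((hμ s).lt_of_ne' hn)⟩)
      simp [this]
    have h₂ : ∑ s ∈ C, (if v ∈ s then μ' s else 0) = ∑ s ∈ c', (if v ∈ s then μ' s else 0) := by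
      rw [Finset.sum_subset (s₁ := c') (s₂ := c ∪ c') Finset.subset_union_right
        (fun s _ hs => by rw [h0' s hs, ite_self])]
      refine Finset.sum_subset (Finset.filter_subset _ _) fun s hs hsC => ?_
      have : μ' s = 0 := by
        by_contra hn
        exact hsC (Finset.mem_filter.2 ⟨hs, Or.inr ((hμ' s).lt_of_ne' hn)⟩)
      simp [this]
    have h₃ : ∀ s, (if v ∈ s then μ s - μ' s else 0) =
        (if v ∈ s then μ s else 0) - (if v ∈ s then μ' s else 0) := by
      intro s; split_ifs <;> simp
    simp only [h₃, Finset.sum_sub_distrib]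
    rw [h₁, h₂, h v, sub_self]
  funext s
  by_contra hs
  -- the largest set with different coefficients has a point outside all the other such sets
  have hsC : ∀ t, μ t ≠ μ' t → t ∈ C := by
    intro t ht
    have hpos : 0 < μ t ∨ 0 < μ' t := by
      by_contra hcon
      push Not at hcon
      exact ht (by rw [le_antisymm hcon.1 (hμ t), le_antisymm hcon.2 (hμ' t)])
    refine Finset.mem_filter.2 ⟨?_, hpos⟩
    by_contra hn
    rw [Finset.mem_union, not_or] at hn
    exact ht (by rw [h0 t hn.1, h0' t hn.2])
  obtain ⟨s₀, hs₀, hmax⟩ := Finset.exists_max_image (C.filter fun t => μ t ≠ μ' t) Finset.card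
    ⟨s, Finset.mem_filter.2 ⟨hsC s hs, hs⟩⟩
  obtain ⟨hs₀C, hs₀ne⟩ := Finset.mem_filter.1 hs₀
  obtain ⟨v, hv, hvt⟩ := exists_mem_forall_ssubset_notMem hchain (hCmem s₀ hs₀C).1
  have := hsumC v
  rw [Finset.sum_eq_single s₀ _ fun h => (h hs₀C).elim, if_pos hv] at this
  · exact hs₀ne (sub_eq_zero.1 this)
  · intro t ht hts
    split_ifs with hvt'
    · by_contra hne
      have htne : μ t ≠ μ' t := fun h => hne (by rw [h, sub_self])
      rcases hchain.total ht hs₀C with h' | h'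
      · exact hvt t ht (h'.ssubset_of_ne hts) hvt'
      · exact hts (Finset.eq_of_subset_of_card_le h'
          (hmax t (Finset.mem_filter.2 ⟨ht, htne⟩))).symm
    · rfl

/-- Every nonnegative function with finite support is a nonnegative combination of indicators of
a chain of nonempty finite sets. -/
lemma exists_layers (s : Finset V) (w : V → ℝ) (hw : ∀ v, 0 ≤ w v) (h0 : ∀ v, v ∉ s → w v = 0) :
    ∃ (c : Finset (Finset V)) (μ : Finset V → ℝ), IsChain (· ⊆ ·) (c : Set (Finset V)) ∧
      (∀ t ∈ c, t.Nonempty ∧ t ⊆ s) ∧ (∀ t, 0 ≤ μ t) ∧ (∀ t, t ∉ c → μ t = 0) ∧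
      ∀ v, w v = ∑ t ∈ c, (if v ∈ t then μ t else 0) := by
  induction hn : s.card using Nat.strong_induction_on generalizing s w with
  | _ n ih =>
  subst hn
  obtain ⟨s', hs'⟩ : ∃ s', s' = s.filter (0 < w ·) := ⟨_, rfl⟩
  have hmem' : ∀ v, v ∈ s' ↔ 0 < w v := by
    intro v
    rw [hs', Finset.mem_filter, and_iff_right_iff_imp]
    intro h
    by_contra hv
    exact h.ne' (h0 v hv)
  have hs's : s' ⊆ s := hs' ▸ Finset.filter_subset _ _
  rcases s'.eq_empty_or_nonempty with hemp | hne
  · refine ⟨∅, 0, by simp, by simp, fun _ => le_rfl, fun _ _ => rfl, fun v => ?_⟩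
    have : ¬ 0 < w v := fun h => by
      have := (hmem' v).2 h
      simp [hemp] at this
    simpa using le_antisymm (not_lt.1 this) (hw v)
  obtain ⟨v₀, hv₀, hmin⟩ := Finset.exists_min_image s' w hne
  obtain ⟨s'', hs''⟩ : ∃ s'', s'' = s'.filter (w v₀ < w ·) := ⟨_, rfl⟩
  have hss : s'' ⊂ s' := by
    rw [hs'', Finset.filter_ssubset]
    exact ⟨v₀, hv₀, lt_irrefl _⟩
  obtain ⟨c, μ, hc, hcs, hμ, hμ0, hsum⟩ := ih s''.card
    ((Finset.card_lt_card hss).trans_le (Finset.card_le_card hs's)) s''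
    (fun v => if v ∈ s' then w v - w v₀ else 0)
    (fun v => by
      split_ifs with h
      · exact sub_nonneg.2 (hmin v h)
      · exact le_rfl)
    (fun v hv => by
      split_ifs with h
      · have : ¬ w v₀ < w v := fun h' => hv (hs'' ▸ Finset.mem_filter.2 ⟨h, h'⟩)
        have := hmin v h
        linarith
      · rfl) rfl
  have hs'c : s' ∉ c := fun h => (hss.trans_subset (hcs s' h).2).2 subset_rfl
  refine ⟨insert s' c, fun t => if t = s' then w v₀ else μ t, ?_, ?_, ?_, ?_, ?_⟩
  · rw [Finset.coe_insert]
    exact hc.insert fun t ht _ => Or.inr ((hcs t ht).2.trans hss.1)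
  · intro t ht
    rcases Finset.mem_insert.1 ht with rfl | ht
    · exact ⟨hne, hs's⟩
    · exact ⟨(hcs t ht).1, ((hcs t ht).2.trans hss.1).trans hs's⟩
  · intro t
    dsimp only
    split_ifs
    · exact hw v₀
    · exact hμ t
  · intro t ht
    rw [Finset.mem_insert, not_or] at ht
    dsimp only
    rw [if_neg ht.1, hμ0 t ht.2]
  · intro v
    rw [Finset.sum_insert hs'c]
    simp only [if_true]
    have h₁ : ∑ t ∈ c, (if v ∈ t then (if t = s' then w v₀ else μ t) else 0) =
        ∑ t ∈ c, (if v ∈ t then μ t else 0) := by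
      refine Finset.sum_congr rfl fun t ht => ?_
      have : t ≠ s' := fun h => hs'c (h ▸ ht)
      rw [if_neg this]
    rw [h₁, ← hsum v]
    split_ifs with h
    · ring
    · have : ¬ 0 < w v := fun h' => h ((hmem' v).2 h')
      linarith [hw v]

end Layers

section Subdivision

variable {E : Type*} [DecidableEq E] [AddCommGroup E] [Module ℝ E]

/-- The barycenter of a finite set of points. -/
noncomputable def bary (s : Finset E) : E := (s.card : ℝ)⁻¹ • ∑ v ∈ s, v

/-- The points of a geometric complex have unique barycentric coordinates. -/
lemma uniqueWeights_id (K : Geometry.SimplicialComplex ℝ E) :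
    UniqueWeights id K.toPreAbstractSimplicialComplex := by
  intro s hs t ht w w' hw hw' h
  simp only [id_eq] at h
  -- weights on the vertices of one simplex are determined by affine independence
  have uniq : ∀ s ∈ K.faces, ∀ w w' : E → ℝ, IsWeight s w → IsWeight s w' →
      ∑ v ∈ s, w v • v = ∑ v ∈ s, w' v • v → w = w' := by
    intro s hs w w' hw hw' h
    have hind := affineIndependent_iff.1 (K.indep hs) Finset.univ (fun v => w v - w' v)
    have h₁ : ∑ v : s, (w v - w' v) = 0 := by
      rw [Finset.sum_coe_sort s (fun v => w v - w' v), Finset.sum_sub_distrib, hw.sum_eq_one,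
        hw'.sum_eq_one, sub_self]
    have h₂ : ∑ v : s, (w v - w' v) • (v : E) = 0 := by
      rw [Finset.sum_coe_sort s (fun v => (w v - w' v) • v)]
      simp only [sub_smul, Finset.sum_sub_distrib]
      rw [h, sub_self]
    have h₃ := hind h₁ h₂
    funext v
    by_cases hv : v ∈ s
    · exact sub_eq_zero.1 (h₃ ⟨v, hv⟩ (Finset.mem_univ _))
    · rw [hw.eq_zero v hv, hw'.eq_zero v hv]
  have hx : ∑ v ∈ s, w v • v ∈ convexHull ℝ ((s ∩ t : Finset E) : Set E) := by
    rw [Finset.coe_inter]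
    exact K.inter_subset_convexHull hs ht
      ⟨mem_convexHull_iff_isWeight.2 ⟨w, hw, rfl⟩, mem_convexHull_iff_isWeight.2 ⟨w', hw', h.symm⟩⟩
  obtain ⟨w'', hw'', h''⟩ := mem_convexHull_iff_isWeight.1 hx
  have e₁ := hw''.sum_smul_eq Finset.inter_subset_left (id : E → E)
  have e₂ := hw''.sum_smul_eq Finset.inter_subset_right (id : E → E)
  simp only [id_eq] at e₁ e₂
  rw [uniq s hs w w'' hw (hw''.mono Finset.inter_subset_left) (h''.symm.trans e₁),
    uniq t ht w' w'' hw' (hw''.mono Finset.inter_subset_right) ((h.symm.trans h''.symm).trans e₂)]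

omit [DecidableEq E] [AddCommGroup E] [Module ℝ E] in
/-- The largest member of a flag contains all the others. -/
lemma exists_top_of_mem_flags {A : PreAbstractSimplicialComplex E} {c : Finset (Finset E)}
    (hc : c ∈ (flags A).faces) : ∃ s ∈ c, ∀ t ∈ c, t ⊆ s := by
  obtain ⟨s, hs, hmax⟩ := Finset.exists_max_image c Finset.card hc.1
  refine ⟨s, hs, fun t ht => ?_⟩
  rcases hc.2.2.total ht hs with h | h
  · exact h
  · exact (Finset.eq_of_subset_of_card_le h (hmax t ht)).symm.subset

/-- A convex combination of barycenters of a flag, in terms of the vertices of the largest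
simplex of the flag. -/
lemma isWeight_of_flag {c : Finset (Finset E)} {s : Finset E} (hne : ∀ t ∈ c, t.Nonempty)
    (hs : ∀ t ∈ c, t ⊆ s) {w : Finset E → ℝ} (hw : IsWeight c w) :
    IsWeight s (fun v => ∑ t ∈ c, if v ∈ t then w t / t.card else 0) ∧
      ∑ t ∈ c, w t • bary t =
        ∑ v ∈ s, (∑ t ∈ c, if v ∈ t then w t / t.card else 0) • v := by
  have hswap : ∀ t ∈ c, ∑ v ∈ s, (if v ∈ t then w t / t.card else 0) = w t := by
    intro t ht
    rw [← Finset.sum_filter, Finset.filter_mem_eq_inter, Finset.inter_eq_right.2 (hs t ht),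
      Finset.sum_const, nsmul_eq_mul]
    have : (t.card : ℝ) ≠ 0 := by exact_mod_cast (hne t ht).card_pos.ne'
    field_simp
  refine ⟨⟨fun v => Finset.sum_nonneg fun t _ => ?_, fun v hv => Finset.sum_eq_zero fun t ht => ?_,
    ?_⟩, ?_⟩
  · split_ifs
    · exact div_nonneg (hw.nonneg t) (Nat.cast_nonneg _)
    · exact le_rfl
  · rw [if_neg fun h => hv (hs t ht h)]
  · rw [Finset.sum_comm, Finset.sum_congr rfl hswap, hw.sum_eq_one]
  · simp only [Finset.sum_smul]
    rw [Finset.sum_comm]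
    refine Finset.sum_congr rfl fun t ht => ?_
    simp only [ite_smul, zero_smul]
    rw [← Finset.sum_filter, Finset.filter_mem_eq_inter, Finset.inter_eq_right.2 (hs t ht), bary,
      ← Finset.smul_sum, smul_smul, div_eq_mul_inv]

lemma uniqueWeights_bary (K : Geometry.SimplicialComplex ℝ E) :
    UniqueWeights bary (flags K.toPreAbstractSimplicialComplex) := by
  intro c hc c' hc' w w' hw hw' h
  obtain ⟨s, hs, htop⟩ := exists_top_of_mem_flags hc
  obtain ⟨s', hs', htop'⟩ := exists_top_of_mem_flags hc'
  have hne : ∀ t ∈ c, t.Nonempty := fun t ht => K.nonempty_of_mem_faces (hc.2.1 t ht)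
  have hne' : ∀ t ∈ c', t.Nonempty := fun t ht => K.nonempty_of_mem_faces (hc'.2.1 t ht)
  obtain ⟨hW, e⟩ := isWeight_of_flag hne htop hw
  obtain ⟨hW', e'⟩ := isWeight_of_flag hne' htop' hw'
  have hWW := uniqueWeights_id K s (hc.2.1 s hs) s' (hc'.2.1 s' hs') _ _ hW hW'
    (by simpa only [id_eq] using e.symm.trans (h.trans e'))
  have := layer_unique hc.2.2 hc'.2.2 hne hne' (μ := fun t => w t / t.card)
    (μ' := fun t => w' t / t.card) (fun t => div_nonneg (hw.nonneg t) (Nat.cast_nonneg _))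
    (fun t => div_nonneg (hw'.nonneg t) (Nat.cast_nonneg _))
    (fun t ht => by rw [hw.eq_zero t ht, zero_div])
    (fun t ht => by rw [hw'.eq_zero t ht, zero_div]) (fun v => congrFun hWW v)
  funext t
  have ht := congrFun this t
  rcases t.eq_empty_or_nonempty with rfl | htne
  · rw [hw.eq_zero ∅ fun h => Finset.not_nonempty_empty (hne _ h),
      hw'.eq_zero ∅ fun h => Finset.not_nonempty_empty (hne' _ h)]
  · have : (t.card : ℝ) ≠ 0 := by exact_mod_cast htne.card_pos.ne'
    exact (div_left_inj' this).1 ht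

/-- The barycentric subdivision of a geometric complex. -/
noncomputable def sd (K : Geometry.SimplicialComplex ℝ E) : Geometry.SimplicialComplex ℝ E :=
  realize bary (flags K.toPreAbstractSimplicialComplex) (uniqueWeights_bary K)

lemma finite_sd {K : Geometry.SimplicialComplex ℝ E} (hK : K.faces.Finite) :
    (sd K).faces.Finite :=
  (finite_flags hK).image _

lemma space_sd (K : Geometry.SimplicialComplex ℝ E) : (sd K).space = K.space := by
  ext x
  rw [sd, mem_space_realize, Geometry.SimplicialComplex.mem_space_iff]
  constructor
  · rintro ⟨c, hc, w, hw, rfl⟩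
    obtain ⟨s, hs, htop⟩ := exists_top_of_mem_flags hc
    obtain ⟨hW, e⟩ := isWeight_of_flag
      (fun t ht => K.nonempty_of_mem_faces (hc.2.1 t ht)) htop hw
    exact ⟨s, hc.2.1 s hs, mem_convexHull_iff_isWeight.2 ⟨_, hW, e.symm⟩⟩
  · rintro ⟨s, hs, hx⟩
    obtain ⟨w, hw, rfl⟩ := mem_convexHull_iff_isWeight.1 hx
    obtain ⟨c, μ, hc, hcs, hμ, hμ0, hsum⟩ := exists_layers s w hw.nonneg hw.eq_zero
    have hcard : ∀ t ∈ c, (t.card : ℝ) ≠ 0 := fun t ht => by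
      exact_mod_cast (hcs t ht).1.card_pos.ne'
    have hwt : IsWeight c fun t => μ t * t.card := by
      refine ⟨fun t => mul_nonneg (hμ t) (Nat.cast_nonneg _), fun t ht => ?_, ?_⟩
      · rw [hμ0 t ht, zero_mul]
      · rw [← hw.sum_eq_one]
        simp only [hsum]
        rw [Finset.sum_comm]
        refine Finset.sum_congr rfl fun t ht => ?_
        rw [← Finset.sum_filter, Finset.filter_mem_eq_inter, Finset.inter_eq_right.2 (hcs t ht).2,
          Finset.sum_const, nsmul_eq_mul, mul_comm]
    refine ⟨c, ⟨hwt.nonempty, fun t ht => ?_, hc⟩, _, hwt, ?_⟩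
    · exact K.down_closed hs (hcs t ht).2 (hcs t ht).1
    · rw [(isWeight_of_flag (fun t ht => (hcs t ht).1) (fun t ht => (hcs t ht).2) hwt).2]
      refine Finset.sum_congr rfl fun v _ => ?_
      rw [hsum v]
      congr 1
      refine Finset.sum_congr rfl fun t ht => ?_
      rw [mul_div_cancel_right₀ _ (hcard t ht)]

end Subdivision

/-! ### Invariance of dimension for the plane -/

section Dimension

/-- Continuous logarithms on a preconnected set that agree at one point agree everywhere. -/
lemma eqOn_of_exp_eqOn {A : Type*} [TopologicalSpace A] {s : Set A} (hs : IsPreconnected s)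
    {l₁ l₂ : A → ℂ} (h₁ : ContinuousOn l₁ s) (h₂ : ContinuousOn l₂ s)
    (h : ∀ a ∈ s, Complex.exp (l₁ a) = Complex.exp (l₂ a)) {a : A} (ha : a ∈ s)
    (haa : l₁ a = l₂ a) : EqOn l₁ l₂ s :=
  Complex.isCoveringMap_exp.eqOn_of_comp_eqOn hs h₁ h₂ (fun x hx => Subtype.ext (h x hx)) ha haa

variable {E : Type*} [NormedAddCommGroup E] [NormedSpace ℝ E]

/-- On the complement of a closed ray every continuous nonvanishing complex function has
a continuous logarithm. -/
lemma exists_log_compl_ray {e : E} (he : e ≠ 0) {g : E → ℂ} (hg : Continuous g)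
    (hg0 : ∀ x, x ≠ 0 → g x ≠ 0) :
    IsOpen ((fun s : ℝ => s • e) '' Ici 0)ᶜ ∧
    ∃ L : E → ℂ, ContinuousOn L ((fun s : ℝ => s • e) '' Ici 0)ᶜ ∧
      ∀ x ∈ ((fun s : ℝ => s • e) '' Ici 0)ᶜ, Complex.exp (L x) = g x := by
  have hopen : IsOpen ((fun s : ℝ => s • e) '' Ici 0)ᶜ :=
    ((isClosedEmbedding_smul_left he).isClosedMap _ isClosed_Ici).isOpen_compl
  have hmem : -e ∈ ((fun s : ℝ => s • e) '' Ici 0)ᶜ := by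
    rintro ⟨s, hs, hse⟩
    have h0 : (s + 1) • e = 0 := by rw [add_smul, one_smul]; simp only at hse; rw [hse]; simp
    have h1 : (0 : ℝ) ≤ s := hs
    rcases smul_eq_zero.1 h0 with h | h
    · linarith
    · exact he h
  have hstar : StarConvex ℝ (-e) ((fun s : ℝ => s • e) '' Ici 0)ᶜ := by
    rintro x hx a b ha hb hab ⟨s, hs, hse⟩
    simp only at hse
    rcases hb.eq_or_lt with rfl | hb
    · obtain rfl : a = 1 := by linarith
      exact hmem ⟨s, hs, by simpa using hse⟩
    · refine hx ⟨(s + a) / b, div_nonneg (add_nonneg hs ha) hb.le, ?_⟩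
      have : (s + a) • e = b • x := by rw [add_smul, hse]; simp
      simp only
      rw [div_eq_inv_mul, mul_smul, this, smul_smul, inv_mul_cancel₀ hb.ne', one_smul]
  have hcontr := hstar.contractibleSpace ⟨_, hmem⟩
  have hsc : IsSimplyConnected ((fun s : ℝ => s • e) '' Ici 0)ᶜ := by
    rw [IsSimplyConnected]
    infer_instance
  refine ⟨hopen, ?_⟩
  obtain ⟨L, hL, hLg⟩ := Complex.exists_continuousOn_eqOn_exp_comp hsc hopen hg.continuousOn
    (by
      rintro ⟨x, hx, hx0⟩
      refine hg0 x ?_ hx0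
      rintro rfl
      exact hx ⟨0, by simp, by simp⟩)
  exact ⟨L, hL, hLg⟩

/-- In a punctured real vector space of dimension different from two, every continuous nonvanishing
complex function has a continuous logarithm: logarithms on the complements of two opposite rays
can be made to agree, because the complement of the line is preconnected. -/
lemma exists_log_compl_zero [FiniteDimensional ℝ E] (hE : Module.finrank ℝ E ≠ 2) {g : E → ℂ}
    (hg : Continuous g) (hg0 : ∀ x, x ≠ 0 → g x ≠ 0) :
    ∃ L : E → ℂ, ContinuousOn L {0}ᶜ ∧ ∀ x, x ≠ 0 → Complex.exp (L x) = g x := by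
  by_cases hsub : ∃ e : E, e ≠ 0
  swap
  · push Not at hsub
    refine ⟨fun _ => 0, continuousOn_const, fun x hx => (hx (hsub x)).elim⟩
  obtain ⟨e, he⟩ := hsub
  obtain ⟨ho₁, L₁, hL₁, hexp₁⟩ := exists_log_compl_ray he hg hg0
  obtain ⟨ho₂, L₂, hL₂, hexp₂⟩ := exists_log_compl_ray (neg_ne_zero.2 he) hg hg0
  obtain ⟨U₁, hU₁⟩ : ∃ U, U = ((fun s : ℝ => s • e) '' Ici 0)ᶜ := ⟨_, rfl⟩
  obtain ⟨U₂, hU₂⟩ : ∃ U, U = ((fun s : ℝ => s • -e) '' Ici 0)ᶜ := ⟨_, rfl⟩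
  rw [← hU₁] at ho₁ hL₁ hexp₁
  rw [← hU₂] at ho₂ hL₂ hexp₂
  have hinter : U₁ ∩ U₂ = ((Submodule.span ℝ {e} : Submodule ℝ E) : Set E)ᶜ := by
    rw [hU₁, hU₂, ← compl_union]
    congr 1
    ext x
    rw [SetLike.mem_coe, Submodule.mem_span_singleton]
    constructor
    · rintro (⟨s, -, rfl⟩ | ⟨s, -, rfl⟩)
      · exact ⟨s, rfl⟩
      · exact ⟨-s, by simp⟩
    · rintro ⟨s, rfl⟩
      rcases le_total 0 s with h | h
      · exact Or.inl ⟨s, h, rfl⟩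
      · exact Or.inr ⟨-s, neg_nonneg.2 h, by simp⟩
  have hpre : IsPreconnected (U₁ ∩ U₂) := by
    rw [hinter]
    have hspan := finrank_span_singleton (K := ℝ) he
    have hquot := Submodule.finrank_quotient_add_finrank (Submodule.span ℝ {e} : Submodule ℝ E)
    rcases Nat.lt_or_ge 1 (Module.finrank ℝ (E ⧸ (Submodule.span ℝ {e} : Submodule ℝ E)))
      with h | h
    · refine (isConnected_compl_of_one_lt_codim ?_).isPreconnected
      rw [← Module.finrank_eq_rank]
      exact_mod_cast h
    · have : (Submodule.span ℝ {e} : Submodule ℝ E) = ⊤ :=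
        Submodule.eq_top_of_finrank_eq (by omega)
      rw [this]
      simpa using isPreconnected_empty
  have hcover : ∀ x, x ≠ 0 → x ∈ U₁ ∨ x ∈ U₂ := by
    intro x hx
    by_contra hcon
    rw [not_or, hU₁, hU₂, notMem_compl_iff, notMem_compl_iff] at hcon
    obtain ⟨⟨s, hs, rfl⟩, t, ht, hst⟩ := hcon
    simp only at hst hx
    have h0 : (s + t) • e = 0 := by rw [add_smul, ← hst]; simp
    have hs' : (0 : ℝ) ≤ s := hs
    have ht' : (0 : ℝ) ≤ t := ht
    rcases smul_eq_zero.1 h0 with h | h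
    · exact hx (by rw [show s = 0 by linarith, zero_smul])
    · exact he h
  -- a period `c` of the exponential that makes the two logarithms agree
  obtain ⟨c, hc, hagree⟩ : ∃ c : ℂ, Complex.exp c = 1 ∧ ∀ x ∈ U₁ ∩ U₂, L₁ x = L₂ x + c := by
    rcases (U₁ ∩ U₂).eq_empty_or_nonempty with hemp | ⟨a, ha⟩
    · exact ⟨0, Complex.exp_zero, fun x hx => by simp [hemp] at hx⟩
    have hc : Complex.exp (L₁ a - L₂ a) = 1 := by
      rw [Complex.exp_sub, hexp₁ a ha.1, hexp₂ a ha.2, div_self]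
      rw [← hexp₁ a ha.1]
      exact Complex.exp_ne_zero _
    refine ⟨L₁ a - L₂ a, hc, eqOn_of_exp_eqOn hpre (hL₁.mono inter_subset_left)
      ((hL₂.mono inter_subset_right).add continuousOn_const) (fun x hx => ?_) ha (by ring)⟩
    rw [Complex.exp_add, hc, mul_one, hexp₁ x hx.1, hexp₂ x hx.2]
  classical
  obtain ⟨L, hL⟩ : ∃ L : E → ℂ, L = fun x => if x ∈ U₁ then L₁ x else L₂ x + c := ⟨_, rfl⟩
  have hLU₁ : EqOn L L₁ U₁ := fun x hx => by rw [hL]; exact if_pos hx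
  have hLU₂ : EqOn L (fun x => L₂ x + c) U₂ := fun x hx => by
    by_cases hx₁ : x ∈ U₁
    · rw [hLU₁ hx₁]; exact hagree x ⟨hx₁, hx⟩
    · rw [hL]; exact if_neg hx₁
  refine ⟨L, fun x hx => ?_, fun x hx => ?_⟩
  · rcases hcover x hx with h | h
    · exact ((hL₁.congr hLU₁).continuousAt (ho₁.mem_nhds h)).continuousWithinAt
    · exact (((hL₂.add continuousOn_const).congr hLU₂).continuousAt
        (ho₂.mem_nhds h)).continuousWithinAt
  · rcases hcover x hx with h | h
    · rw [hLU₁ h, hexp₁ x h]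
    · rw [hLU₂ h, Complex.exp_add, hc, mul_one, hexp₂ x h]

/-- Only two-dimensional spaces embed as open subsets of the plane: otherwise a small circle around
a point of the image would carry a continuous logarithm. -/
theorem finrank_eq_two_of_isOpenEmbedding [FiniteDimensional ℝ E] {h : E → ℂ}
    (hh : IsOpenEmbedding h) : Module.finrank ℝ E = 2 := by
  by_contra hE
  obtain ⟨L, hL, hexp⟩ := exists_log_compl_zero hE (g := fun x => h x - h 0)
    (hh.continuous.sub continuous_const)
    (fun x hx h' => hx (hh.injective (sub_eq_zero.1 h')))
  obtain ⟨ε, hε, hball⟩ := Metric.isOpen_iff.1 hh.isOpen_range (h 0) ⟨0, rfl⟩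
  obtain ⟨r, hr0, hrε⟩ := exists_between hε
  obtain ⟨γ, hγ⟩ : ∃ γ : ℝ → ℂ, γ = fun t : ℝ => h 0 + r * Complex.exp (t * Complex.I) := ⟨_, rfl⟩
  have hγc : Continuous γ := by rw [hγ]; fun_prop
  have hγr : ∀ t, γ t ∈ range h := fun t => hball (by
    rw [hγ, Metric.mem_ball, dist_eq_norm]
    simpa [Complex.norm_exp_ofReal_mul_I, abs_of_pos hr0] using hrε)
  choose k hk using hγr
  have hkc : Continuous k := by
    rw [hh.isInducing.continuous_iff]
    have : h ∘ k = γ := funext hk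
    rwa [this]
  have hr : (r : ℂ) ≠ 0 := by exact_mod_cast hr0.ne'
  have hk0 : ∀ t, k t ≠ 0 := by
    intro t h0
    have := hk t
    rw [h0, hγ] at this
    simp [hr, Complex.exp_ne_zero] at this
  have hlog : ∀ t : ℝ, Complex.exp (L (k t)) = r * Complex.exp (t * Complex.I) := by
    intro t
    rw [hexp _ (hk0 t), hk, hγ]
    ring
  have hconst := eqOn_of_exp_eqOn (s := univ) isPreconnected_univ (l₁ := fun t : ℝ => L (k t))
    (l₂ := fun t : ℝ => L (k 0) + t * Complex.I)
    (hL.comp_continuous hkc hk0).continuousOn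
    (by fun_prop) (fun t _ => by
      rw [hlog, Complex.exp_add, hlog]; simp) (mem_univ (0 : ℝ)) (by simp)
  have h1 := hconst (mem_univ (2 * Real.pi))
  have h2 : k (2 * Real.pi) = k 0 := by
    apply hh.injective
    rw [hk, hk, hγ]
    simp
  simp only [h2] at h1
  simp at h1

/-- Every nonempty open subset of a normed space contains an open copy of the whole space. -/
lemma exists_isOpenEmbedding_range_subset {U : Set E} (hU : IsOpen U) (hne : U.Nonempty) :
    ∃ e : E → E, IsOpenEmbedding e ∧ range e ⊆ U := by
  obtain ⟨q, hq⟩ := hne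
  obtain ⟨r, hr, hball⟩ := Metric.isOpen_iff.1 hU q hq
  have h₁ : IsOpenEmbedding (OpenPartialHomeomorph.univUnitBall : E → E) :=
    OpenPartialHomeomorph.isOpenEmbedding _ rfl
  have h₂ : IsOpenEmbedding fun x : E => q + r • x :=
    ((Homeomorph.smulOfNeZero r hr.ne').trans (Homeomorph.addLeft q)).isOpenEmbedding
  refine ⟨_, h₂.comp h₁, ?_⟩
  rintro _ ⟨x, rfl⟩
  apply hball
  have hx : OpenPartialHomeomorph.univUnitBall x ∈ Metric.ball (0 : E) 1 :=
    OpenPartialHomeomorph.univUnitBall.map_source (mem_univ x)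
  rw [mem_ball_zero_iff] at hx
  rw [Metric.mem_ball, dist_eq_norm]
  simp only [Function.comp_apply, add_sub_cancel_left, norm_smul, Real.norm_of_nonneg hr.le]
  nlinarith

/-- If a space has a dense open subset that embeds openly in the plane, then an open subset of
a real vector space that embeds openly in the space is two-dimensional. -/
theorem finrank_eq_two_of_dense_range [FiniteDimensional ℝ E] {X B : Type*} [TopologicalSpace X]
    [TopologicalSpace B] {i : B → X} (hi : IsOpenEmbedding i) (hd : DenseRange i) {k : B → ℂ}
    (hk : IsOpenEmbedding k) {Ω : Set E} (hΩ : IsOpen Ω) (hne : Ω.Nonempty) {j : Ω → X}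
    (hj : IsOpenEmbedding j) : Module.finrank ℝ E = 2 := by
  have hne' : Nonempty Ω := hne.to_subtype
  obtain ⟨_, ⟨z, rfl⟩, b, hb⟩ := hd.inter_open_nonempty (range j) hj.isOpen_range
    (range_nonempty j)
  have hopen : IsOpen (((↑) : Ω → E) '' (j ⁻¹' range i)) :=
    hΩ.isOpenMap_subtype_val _ (hi.isOpen_range.preimage hj.continuous)
  obtain ⟨e, he, hesub⟩ := exists_isOpenEmbedding_range_subset hopen ⟨z, z, ⟨b, hb⟩, rfl⟩
  have : ∀ x, ∃ y : Ω, j y ∈ range i ∧ (y : E) = e x := fun x => hesub ⟨x, rfl⟩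
  choose e' he'r he' using this
  have he'emb : IsOpenEmbedding e' := by
    refine IsOpenEmbedding.of_comp e' hΩ.isOpenEmbedding_subtypeVal ?_
    have : Subtype.val ∘ e' = e := funext he'
    rwa [this]
  choose m hm using he'r
  have hmemb : IsOpenEmbedding m := by
    refine IsOpenEmbedding.of_comp m hi ?_
    have : i ∘ m = j ∘ e' := funext hm
    rw [this]
    exact hj.comp he'emb
  exact finrank_eq_two_of_isOpenEmbedding (hk.comp hmemb)

end Dimension

/-! ### Facets -/

section Facets

/-- The relative interior of a facet is an open subset of the complex, and it is
homeomorphic to an open subset of a vector space of the dimension of the facet. -/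
lemma exists_isOpenEmbedding_of_mem_facets {n : ℕ}
    {K : Geometry.SimplicialComplex ℝ (Fin n → ℝ)} (hK : K.faces.Finite) {s : Finset (Fin n → ℝ)}
    (hs : s ∈ K.facets) :
    ∃ (H : Submodule ℝ (s → ℝ)) (Ω : Set H) (j : Ω → K.space),
      Module.finrank ℝ H + 1 = s.card ∧ IsOpen Ω ∧ Ω.Nonempty ∧ IsOpenEmbedding j := by
  classical
  obtain ⟨hsK, hmax⟩ := hs
  have hsne : s.Nonempty := K.nonempty_of_mem_faces hsK
  have hcard : (0 : ℝ) < s.card := by exact_mod_cast hsne.card_pos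
  have : Nonempty s := hsne.to_subtype
  let σ : (s → ℝ) →ₗ[ℝ] ℝ := ∑ v : s, LinearMap.proj v
  have hσ : ∀ u, σ u = ∑ v, u v := fun u => by simp [σ]
  let H : Submodule ℝ (s → ℝ) := LinearMap.ker σ
  have hH : ∀ u : H, ∑ v, (u : s → ℝ) v = 0 := fun u => by
    rw [← hσ]; exact LinearMap.mem_ker.1 u.2
  have hfin : Module.finrank ℝ H + 1 = s.card := by
    have hsurj : LinearMap.range σ = ⊤ := by
      rw [LinearMap.range_eq_top]
      intro y
      obtain ⟨v⟩ := ‹Nonempty s›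
      exact ⟨Pi.single v y, by rw [hσ]; simp⟩
    have := LinearMap.finrank_range_add_finrank_ker σ
    rw [hsurj, finrank_top, Module.finrank_self, Module.finrank_fintype_fun_eq_card,
      Fintype.card_coe] at this
    change 1 + Module.finrank ℝ H = s.card at this
    omega
  -- the linear map that sends coordinates with sum zero to the vector they represent
  let l : H →ₗ[ℝ] (Fin n → ℝ) := ∑ v : s, (LinearMap.proj v ∘ₗ H.subtype).smulRight (v : Fin n → ℝ)
  have hl : ∀ u : H, l u = ∑ v : s, (u : s → ℝ) v • (v : Fin n → ℝ) := fun u => by simp [l]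
  have hker : LinearMap.ker l = ⊥ := by
    rw [LinearMap.ker_eq_bot']
    intro u hu
    have := affineIndependent_iff.1 (K.indep hsK) Finset.univ (u : s → ℝ) (hH u)
      (by rw [← hl, hu])
    ext v
    exact this v (Finset.mem_univ v)
  have hlemb := LinearMap.isClosedEmbedding_of_injective hker
  let g : H → (Fin n → ℝ) := fun u => bary s + l u
  have hgemb : IsEmbedding g := ((Homeomorph.addLeft (bary s)).isEmbedding).comp hlemb.isEmbedding
  have hg : ∀ u : H, g u = ∑ v : s, ((s.card : ℝ)⁻¹ + (u : s → ℝ) v) • (v : Fin n → ℝ) := by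
    intro u
    simp only [g, hl, add_smul, Finset.sum_add_distrib, bary, Finset.smul_sum]
    rw [← Finset.sum_coe_sort s (fun v => (s.card : ℝ)⁻¹ • v)]
  let Ω : Set H := {u | ∀ v, 0 < (s.card : ℝ)⁻¹ + (u : s → ℝ) v}
  have hΩ : IsOpen Ω := by
    have : Ω = ⋂ v, {u : H | 0 < (s.card : ℝ)⁻¹ + (u : s → ℝ) v} := by
      ext u; simp [Ω]
    rw [this]
    refine isOpen_iInter_of_finite fun v => isOpen_lt continuous_const ?_
    exact continuous_const.add ((continuous_apply v).comp continuous_subtype_val)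
  have hweight : ∀ u ∈ Ω, ∃ w, IsWeight s w ∧ (∀ v ∈ s, 0 < w v) ∧ ∑ v ∈ s, w v • v = g u ∧
      ∀ v : s, w v = (s.card : ℝ)⁻¹ + (u : s → ℝ) v := by
    intro u hu
    obtain ⟨w, hw⟩ : ∃ w : (Fin n → ℝ) → ℝ, w = fun v =>
      if h : v ∈ s then (s.card : ℝ)⁻¹ + (u : s → ℝ) ⟨v, h⟩ else 0 := ⟨_, rfl⟩
    have hwv : ∀ v : s, w v = (s.card : ℝ)⁻¹ + (u : s → ℝ) v := fun v => by
      rw [hw]; exact dif_pos v.2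
    have hpos : ∀ v ∈ s, 0 < w v := fun v hv => by
      have := hwv ⟨v, hv⟩
      simp only at this
      rw [this]; exact hu ⟨v, hv⟩
    have h0 : ∀ v, v ∉ s → w v = 0 := fun v hv => by rw [hw]; exact dif_neg hv
    refine ⟨w, ⟨fun v => ?_, h0, ?_⟩, hpos, ?_, hwv⟩
    · by_cases hv : v ∈ s
      · exact (hpos v hv).le
      · exact (h0 v hv).ge
    · rw [← Finset.sum_coe_sort s w]
      simp only [hwv, Finset.sum_add_distrib, hH u]
      simp [hcard.ne']
    · rw [hg, ← Finset.sum_coe_sort s (fun v => w v • v)]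
      simp only [hwv]
  have hgΩ : ∀ u ∈ Ω, g u ∈ convexHull ℝ (s : Set (Fin n → ℝ)) := by
    intro u hu
    obtain ⟨w, hw, -, h, -⟩ := hweight u hu
    exact mem_convexHull_iff_isWeight.2 ⟨w, hw, h⟩
  let j : Ω → K.space := fun u => ⟨g u, K.convexHull_subset_space hsK (hgΩ u u.2)⟩
  have hjemb : IsEmbedding j := by
    refine IsEmbedding.of_comp (g := ((↑) : K.space → (Fin n → ℝ))) ?_ continuous_subtype_val ?_
    · exact (hgemb.continuous.comp continuous_subtype_val).subtype_mk _
    · exact hgemb.comp IsEmbedding.subtypeVal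
  have hrange : range j = ((↑) : K.space → (Fin n → ℝ)) ⁻¹'
      (⋃ t ∈ {t ∈ K.faces | ¬ s ⊆ t}, convexHull ℝ (t : Set (Fin n → ℝ)))ᶜ := by
    ext ⟨x, hx⟩
    simp only [mem_range, mem_preimage, mem_compl_iff, mem_iUnion, not_exists]
    constructor
    · rintro ⟨u, hu⟩ t ⟨ht, hst⟩ hxt
      obtain ⟨w, hw, hpos, h, -⟩ := hweight u u.2
      obtain ⟨w', hw', h'⟩ := mem_convexHull_iff_isWeight.1 hxt
      have hux : g u = x := congrArg Subtype.val hu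
      have := uniqueWeights_id K s hsK t ht w w' hw hw' (by simp [h, h', hux])
      refine hst fun v hv => ?_
      by_contra hvt
      have h0 := hw'.eq_zero v hvt
      rw [← this] at h0
      exact (hpos v hv).ne' h0
    · intro h
      obtain ⟨t, ht, hxt⟩ := K.mem_space_iff.1 hx
      have hst : s ⊆ t := by
        by_contra hst
        exact h t ⟨ht, hst⟩ hxt
      obtain rfl := hmax ht hst
      obtain ⟨w, hw, rfl⟩ := mem_convexHull_iff_isWeight.1 hxt
      have hpos : ∀ v ∈ s, 0 < w v := by
        intro v hv
        by_contra hv0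
        have hv0 : w v = 0 := le_antisymm (not_lt.1 hv0) (hw.nonneg v)
        -- a vanishing weight puts the point in the opposite face
        have hw' : IsWeight (s.erase v) w := hw.restrict (Finset.erase_subset _ _) fun i hi => by
          by_cases hiv : i = v
          · rw [hiv, hv0]
          · exact hw.eq_zero i fun his => hi (Finset.mem_erase.2 ⟨hiv, his⟩)
        refine h (s.erase v) ⟨K.down_closed hsK (Finset.erase_subset _ _) hw'.nonempty, fun hsub =>
          Finset.notMem_erase v s (hsub hv)⟩ ?_
        have e := hw'.sum_smul_eq (Finset.erase_subset v s) (id : (Fin n → ℝ) → _)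
        exact mem_convexHull_iff_isWeight.2 ⟨w, hw', e⟩
      refine ⟨⟨⟨fun v => w v - (s.card : ℝ)⁻¹, ?_⟩, fun v => ?_⟩, ?_⟩
      · rw [LinearMap.mem_ker, hσ, Finset.sum_sub_distrib, Finset.sum_coe_sort s w,
          hw.sum_eq_one]
        simp [hcard.ne']
      · simpa using hpos v v.2
      · apply Subtype.ext
        change g _ = ∑ v ∈ s, w v • v
        rw [hg, ← Finset.sum_coe_sort s (fun v => w v • v)]
        simp
  refine ⟨H, Ω, j, hfin, hΩ, ⟨0, fun v => by simpa using hcard⟩, hjemb, ?_⟩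
  rw [hrange]
  refine IsOpen.preimage continuous_subtype_val (isOpen_compl_iff.2 ?_)
  exact (hK.subset (sep_subset _ _)).isClosed_biUnion fun t _ =>
    (t.finite_toSet.isCompact_convexHull ℝ).isClosed

end Facets

/-! ### Covering a connected two-dimensional complex by three collapsible subpolyhedra -/

section Cover

variable {n : ℕ}

/-- If the complex `B` is a proper part of `A`, then its underlying space is smaller. -/
lemma exists_mem_space_notMem_space {I E : Type*} [DecidableEq I] [DecidableEq E] [AddCommGroup E]
    [Module ℝ E] {p : I → E} {A B : PreAbstractSimplicialComplex I} (hA : UniqueWeights p A)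
    (hBA : B.faces ⊆ A.faces) {c : Finset I} (hc : c ∈ A.faces) (hcB : c ∉ B.faces) :
    ∃ x ∈ (realize p A hA).space, x ∉ (realize p B (hA.mono hBA)).space := by
  have hcne := nonempty_of_mem_faces A hc
  have hcard : (0 : ℝ) < c.card := by exact_mod_cast hcne.card_pos
  obtain ⟨w, hw⟩ : ∃ w : I → ℝ, w = fun i => if i ∈ c then (c.card : ℝ)⁻¹ else 0 := ⟨_, rfl⟩
  have hwc : ∀ i ∈ c, w i = (c.card : ℝ)⁻¹ := fun i hi => by rw [hw]; exact if_pos hi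
  have hww : IsWeight c w := by
    refine ⟨fun i => ?_, fun i hi => by rw [hw]; exact if_neg hi, ?_⟩
    · by_cases hi : i ∈ c
      · rw [hwc i hi]; positivity
      · rw [hw]; simp [hi]
    · rw [Finset.sum_congr rfl hwc]; simp [hcard.ne']
  refine ⟨_, mem_space_realize.2 ⟨c, hc, w, hww, rfl⟩, fun h => ?_⟩
  obtain ⟨c', hc', w', hw', h'⟩ := mem_space_realize.1 h
  have := hA c' (hBA hc') c hc w' w hw' hww h'
  refine hcB (mem_faces_of_subset B hc' (fun i hi => ?_) hcne)
  by_contra hi'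
  have h0 := hw'.eq_zero i hi'
  rw [this, hwc i hi] at h0
  exact (inv_pos.2 hcard).ne' h0

/-- The vertices of a complex with connected underlying space are connected by edges. -/
lemma forall_vertex_mem_of_isPreconnected {K : Geometry.SimplicialComplex ℝ (Fin n → ℝ)}
    (hK : K.faces.Finite) (hconn : IsPreconnected K.space) (W : Set (Fin n → ℝ))
    (hne : ∃ i ∈ W, {i} ∈ K.faces) (hW : ∀ i ∈ W, ∀ j, {i, j} ∈ K.faces → j ∈ W)
    (j : Fin n → ℝ) (hj : {j} ∈ K.faces) : j ∈ W := by
  by_contra hjW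
  have hall : ∀ τ ∈ K.faces, ∀ i ∈ τ, i ∈ W → ∀ k ∈ τ, k ∈ W := by
    intro τ hτ i hi hiW k hk
    exact hW i hiW k (K.down_closed hτ (by simp [Finset.insert_subset_iff, hi, hk]) (by simp))
  have hclosed : ∀ S ⊆ K.faces, IsClosed (⋃ τ ∈ S, convexHull ℝ (τ : Set (Fin n → ℝ))) :=
    fun S hS => (hK.subset hS).isClosed_biUnion fun t _ =>
      (t.finite_toSet.isCompact_convexHull ℝ).isClosed
  obtain ⟨i, hiW, hi⟩ := hne
  have mem_single : ∀ i : Fin n → ℝ,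
      i ∈ convexHull ℝ ((({i} : Finset (Fin n → ℝ)) : Set (Fin n → ℝ))) :=
    fun i => subset_convexHull ℝ _ (by simp)
  obtain ⟨x, -, hx₁, hx₂⟩ := isPreconnected_closed_iff.1 hconn
    (⋃ τ ∈ {τ ∈ K.faces | ∃ i ∈ τ, i ∈ W}, convexHull ℝ (τ : Set (Fin n → ℝ)))
    (⋃ τ ∈ {τ ∈ K.faces | ∀ i ∈ τ, i ∉ W}, convexHull ℝ (τ : Set (Fin n → ℝ)))
    (hclosed _ (sep_subset _ _)) (hclosed _ (sep_subset _ _))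
    (fun x hx => by
      obtain ⟨τ, hτ, hxτ⟩ := K.mem_space_iff.1 hx
      by_cases h : ∃ i ∈ τ, i ∈ W
      · exact Or.inl (mem_biUnion (⟨hτ, h⟩ : τ ∈ {τ ∈ K.faces | ∃ i ∈ τ, i ∈ W}) hxτ)
      · push Not at h
        exact Or.inr (mem_biUnion (⟨hτ, h⟩ : τ ∈ {τ ∈ K.faces | ∀ i ∈ τ, i ∉ W}) hxτ))
    ⟨i, K.convexHull_subset_space hi (mem_single i),
      mem_biUnion (⟨hi, i, by simp, hiW⟩ : {i} ∈ {τ ∈ K.faces | ∃ i ∈ τ, i ∈ W}) (mem_single i)⟩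
    ⟨j, K.convexHull_subset_space hj (mem_single j),
      mem_biUnion (⟨hj, by simpa using hjW⟩ : {j} ∈ {τ ∈ K.faces | ∀ i ∈ τ, i ∉ W})
        (mem_single j)⟩
  simp only [mem_iUnion] at hx₁ hx₂
  obtain ⟨τ₁, ⟨hτ₁, i₁, hi₁, hi₁W⟩, hx₁⟩ := hx₁
  obtain ⟨τ₂, ⟨hτ₂, h₂⟩, hx₂⟩ := hx₂
  have hemp : (τ₁ ∩ τ₂ : Set (Fin n → ℝ)) = ∅ := by
    ext k
    simp only [mem_inter_iff, Finset.mem_coe, mem_empty_iff_false, iff_false, not_and]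
    exact fun hk₁ hk₂ => h₂ k hk₂ (hall τ₁ hτ₁ i₁ hi₁ hi₁W k hk₁)
  have := K.inter_subset_convexHull hτ₁ hτ₂ ⟨hx₁, hx₂⟩
  rw [hemp, convexHull_empty] at this
  exact this

lemma singleton_mem_flags {A : PreAbstractSimplicialComplex (Fin n → ℝ)} {s : Finset (Fin n → ℝ)}
    (hs : s ∈ A.faces) : {s} ∈ (flags A).faces :=
  ⟨Finset.singleton_nonempty s, fun τ hτ => by rwa [Finset.mem_singleton.1 hτ], by simp⟩

lemma bary_injOn (K : Geometry.SimplicialComplex ℝ (Fin n → ℝ)) {s t : Finset (Fin n → ℝ)}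
    (hs : s ∈ K.faces) (ht : t ∈ K.faces) (h : bary s = bary t) : s = t :=
  (uniqueWeights_bary K).injOn (singleton_mem_flags hs) (singleton_mem_flags ht)
    (Finset.mem_singleton_self s) (Finset.mem_singleton_self t) h

/-- The barycenters of the simplices of `K` with `i` vertices. -/
def colourClass (K : Geometry.SimplicialComplex ℝ (Fin n → ℝ)) (i : ℕ) : Set (Fin n → ℝ) :=
  bary '' {s ∈ K.faces | s.card = i}

/-- The simplices of the barycentric subdivision have at most one vertex of each colour. -/
lemma colourClass_subsingleton (K : Geometry.SimplicialComplex ℝ (Fin n → ℝ)) (i : ℕ)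
    (τ : Finset (Fin n → ℝ)) (hτ : τ ∈ (sd K).faces) (x : Fin n → ℝ) (hx : x ∈ colourClass K i)
    (y : Fin n → ℝ) (hy : y ∈ colourClass K i) (hxτ : x ∈ τ) (hyτ : y ∈ τ) : x = y := by
  obtain ⟨c, hc, rfl⟩ := hτ
  obtain ⟨s, ⟨hs, hsi⟩, rfl⟩ := hx
  obtain ⟨t, ⟨ht, hti⟩, rfl⟩ := hy
  obtain ⟨s', hs', hss⟩ := Finset.mem_image.1 hxτ
  obtain ⟨t', ht', htt⟩ := Finset.mem_image.1 hyτ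
  obtain rfl := bary_injOn K (hc.2.1 s' hs') hs hss
  obtain rfl := bary_injOn K (hc.2.1 t' ht') ht htt
  rcases hc.2.2.total hs' ht' with h | h
  · rw [Finset.eq_of_subset_of_card_le h (by omega)]
  · rw [Finset.eq_of_subset_of_card_le h (by omega)]

lemma singleton_mem_sd {K : Geometry.SimplicialComplex ℝ (Fin n → ℝ)} {s : Finset (Fin n → ℝ)}
    (hs : s ∈ K.faces) : {bary s} ∈ (sd K).faces :=
  ⟨{s}, singleton_mem_flags hs, by simp⟩

/-- The subpolyhedron of colour `i`: a tree in the subdivision of `K` thickened around its vertices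
of colour `i` by their stars in the second subdivision. -/
noncomputable def colourComplex (K : Geometry.SimplicialComplex ℝ (Fin n → ℝ))
    (T : PreAbstractSimplicialComplex (Fin n → ℝ)) (i : ℕ) :
    Geometry.SimplicialComplex ℝ (Fin n → ℝ) :=
  realize bary (starUnion (sd K).toPreAbstractSimplicialComplex T (colourClass K i))
    ((uniqueWeights_bary (sd K)).mono fun _ hf => hf.1)

lemma colourComplex_space_ne {K : Geometry.SimplicialComplex ℝ (Fin n → ℝ)}
    {T : PreAbstractSimplicialComplex (Fin n → ℝ)} (hT : ∀ τ ∈ T.faces, τ.card ≤ 2)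
    {s : Finset (Fin n → ℝ)} (hs : s ∈ K.faces) (hs3 : s.card = 3) (i : ℕ) :
    (colourComplex K T i).space ≠ K.space := by
  obtain ⟨a, b, c, hab, hac, hbc, rfl⟩ := Finset.card_eq_three.1 hs3
  -- a triangle of the subdivision
  obtain ⟨d, hd⟩ : ∃ d : Finset (Finset (Fin n → ℝ)), d = {{a}, {a, b}, {a, b, c}} := ⟨_, rfl⟩
  have hsub₁ : ({a} : Finset (Fin n → ℝ)) ⊆ {a, b} := by simp
  have hsub₂ : ({a, b} : Finset (Fin n → ℝ)) ⊆ {a, b, c} := by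
    simp [Finset.insert_subset_iff]
  have hcard2 : ({a, b} : Finset (Fin n → ℝ)).card = 2 := Finset.card_pair hab
  have hdflag : d ∈ (flags K.toPreAbstractSimplicialComplex).faces := by
    refine ⟨by simp [hd], ?_, ?_⟩
    · intro τ hτ
      simp only [hd, Finset.mem_insert, Finset.mem_singleton] at hτ
      rcases hτ with rfl | rfl | rfl
      · exact K.down_closed hs (hsub₁.trans hsub₂) (by simp)
      · exact K.down_closed hs hsub₂ (by simp)
      · exact hs
    · rw [hd]
      simp only [Finset.coe_insert, Finset.coe_singleton]
      refine ((IsChain.singleton).insert ?_).insert ?_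
      · rintro t rfl -
        exact Or.inl hsub₂
      · rintro t (rfl | rfl) -
        · exact Or.inl hsub₁
        · exact Or.inl (hsub₁.trans hsub₂)
  have hdcard : d.card = 3 := by
    rw [hd, Finset.card_eq_three]
    refine ⟨_, _, _, ?_, ?_, ?_, rfl⟩
    · intro h; have := congrArg Finset.card h; rw [hcard2] at this; simp at this
    · intro h; have := congrArg Finset.card h; rw [hs3] at this; simp at this
    · intro h; have := congrArg Finset.card h; rw [hs3, hcard2] at this; omega
  obtain ⟨σ, hσ⟩ : ∃ σ, σ = d.image bary := ⟨_, rfl⟩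
  have hσK : σ ∈ (sd K).faces := ⟨d, hdflag, hσ.symm⟩
  have hσcard : σ.card = 3 := by
    rw [hσ, Finset.card_image_of_injOn, hdcard]
    exact fun s hs t ht h => bary_injOn K (hdflag.2.1 s hs) (hdflag.2.1 t ht) h
  -- a vertex of that triangle with a different colour
  obtain ⟨t, htd, hti⟩ : ∃ t ∈ d, t.card ≠ i := by
    by_cases h : i = 1
    · exact ⟨{a, b}, by simp [hd], by omega⟩
    · exact ⟨{a}, by simp [hd], by simpa using Ne.symm h⟩
  have htK := hdflag.2.1 t htd
  have htσ : bary t ∈ σ := hσ ▸ Finset.mem_image_of_mem _ htd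
  have hflag : {{bary t}, σ} ∈ (flags (sd K).toPreAbstractSimplicialComplex).faces := by
    refine ⟨by simp, ?_, ?_⟩
    · intro τ hτ
      simp only [Finset.mem_insert, Finset.mem_singleton] at hτ
      rcases hτ with rfl | rfl
      · exact singleton_mem_sd htK
      · exact hσK
    · rw [Finset.coe_pair]
      exact IsChain.pair (Finset.singleton_subset_iff.2 htσ)
  have hnot : {{bary t}, σ} ∉
      (starUnion (sd K).toPreAbstractSimplicialComplex T (colourClass K i)).faces := by
    rintro ⟨-, h | ⟨x, ⟨u, ⟨hu, hui⟩, rfl⟩, hx⟩⟩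
    · have := hT σ (h σ (by simp))
      omega
    · have := Finset.mem_singleton.1 (hx {bary t} (by simp))
      exact hti (bary_injOn K hu htK this ▸ hui)
  obtain ⟨x, hx, hx'⟩ := exists_mem_space_notMem_space (uniqueWeights_bary (sd K))
    (B := starUnion (sd K).toPreAbstractSimplicialComplex T (colourClass K i))
    (fun _ hf => hf.1) hflag hnot
  intro h
  refine hx' (?_ : x ∈ (colourComplex K T i).space)
  rw [h, ← space_sd K, ← space_sd (sd K)]
  exact hx

lemma colourComplex_space_subset (K : Geometry.SimplicialComplex ℝ (Fin n → ℝ))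
    (T : PreAbstractSimplicialComplex (Fin n → ℝ)) (i : ℕ) :
    (colourComplex K T i).space ⊆ K.space := by
  intro x hx
  rw [← space_sd K, ← space_sd (sd K)]
  obtain ⟨c, hc, h⟩ := mem_space_realize.1 hx
  exact mem_space_realize.2 ⟨c, hc.1, h⟩

/-- A complex all of whose simplices have at most three vertices is the union of its three colour
complexes: the smallest simplex of a flag has a vertex of some colour. -/
lemma space_subset_union_colourComplex {K : Geometry.SimplicialComplex ℝ (Fin n → ℝ)}
    (T : PreAbstractSimplicialComplex (Fin n → ℝ)) (h3 : ∀ s ∈ K.faces, s.card ≤ 3) {x : Fin n → ℝ}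
    (hx : x ∈ K.space) : ∃ i ∈ ({1, 2, 3} : Set ℕ), x ∈ (colourComplex K T i).space := by
  rw [← space_sd K, ← space_sd (sd K)] at hx
  obtain ⟨c, hc, h⟩ := mem_space_realize.1 hx
  obtain ⟨τ, hτ, hmin⟩ := Finset.exists_min_image c Finset.card hc.1
  have hτall : ∀ σ ∈ c, τ ⊆ σ := by
    intro σ hσ
    rcases hc.2.2.total hτ hσ with h | h
    · exact h
    · exact (Finset.eq_of_subset_of_card_le h (hmin σ hσ)).symm.subset
  obtain ⟨d, hd, rfl⟩ := hc.2.1 τ hτ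
  obtain ⟨s, hs⟩ := hd.1
  have hsK := hd.2.1 s hs
  refine ⟨s.card, ?_, mem_space_realize.2 ⟨c, ⟨hc, Or.inr ⟨bary s, ⟨s, ⟨hsK, rfl⟩, rfl⟩,
    fun σ hσ => hτall σ hσ (Finset.mem_image_of_mem _ hs)⟩⟩, h⟩⟩
  have h₁ := (K.nonempty_of_mem_faces hsK).card_pos
  have h₂ := h3 s hsK
  simp only [mem_insert_iff, mem_singleton_iff]
  omega

/-- A connected finite complex of dimension two is covered by three proper collapsible
subpolyhedra. -/
theorem exists_three_collapsible {K : Geometry.SimplicialComplex ℝ (Fin n → ℝ)}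
    (hK : K.faces.Finite) (hconn : IsPreconnected K.space) (h3 : ∀ s ∈ K.faces, s.card ≤ 3)
    (hex : ∃ s ∈ K.faces, s.card = 3) :
    ∃ L : ℕ → Geometry.SimplicialComplex ℝ (Fin n → ℝ),
      (∀ i, (L i).faces.Finite ∧ CollapsibleComplex (L i) ∧ (L i).space ⊆ K.space ∧
        (L i).space ≠ K.space) ∧
      ∀ x ∈ K.space, ∃ i ∈ ({1, 2, 3} : Set ℕ), x ∈ (L i).space := by
  obtain ⟨s, hs, hs3⟩ := hex
  obtain ⟨T, hT, hspan⟩ := exists_spanning_tree (A := (sd K).toPreAbstractSimplicialComplex)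
    (finite_sd hK) ⟨_, singleton_mem_sd hs⟩
    (forall_vertex_mem_of_isPreconnected (finite_sd hK) (by rwa [space_sd]))
  refine ⟨colourComplex K T, fun i => ⟨?_, ?_, colourComplex_space_subset K T i,
    colourComplex_space_ne hT.card_le hs hs3 i⟩,
    fun x hx => space_subset_union_colourComplex T h3 hx⟩
  · exact ((finite_flags (finite_sd hK)).subset fun _ hf => hf.1).image _
  · obtain ⟨B, v, -, hB, hcol⟩ := hT.collapses
    refine collapsibleComplex_realize (Relation.ReflTransGen.trans (starUnion_collapses
      (finite_sd hK) hT.subset ?_ (colourClass_subsingleton K i)) hcol) hB _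
    rintro _ ⟨t, ⟨ht, -⟩, rfl⟩
    exact hspan _ (singleton_mem_sd ht)

end Cover

/-! ### Triangulated spaces with a dense open disk -/

section Triangulated

/-- If a connected space has a dense open subset that embeds openly in the plane, then all its
triangulations are purely two-dimensional, and it is covered by three proper collapsible
subpolyhedra. -/
theorem exists_three_collapsible_of_dense_disk {X B : Type*} [TopologicalSpace X]
    [TopologicalSpace B] [ConnectedSpace X] {i : B → X} (hi : IsOpenEmbedding i)
    (hd : DenseRange i) {k : B → ℂ} (hk : IsOpenEmbedding k) (T : Triangulation X) :
    ∃ A₁ A₂ A₃ : Set X, (∀ A ∈ [A₁, A₂, A₃], A ≠ univ ∧ IsSubpolyhedron T A ∧ IsCollapsible T A) ∧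
      A₁ ∪ A₂ ∪ A₃ = univ := by
  have hfacet : ∀ s ∈ T.complex.facets, s.card = 3 := by
    intro s hs
    obtain ⟨H, Ω, j, hH, hΩ, hne, hj⟩ := exists_isOpenEmbedding_of_mem_facets T.finite_faces hs
    have := finrank_eq_two_of_dense_range hi hd hk hΩ hne
      (T.homeo.isOpenEmbedding.comp hj)
    omega
  have hle : ∀ s ∈ T.complex.faces, ∃ t ∈ T.complex.facets, s ⊆ t := by
    intro s hs
    obtain ⟨t, hst, ht⟩ := T.finite_faces.exists_le_maximal hs
    exact ⟨t, ⟨ht.prop, fun u hu htu => (ht.eq_of_le hu htu)⟩, hst⟩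
  have hspace : IsConnected T.complex.space := by
    have : ConnectedSpace T.complex.space := T.homeo.symm.surjective.connectedSpace
      T.homeo.symm.continuous
    exact isConnected_iff_connectedSpace.2 this
  obtain ⟨x, hx⟩ := hspace.nonempty
  obtain ⟨s, hs, -⟩ := T.complex.mem_space_iff.1 hx
  obtain ⟨t, ht, -⟩ := hle s hs
  obtain ⟨L, hL, hcover⟩ := exists_three_collapsible T.finite_faces hspace.isPreconnected
    (fun s hs => by
      obtain ⟨t, ht, hst⟩ := hle s hs
      exact (Finset.card_le_card hst).trans (hfacet t ht).le) ⟨t, ht.1, hfacet t ht⟩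
  let A : ℕ → Set X := fun i => T.homeo.symm ⁻¹' (Subtype.val ⁻¹' (L i).space)
  have htrace : ∀ i, T.trace (A i) = (L i).space := by
    intro i
    ext x
    constructor
    · rintro ⟨y, hy, rfl⟩
      simpa [A] using hy
    · intro hx
      exact ⟨⟨x, (hL i).2.2.1 hx⟩, by simpa [A] using hx, rfl⟩
  have hA : ∀ i, A i ≠ univ ∧ IsSubpolyhedron T (A i) ∧ IsCollapsible T (A i) := by
    intro i
    refine ⟨fun h => (hL i).2.2.2 ?_, ⟨L i, (hL i).1, (htrace i).symm⟩,
      ⟨L i, (hL i).1, (htrace i).symm, (hL i).2.1⟩⟩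
    rw [← htrace i, h]
    simp [Triangulation.trace]
  refine ⟨A 1, A 2, A 3, ?_, ?_⟩
  · simp only [List.mem_cons, List.not_mem_nil, or_false]
    rintro _ (rfl | rfl | rfl) <;> exact hA _
  · refine eq_univ_of_forall fun x => ?_
    obtain ⟨i, hi, hx⟩ := hcover _ (T.homeo.symm x).2
    rcases hi with rfl | rfl | rfl
    · exact Or.inl (Or.inl hx)
    · exact Or.inl (Or.inr hx)
    · exact Or.inr hx

end Triangulated

/-! ### Triangulations from coordinate functions -/

/-- A compact space that embeds in a standard simplex as a union of closed faces is triangulated. -/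
theorem nonempty_triangulation_of_coordinates {D V : Type*} [TopologicalSpace D] [CompactSpace D]
    [Fintype V] {G : D → V → ℝ} (hG : Continuous G) (hinj : Function.Injective G)
    (hnn : ∀ x i, 0 ≤ G x i) (hsum : ∀ x, ∑ i, G x i = 1)
    (hsupp : ∀ x (w : V → ℝ), (∀ i, 0 ≤ w i) → ∑ i, w i = 1 → (∀ i, G x i = 0 → w i = 0) →
      w ∈ range G) : Nonempty (Triangulation D) := by
  classical
  let e := Fintype.equivFin V
  let A : PreAbstractSimplicialComplex (Fin (Fintype.card V)) :=
    { faces := {s | s.Nonempty ∧ ∃ x, ∀ i ∈ s, G x (e.symm i) ≠ 0}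
      isRelLowerSet_faces := by
        rintro s ⟨hs, x, hx⟩
        exact ⟨hs, fun t hts ht => ⟨ht, x, fun i hi => hx i (hts hi)⟩⟩ }
  let p : Fin (Fintype.card V) → Fin (Fintype.card V) → ℝ := fun i => Pi.single i 1
  have hp : ∀ c (w : Fin (Fintype.card V) → ℝ), IsWeight c w → ∑ i ∈ c, w i • p i = w := by
    intro c w hw
    rw [hw.sum_smul_eq (Finset.subset_univ c)]
    funext j
    simp [p, Finset.sum_apply, Pi.single_apply]
  have hA : UniqueWeights p A := by
    intro c _ c' _ w w' hw hw' h
    rwa [hp c w hw, hp c' w' hw'] at h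
  let g : D → Fin (Fintype.card V) → ℝ := fun x i => G x (e.symm i)
  have hg : Continuous g := continuous_pi fun i => (continuous_apply (e.symm i)).comp hG
  have hginj : Function.Injective g := by
    intro x y hxy
    refine hinj (funext fun i => ?_)
    have := congrFun hxy (e i)
    simpa [g] using this
  have hrange : range g = (realize p A hA).space := by
    ext y
    rw [mem_space_realize]
    constructor
    · rintro ⟨x, rfl⟩
      have hw : IsWeight (Finset.univ.filter fun i => G x (e.symm i) ≠ 0) (g x) := by
        refine ⟨fun i => hnn x _, fun i hi => by simpa using hi, ?_⟩
        rw [Finset.sum_filter_ne_zero, ← hsum x]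
        exact Equiv.sum_comp e.symm (G x)
      exact ⟨_, ⟨hw.nonempty, x, fun i hi => (Finset.mem_filter.1 hi).2⟩, g x, hw, hp _ _ hw⟩
    · rintro ⟨c, ⟨-, x, hx⟩, w, hw, rfl⟩
      rw [hp c w hw]
      obtain ⟨z, hz⟩ := hsupp x (fun v => w (e v)) (fun v => hw.nonneg _)
        (by
          rw [Equiv.sum_comp e w]
          exact (hw.mono (Finset.subset_univ c)).sum_eq_one)
        (fun v hv => hw.eq_zero _ fun hvc => hx _ hvc (by simpa using hv))
      refine ⟨z, funext fun i => ?_⟩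
      have := congrFun hz (e.symm i)
      simpa [g] using this
  have hemb : IsEmbedding g := (hg.isClosedEmbedding hginj).isEmbedding
  exact ⟨⟨Fintype.card V, realize p A hA, (Set.toFinite A.faces).image _,
    (Homeomorph.setCongr hrange.symm).trans hemb.toHomeomorph.symm⟩⟩

/-! ### The triangle as a model of the circle -/

section Triangle

/-- The piecewise linear parametrization of the boundary of the triangle by `[-2, 2]`, which sends
the endpoints to the vertex 2 and `1`, `-1` to the vertices 0, 1. -/
noncomputable def triangleParam (x : ℝ) : Fin 3 → ℝ :=
  ![max 0 (min ((1 + x) / 2) (2 - x)), max 0 (min ((1 - x) / 2) (2 + x)), max 0 (|x| - 1)]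

lemma continuous_triangleParam : Continuous triangleParam := by
  refine continuous_pi fun i => ?_
  fin_cases i <;> simp only [triangleParam] <;> simp <;> fun_prop

lemma triangleParam_zero (x : ℝ) : triangleParam x 0 = max 0 (min ((1 + x) / 2) (2 - x)) := rfl
lemma triangleParam_one (x : ℝ) : triangleParam x 1 = max 0 (min ((1 - x) / 2) (2 + x)) := rfl
lemma triangleParam_two (x : ℝ) : triangleParam x 2 = max 0 (|x| - 1) := rfl

lemma triangleParam_of_le {x : ℝ} (h₁ : x ≤ -1) (h₂ : -2 ≤ x) :
    triangleParam x 0 = 0 ∧ triangleParam x 1 = 2 + x ∧ triangleParam x 2 = -x - 1 := by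
  rw [triangleParam_zero, triangleParam_one, triangleParam_two, abs_of_nonpos (by linarith)]
  refine ⟨max_eq_left (min_le_of_left_le (by linarith)), ?_, max_eq_right (by linarith)⟩
  rw [min_eq_right (by linarith), max_eq_right (by linarith)]

lemma triangleParam_of_mem {x : ℝ} (h₁ : -1 ≤ x) (h₂ : x ≤ 1) :
    triangleParam x 0 = (1 + x) / 2 ∧ triangleParam x 1 = (1 - x) / 2 ∧
      triangleParam x 2 = 0 := by
  rw [triangleParam_zero, triangleParam_one, triangleParam_two]
  refine ⟨?_, ?_, max_eq_left (by linarith [abs_le.2 ⟨h₁, h₂⟩])⟩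
  · rw [min_eq_left (by linarith), max_eq_right (by linarith)]
  · rw [min_eq_left (by linarith), max_eq_right (by linarith)]

lemma triangleParam_of_ge {x : ℝ} (h₁ : 1 ≤ x) (h₂ : x ≤ 2) :
    triangleParam x 0 = 2 - x ∧ triangleParam x 1 = 0 ∧ triangleParam x 2 = x - 1 := by
  rw [triangleParam_zero, triangleParam_one, triangleParam_two, abs_of_nonneg (by linarith)]
  refine ⟨?_, max_eq_left (min_le_of_left_le (by linarith)), max_eq_right (by linarith)⟩
  rw [min_eq_right (by linarith), max_eq_right (by linarith)]

lemma triangleParam_cases {x : ℝ} (hx : x ∈ Icc (-2 : ℝ) 2) :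
    (x ≤ -1 ∧ triangleParam x 0 = 0 ∧ triangleParam x 1 = 2 + x ∧ triangleParam x 2 = -x - 1) ∨
    (-1 ≤ x ∧ x ≤ 1 ∧ triangleParam x 0 = (1 + x) / 2 ∧ triangleParam x 1 = (1 - x) / 2 ∧
      triangleParam x 2 = 0) ∨
    (1 ≤ x ∧ triangleParam x 0 = 2 - x ∧ triangleParam x 1 = 0 ∧ triangleParam x 2 = x - 1) := by
  rcases le_total x (-1) with h | h
  · exact Or.inl ⟨h, triangleParam_of_le h hx.1⟩
  rcases le_total x 1 with h' | h'
  · exact Or.inr (Or.inl ⟨h, h', triangleParam_of_mem h h'⟩)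
  · exact Or.inr (Or.inr ⟨h', triangleParam_of_ge h' hx.2⟩)

lemma triangleParam_injOn : InjOn triangleParam (Ioc (-2) 2) := by
  intro x hx y hy h
  have h0 := congrFun h 0
  have h1 := congrFun h 1
  have h2 := congrFun h 2
  obtain ⟨hx₁, hx₂⟩ := hx
  obtain ⟨hy₁, hy₂⟩ := hy
  rcases triangleParam_cases ⟨hx₁.le, hx₂⟩ with ⟨h, a, b, c⟩ | ⟨h, h', a, b, c⟩ | ⟨h, a, b, c⟩ <;>
  rcases triangleParam_cases ⟨hy₁.le, hy₂⟩ with ⟨k, a', b', c'⟩ | ⟨k, k', a', b', c'⟩ |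
    ⟨k, a', b', c'⟩ <;>
  rw [a, a'] at h0 <;> rw [b, b'] at h1 <;> rw [c, c'] at h2 <;> linarith

/-- Coordinates on a circle that identify it with the boundary of a triangle, such that a given
point `v` becomes the vertex 2 and the open star of this vertex lies in a given neighbourhood. -/
structure IsTriangleCoord {J : Type*} [TopologicalSpace J] (β : J → Fin 3 → ℝ) (v : J)
    (N : Set J) : Prop where
  continuous : Continuous β
  injective : Function.Injective β
  nonneg : ∀ y i, 0 ≤ β y i
  sum_eq_one : ∀ y, ∑ i, β y i = 1
  exists_eq_zero : ∀ y, ∃ i, β y i = 0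
  apply_vertex : β v 2 = 1
  surj : ∀ b : Fin 3 → ℝ, (∀ i, 0 ≤ b i) → ∑ i, b i = 1 → (∃ i, b i = 0) → ∃ y, β y = b
  star_subset : ∀ y, 0 < β y 2 → y ∈ N
  isPreconnected_edge : ∀ i, i ≠ 2 → IsPreconnected {y | 0 < β y 2 ∧ 0 < β y i}

/-- The circle is a triangle whose vertex 2 is a given point with a given small star: parametrize
the circle by `[-2, 2]` so that the image of `[-1, 1]` is almost the whole circle. -/
theorem exists_isTriangleCoord {J : Type*} [TopologicalSpace J] (ψ : Circle ≃ₜ J) (v : J)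
    {N : Set J} (hN : N ∈ 𝓝 v) : ∃ β : J → Fin 3 → ℝ, IsTriangleCoord β v N := by
  have : T2Space J := ψ.symm.isEmbedding.t2Space
  -- the parametrization of the circle by `[-1, 1]`
  obtain ⟨η, hη⟩ : ∃ η : ℝ → J, η = fun t => ψ (ψ.symm v * Circle.exp (Real.pi * (1 + t))) :=
    ⟨_, rfl⟩
  have hηc : Continuous η := by rw [hη]; fun_prop
  have hη1 : η 1 = v := by
    rw [hη]
    have : Circle.exp (Real.pi * (1 + 1)) = 1 := by
      rw [show Real.pi * (1 + 1) = 2 * Real.pi by ring, Circle.exp_two_pi]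
    simp only [this, mul_one, Homeomorph.apply_symm_apply]
  have hηn : η (-1) = v := by rw [hη]; simp
  have hηinj : ∀ s ∈ Ioc (-1 : ℝ) 1, ∀ t ∈ Ioc (-1 : ℝ) 1, η s = η t → s = t := by
    intro s hs t ht hst
    rw [hη] at hst
    have h₁ := mul_left_cancel (ψ.injective hst)
    simp only [mul_add, Circle.exp_add] at h₁
    have h₂ := mul_left_cancel h₁
    have hπ := Real.pi_pos
    have := Circle.injective_arg.eq_iff.2 h₂
    rw [Circle.arg_exp (by nlinarith [hs.1]) (by nlinarith [hs.2]),
      Circle.arg_exp (by nlinarith [ht.1]) (by nlinarith [ht.2])] at this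
    exact mul_left_cancel₀ hπ.ne' this
  have hηsurj : ∀ y, ∃ t ∈ Ioc (-1 : ℝ) 1, η t = y := by
    intro y
    obtain ⟨z, hz⟩ : ∃ z : Circle, z = Circle.exp (-Real.pi) * ((ψ.symm v)⁻¹ * ψ.symm y) := ⟨_, rfl⟩
    have hπ := Real.pi_pos
    refine ⟨Complex.arg z / Real.pi, ⟨?_, ?_⟩, ?_⟩
    · rw [lt_div_iff₀ hπ]; simpa using Complex.neg_pi_lt_arg z
    · rw [div_le_iff₀ hπ]; simpa using Complex.arg_le_pi z
    · rw [hη]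
      simp only [mul_add, mul_div_cancel₀ _ hπ.ne', Circle.exp_add, Circle.exp_arg, mul_one]
      rw [hz, ← mul_assoc (Circle.exp Real.pi), ← Circle.exp_add, add_neg_cancel, Circle.exp_zero,
        one_mul, mul_inv_cancel_left, Homeomorph.apply_symm_apply]
  obtain ⟨δ, hδ0, hδ1, hδN⟩ : ∃ δ : ℝ, 0 < δ ∧ δ < 1 ∧ ∀ t ∈ Icc (-1 : ℝ) 1, δ < |t| → η t ∈ N := by
    have h₁ : η ⁻¹' N ∈ 𝓝 (1 : ℝ) := hηc.continuousAt.preimage_mem_nhds (by rwa [hη1])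
    have h₂ : η ⁻¹' N ∈ 𝓝 (-1 : ℝ) := hηc.continuousAt.preimage_mem_nhds (by rwa [hηn])
    obtain ⟨ε₁, hε₁, h₁⟩ := Metric.mem_nhds_iff.1 h₁
    obtain ⟨ε₂, hε₂, h₂⟩ := Metric.mem_nhds_iff.1 h₂
    have hm : 0 < min (1 / 2) (min ε₁ ε₂) := by positivity
    have hm1 : min (1 / 2) (min ε₁ ε₂) ≤ 1 / 2 := min_le_left _ _
    have hm2 : min (1 / 2) (min ε₁ ε₂) ≤ ε₁ := (min_le_right _ _).trans (min_le_left _ _)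
    have hm3 : min (1 / 2) (min ε₁ ε₂) ≤ ε₂ := (min_le_right _ _).trans (min_le_right _ _)
    refine ⟨1 - min (1 / 2) (min ε₁ ε₂), by linarith, by linarith, fun t ht hlt => ?_⟩
    rcases lt_abs.1 hlt with h | h
    · refine h₁ ?_
      rw [Metric.mem_ball, Real.dist_eq, abs_lt]
      constructor <;> linarith [ht.2]
    · refine h₂ ?_
      rw [Metric.mem_ball, Real.dist_eq, abs_lt]
      constructor <;> linarith [ht.1]
  -- the reparametrization of `[-1, 1]` by `[-2, 2]`
  obtain ⟨c, hc⟩ : ∃ c : ℝ → ℝ, c = fun x => max (-1) (min 1 x) := ⟨_, rfl⟩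
  have hcc : Continuous c := by rw [hc]; fun_prop
  have hc₁ : ∀ x, x ≤ -1 → c x = -1 := fun x hx => by
    rw [hc]; exact max_eq_left (min_le_of_right_le hx)
  have hc₂ : ∀ x, 1 ≤ x → c x = 1 := fun x hx => by
    rw [hc]; simp only; rw [min_eq_left hx, max_eq_right (by linarith)]
  have hc₃ : ∀ x, -1 ≤ x → x ≤ 1 → c x = x := fun x hx hx' => by
    rw [hc]; simp only; rw [min_eq_right hx', max_eq_right hx]
  obtain ⟨h, hh⟩ : ∃ h : ℝ → ℝ, h = fun x => δ * c x + (1 - δ) * (x - c x) := ⟨_, rfl⟩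
  have hhc : Continuous h := by rw [hh]; fun_prop
  have hmono : StrictMono h := by
    intro x y hxy
    have h₁ : c x ≤ c y ∧ x - c x ≤ y - c y := by
      rcases le_total x (-1) with a | a <;> rcases le_total x 1 with a' | a' <;>
      rcases le_total y (-1) with b | b <;> rcases le_total y 1 with b' | b' <;>
      first
      | (rw [hc₁ x a, hc₁ y b]; constructor <;> linarith)
      | (rw [hc₁ x a, hc₂ y b']; constructor <;> linarith)
      | (rw [hc₁ x a, hc₃ y b b']; constructor <;> linarith)
      | (rw [hc₂ x a', hc₁ y b]; constructor <;> linarith)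
      | (rw [hc₂ x a', hc₂ y b']; constructor <;> linarith)
      | (rw [hc₂ x a', hc₃ y b b']; constructor <;> linarith)
      | (rw [hc₃ x a a', hc₁ y b]; constructor <;> linarith)
      | (rw [hc₃ x a a', hc₂ y b']; constructor <;> linarith)
      | (rw [hc₃ x a a', hc₃ y b b']; constructor <;> linarith)
    rw [hh]
    simp only
    have h₂ : 0 ≤ δ * (c y - c x) := mul_nonneg hδ0.le (by linarith)
    have h₃ : 0 ≤ (1 - δ) * ((y - c y) - (x - c x)) := mul_nonneg (by linarith) (by linarith)
    rcases h₁.1.eq_or_lt with h₄ | h₄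
    · have : 0 < (1 - δ) * ((y - c y) - (x - c x)) := mul_pos (by linarith) (by linarith)
      linarith
    · have : 0 < δ * (c y - c x) := mul_pos hδ0 (by linarith)
      linarith
  have hh2 : h 2 = 1 := by rw [hh]; simp only; rw [hc₂ 2 (by norm_num)]; ring
  have hhn2 : h (-2) = -1 := by rw [hh]; simp only; rw [hc₁ (-2) (by norm_num)]; ring
  have hh1 : h 1 = δ := by rw [hh]; simp only; rw [hc₂ 1 le_rfl]; ring
  have hhn1 : h (-1) = -δ := by rw [hh]; simp only; rw [hc₁ (-1) le_rfl]; ring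
  have hsurj : ∀ y, ∃ x ∈ Ioc (-2 : ℝ) 2, η (h x) = y := by
    intro y
    obtain ⟨t, ht, rfl⟩ := hηsurj y
    obtain ⟨x, hx, rfl⟩ := intermediate_value_Ioc (by norm_num : (-2 : ℝ) ≤ 2) hhc.continuousOn
      (by rwa [hh2, hhn2])
    exact ⟨x, hx, rfl⟩
  choose σ hσ hησ using hsurj
  have hσuniq : ∀ x ∈ Ioc (-2 : ℝ) 2, σ (η (h x)) = x := by
    intro x hx
    refine hmono.injective (hηinj _ ?_ _ ?_ (hησ _))
    · rw [← hhn2, ← hh2]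
      exact ⟨hmono (hσ _).1, hmono.monotone (hσ _).2⟩
    · rw [← hhn2, ← hh2]
      exact ⟨hmono hx.1, hmono.monotone hx.2⟩
  obtain ⟨β, hβ⟩ : ∃ β : J → Fin 3 → ℝ, β = fun y => triangleParam (σ y) := ⟨_, rfl⟩
  have hβη : ∀ x ∈ Icc (-2 : ℝ) 2, β (η (h x)) = triangleParam x := by
    intro x hx
    rcases hx.1.eq_or_lt with rfl | hlt
    · -- both endpoints of the interval are mapped to the vertex 2
      rw [hhn2, hηn, ← hη1, ← hh2, hβ]
      simp only
      rw [hσuniq 2 (by norm_num)]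
      obtain ⟨a, b, d⟩ := triangleParam_of_ge (x := 2) (by norm_num) le_rfl
      obtain ⟨a', b', d'⟩ := triangleParam_of_le (x := -2) (by norm_num) le_rfl
      funext i
      fin_cases i
      · exact a.trans (Eq.trans (by norm_num) a'.symm)
      · exact b.trans (Eq.trans (by norm_num) b'.symm)
      · exact d.trans (Eq.trans (by norm_num) d'.symm)
    · rw [hβ]
      simp only
      rw [hσuniq x ⟨hlt, hx.2⟩]
  have hσcases := fun y => triangleParam_cases (Ioc_subset_Icc_self (hσ y))
  have hβσ : ∀ y, β y = triangleParam (σ y) := fun y => by rw [hβ]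
  refine ⟨β, ?_, ?_, ?_, ?_, ?_, ?_, ?_, ?_, ?_⟩
  · -- `β` is continuous, because `[-2, 2] → J` is a quotient map
    have hq : IsQuotientMap (fun x : Icc (-2 : ℝ) 2 => η (h x)) := by
      have hcont : Continuous fun x : Icc (-2 : ℝ) 2 => η (h x) :=
        (hηc.comp hhc).comp continuous_subtype_val
      refine hcont.isClosedMap.isQuotientMap hcont fun y => ?_
      exact ⟨⟨σ y, Ioc_subset_Icc_self (hσ y)⟩, hησ y⟩
    rw [hq.continuous_iff]
    have : β ∘ (fun x : Icc (-2 : ℝ) 2 => η (h x)) =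
        fun x : Icc (-2 : ℝ) 2 => triangleParam x := funext fun x => hβη x x.2
    rw [this]
    exact continuous_triangleParam.comp continuous_subtype_val
  · intro y z hyz
    rw [hβσ, hβσ] at hyz
    rw [← hησ y, ← hησ z, triangleParam_injOn (hσ y) (hσ z) hyz]
  · intro y i
    rw [hβσ]
    fin_cases i <;> exact le_max_left _ _
  · intro y
    rw [Fin.sum_univ_three, hβσ]
    rcases hσcases y with ⟨-, a, b, d⟩ | ⟨-, -, a, b, d⟩ | ⟨-, a, b, d⟩ <;> rw [a, b, d] <;> ring
  · intro y
    rw [hβσ]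
    rcases hσcases y with ⟨-, a, b, d⟩ | ⟨-, -, a, b, d⟩ | ⟨-, a, b, d⟩
    · exact ⟨0, a⟩
    · exact ⟨2, d⟩
    · exact ⟨1, b⟩
  · have := hβη 2 (by norm_num)
    rw [hh2, hη1] at this
    rw [this, (triangleParam_of_ge (x := 2) (by norm_num) le_rfl).2.2]
    norm_num
  · intro b hb hsum hzero
    rw [Fin.sum_univ_three] at hsum
    have h0 := hb 0
    have h1 := hb 1
    have h2 := hb 2
    have build : ∀ x ∈ Icc (-2 : ℝ) 2, triangleParam x 0 = b 0 → triangleParam x 1 = b 1 →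
        triangleParam x 2 = b 2 → ∃ y, β y = b := by
      intro x hx e0 e1 e2
      refine ⟨η (h x), ?_⟩
      rw [hβη x hx]
      funext i
      fin_cases i
      · exact e0
      · exact e1
      · exact e2
    obtain ⟨i, hi⟩ := hzero
    fin_cases i
    · have hi : b 0 = 0 := hi
      obtain ⟨a', b', d'⟩ := triangleParam_of_le (x := b 1 - 2) (by linarith) (by linarith)
      refine build (b 1 - 2) ⟨by linarith, by linarith⟩ ?_ ?_ ?_ <;> linarith
    · have hi : b 1 = 0 := hi
      obtain ⟨a', b', d'⟩ := triangleParam_of_ge (x := 2 - b 0) (by linarith) (by linarith)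
      refine build (2 - b 0) ⟨by linarith, by linarith⟩ ?_ ?_ ?_ <;> linarith
    · have hi : b 2 = 0 := hi
      obtain ⟨a', b', d'⟩ := triangleParam_of_mem (x := 2 * b 0 - 1) (by linarith) (by linarith)
      refine build (2 * b 0 - 1) ⟨by linarith, by linarith⟩ ?_ ?_ ?_ <;> linarith
  · intro y hy
    rw [hβσ] at hy
    rw [← hησ y]
    have hIcc : h (σ y) ∈ Icc (-1 : ℝ) 1 := by
      rw [← hhn2, ← hh2]
      exact ⟨hmono.monotone (hσ y).1.le, hmono.monotone (hσ y).2⟩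
    refine hδN _ hIcc ?_
    rcases hσcases y with ⟨k, a, b, d⟩ | ⟨-, -, a, b, d⟩ | ⟨k, a, b, d⟩ <;> rw [d] at hy
    · refine lt_abs.2 (Or.inr ?_)
      have := hmono (show σ y < -1 by linarith)
      linarith
    · exact (lt_irrefl _ hy).elim
    · refine lt_abs.2 (Or.inl ?_)
      have := hmono (show 1 < σ y by linarith)
      linarith
  · intro i hi
    have hpre : ∀ a b : ℝ, IsPreconnected ((fun x => η (h x)) '' Ioo a b) := fun a b =>
      isPreconnected_Ioo.image _ (hηc.comp hhc).continuousOn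
    have hcase : i = 0 ∨ i = 1 := by
      fin_cases i
      · exact Or.inl rfl
      · exact Or.inr rfl
      · exact (hi rfl).elim
    rcases hcase with rfl | rfl
    · convert! hpre 1 2 using 1
      ext y
      constructor
      · rintro ⟨h₁, h₂⟩
        rw [hβσ] at h₁ h₂
        refine ⟨σ y, ?_, hησ y⟩
        rcases hσcases y with ⟨-, a, b, d⟩ | ⟨-, -, a, b, d⟩ | ⟨-, a, b, d⟩ <;>
          rw [d] at h₁ <;> rw [a] at h₂ <;> constructor <;> linarith
      · rintro ⟨x, ⟨h₁, h₂⟩, rfl⟩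
        obtain ⟨a, b, d⟩ := triangleParam_of_ge h₁.le h₂.le
        rw [mem_ofPred_eq, hβη x ⟨by linarith, h₂.le⟩, a, d]
        constructor <;> linarith
    · convert! hpre (-2) (-1) using 1
      ext y
      constructor
      · rintro ⟨h₁, h₂⟩
        rw [hβσ] at h₁ h₂
        refine ⟨σ y, ?_, hησ y⟩
        rcases hσcases y with ⟨-, a, b, d⟩ | ⟨-, -, a, b, d⟩ | ⟨-, a, b, d⟩ <;>
          rw [d] at h₁ <;> rw [b] at h₂ <;> constructor <;> linarith
      · rintro ⟨x, ⟨h₁, h₂⟩, rfl⟩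
        obtain ⟨a, b, d⟩ := triangleParam_of_le h₂.le h₁.le
        rw [mem_ofPred_eq, hβη x ⟨h₁.le, by linarith⟩, b, d]
        constructor <;> linarith

end Triangle

/-! ### Coordinates on the mapping cylinder -/

section Levels

/-- In the staircase triangulation of the prism over a triangle, the point at the level `t` over the
point with coordinates `b` has the coordinates `b i - lowerPart b t i` with respect to the vertices
of the triangle at the level 0 and `lowerPart b t i` with respect to those at the level 1: lay
intervals of lengths `b 2`, `b 1`, `b 0` end to end in this order, and take the lengths of their
intersections with `[0, t]`. -/
noncomputable def lowerPart (b : Fin 3 → ℝ) (t : ℝ) : Fin 3 → ℝ :=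
  ![t - min t (b 1 + b 2), min t (b 1 + b 2) - min t (b 2), min t (b 2)]

variable {b : Fin 3 → ℝ} {t : ℝ}

lemma lowerPart_zero : lowerPart b t 0 = t - min t (b 1 + b 2) := rfl
lemma lowerPart_one : lowerPart b t 1 = min t (b 1 + b 2) - min t (b 2) := rfl
lemma lowerPart_two : lowerPart b t 2 = min t (b 2) := rfl

lemma sum_lowerPart : ∑ i, lowerPart b t i = t := by
  rw [Fin.sum_univ_three, lowerPart_zero, lowerPart_one, lowerPart_two]; ring

/-- The three positions of the level `t` relative to the intervals. -/
lemma lowerPart_cases (hb : ∀ i, 0 ≤ b i) :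
    (t ≤ b 2 ∧ lowerPart b t 0 = 0 ∧ lowerPart b t 1 = 0 ∧ lowerPart b t 2 = t) ∨
    (b 2 ≤ t ∧ t ≤ b 1 + b 2 ∧ lowerPart b t 0 = 0 ∧ lowerPart b t 1 = t - b 2 ∧
      lowerPart b t 2 = b 2) ∨
    (b 1 + b 2 ≤ t ∧ lowerPart b t 0 = t - (b 1 + b 2) ∧ lowerPart b t 1 = b 1 ∧
      lowerPart b t 2 = b 2) := by
  have h1 := hb 1
  have h2 := hb 2
  rw [lowerPart_zero, lowerPart_one, lowerPart_two]
  rcases le_total t (b 2) with h | h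
  · rw [min_eq_left h, min_eq_left (by linarith : t ≤ b 1 + b 2)]
    exact Or.inl ⟨h, by ring, by ring, rfl⟩
  rcases le_total t (b 1 + b 2) with h' | h'
  · rw [min_eq_right h, min_eq_left h']
    exact Or.inr (Or.inl ⟨h, h', by ring, rfl, rfl⟩)
  · rw [min_eq_right h, min_eq_right h']
    exact Or.inr (Or.inr ⟨h', rfl, by ring, rfl⟩)

lemma forall_fin_three {P : Fin 3 → Prop} (h0 : P 0) (h1 : P 1) (h2 : P 2) : ∀ i, P i := by
  intro i
  fin_cases i
  · exact h0
  · exact h1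
  · exact h2

lemma lowerPart_mem (hb : ∀ i, 0 ≤ b i) (hsum : ∑ i, b i = 1) (ht : 0 ≤ t) (ht' : t ≤ 1) :
    ∀ i, 0 ≤ lowerPart b t i ∧ lowerPart b t i ≤ b i := by
  rw [Fin.sum_univ_three] at hsum
  have h0 := hb 0
  have h1 := hb 1
  have h2 := hb 2
  rcases lowerPart_cases (t := t) hb with ⟨h, a, b', c⟩ | ⟨h, h', a, b', c⟩ | ⟨h, a, b', c⟩ <;>
  refine forall_fin_three ?_ ?_ ?_ <;> simp only [a, b', c] <;> constructor <;> linarith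

lemma lowerPart_level_one (hb : ∀ i, 0 ≤ b i) (hsum : ∑ i, b i = 1) : lowerPart b 1 = b := by
  have h : ∀ i, 0 ≤ b i - lowerPart b 1 i := fun i =>
    sub_nonneg.2 (lowerPart_mem hb hsum zero_le_one le_rfl i).2
  have h' : ∑ i, (b i - lowerPart b 1 i) = 0 := by
    rw [Finset.sum_sub_distrib, hsum, sum_lowerPart, sub_self]
  funext i
  exact (sub_eq_zero.1 ((Finset.sum_eq_zero_iff_of_nonneg fun i _ => h i).1 h' i
    (Finset.mem_univ i))).symm

lemma lowerPart_level_zero (hb : ∀ i, 0 ≤ b i) (hsum : ∑ i, b i = 1) : lowerPart b 0 = 0 := by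
  funext i
  exact (Finset.sum_eq_zero_iff_of_nonneg
    fun i _ => (lowerPart_mem hb hsum le_rfl zero_le_one i).1).1 sum_lowerPart i (Finset.mem_univ i)

/-- Below the level 1, the first coordinate that occurs does so above that level. -/
lemma lowerPart_lt (hb : ∀ i, 0 ≤ b i) (hsum : ∑ i, b i = 1) (ht : t < 1) :
    ∀ i, 0 < b i → (∀ k, k < i → b k = 0) → lowerPart b t i < b i := by
  rw [Fin.sum_univ_three] at hsum
  have h0 := hb 0
  have h1 := hb 1
  have h2 := hb 2
  have e0 : (∀ k : Fin 3, k < 1 → b k = 0) → b 0 = 0 := fun h => h 0 (by decide)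
  have e1 : (∀ k : Fin 3, k < 2 → b k = 0) → b 0 = 0 ∧ b 1 = 0 :=
    fun h => ⟨h 0 (by decide), h 1 (by decide)⟩
  rcases lowerPart_cases (t := t) hb with ⟨h, a, b', c⟩ | ⟨h, h', a, b', c⟩ | ⟨h, a, b', c⟩ <;>
  refine forall_fin_three ?_ ?_ ?_ <;> simp only [a, b', c] <;> intro hpos hz <;>
  first
  | linarith
  | linarith [e0 hz]
  | linarith [(e1 hz).1, (e1 hz).2]

/-- If a coordinate occurs above the level `t`, then the ones with smaller index do not occur
below it. -/
lemma lowerPart_eq_zero (hb : ∀ i, 0 ≤ b i) :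
    ∀ k i, i < k → lowerPart b t k < b k → lowerPart b t i = 0 := by
  rcases lowerPart_cases (t := t) hb with ⟨h, a, b', c⟩ | ⟨h, h', a, b', c⟩ | ⟨h, a, b', c⟩ <;>
  refine forall_fin_three (forall_fin_three ?_ ?_ ?_) (forall_fin_three ?_ ?_ ?_)
    (forall_fin_three ?_ ?_ ?_) <;> intro hlt <;>
  first
  | (exfalso; revert hlt; decide)
  | (intro hpos; first | exact a | exact b' | linarith)

/-- The coordinates below a level are recovered from a splitting of `b` for which no coordinate
that occurs below the level has a smaller index than one that occurs above it. -/
lemma lowerPart_eq_of_staircase {j κ : Fin 3 → ℝ} (hj : ∀ i, 0 ≤ j i) (hκ : ∀ i, 0 ≤ κ i)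
    (hst : ∀ k i, i < k → 0 < κ k → j i = 0) :
    lowerPart (fun i => j i + κ i) (∑ i, j i) = j := by
  have j0 := hj 0
  have j1 := hj 1
  have j2 := hj 2
  have k0 := hκ 0
  have k1 := hκ 1
  have k2 := hκ 2
  have h10 : κ 1 = 0 ∨ j 0 = 0 := by
    rcases k1.eq_or_lt with h | h
    · exact Or.inl h.symm
    · exact Or.inr (hst 1 0 (by decide) h)
  have h2 : κ 2 = 0 ∨ (j 0 = 0 ∧ j 1 = 0) := by
    rcases k2.eq_or_lt with h | h
    · exact Or.inl h.symm
    · exact Or.inr ⟨hst 2 0 (by decide) h, hst 2 1 (by decide) h⟩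
  have hb : ∀ i, 0 ≤ j i + κ i := fun i => add_nonneg (hj i) (hκ i)
  have hcases := lowerPart_cases (t := ∑ i, j i) hb
  simp only [Fin.sum_univ_three] at hcases ⊢
  funext i
  revert i
  rcases hcases with ⟨h, a, b', c⟩ | ⟨h, h', a, b', c⟩ | ⟨h, a, b', c⟩ <;>
  rcases h10 with h10 | h10 <;> rcases h2 with h2 | ⟨h2, h2'⟩ <;>
  refine forall_fin_three ?_ ?_ ?_ <;> simp only [a, b', c] <;> linarith

lemma continuous_lowerPart {X : Type*} [TopologicalSpace X] {b : X → Fin 3 → ℝ} {t : X → ℝ}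
    (hb : Continuous b) (ht : Continuous t) : Continuous fun x => lowerPart (b x) (t x) := by
  have hb' : ∀ i, Continuous fun x => b x i := fun i => (continuous_apply i).comp hb
  refine continuous_pi (forall_fin_three ?_ ?_ ?_)
  · exact ht.sub (ht.min ((hb' 1).add (hb' 2)))
  · exact (ht.min ((hb' 1).add (hb' 2))).sub (ht.min (hb' 2))
  · exact ht.min (hb' 2)

end Levels

section Ring

variable {S R : Type*} [TopologicalSpace S] [Fintype R]

/-- A triangulation of the one-dimensional space `S` with set of vertices `R`, in terms of a
simplicial map to a triangle with coordinates `b`. The vertex `ρ` lies over the vertex `π ρ` of the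
triangle, and its open star is the part of `O ρ` on which the coordinate `π ρ` does not vanish. A
point is determined by its image and the first vertex of its simplex, and the points of the faces
of the image of a simplex lift to that simplex (`lift`). -/
structure IsRing (b : S → Fin 3 → ℝ) (π : R → Fin 3) (O : R → Set S) : Prop where
  continuous : Continuous b
  nonneg : ∀ θ i, 0 ≤ b θ i
  sum_eq_one : ∀ θ, ∑ i, b θ i = 1
  frontier : ∀ ρ, ∀ θ ∈ frontier (O ρ), b θ (π ρ) = 0
  existsUnique : ∀ θ i, 0 < b θ i → ∃ ρ, π ρ = i ∧ θ ∈ O ρ ∧ ∀ ρ', π ρ' = i → θ ∈ O ρ' → ρ' = ρ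
  inj : ∀ θ θ' ρ, b θ = b θ' → θ ∈ O ρ → θ' ∈ O ρ → 0 < b θ (π ρ) →
    (∀ k, k < π ρ → b θ k = 0) → θ = θ'
  lift : ∀ θ₀ (b' : Fin 3 → ℝ), (∀ i, 0 ≤ b' i) → ∑ i, b' i = 1 → (∀ i, b θ₀ i = 0 → b' i = 0) →
    ∃ θ, b θ = b' ∧ ∀ ρ, 0 < b' (π ρ) → (θ ∈ O ρ ↔ θ₀ ∈ O ρ)

/-- The weight of the ring and the base at the radius `r` of the disk. -/
noncomputable def coneWeight (r : ℝ) : ℝ := max 0 (min 1 (2 * r))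

/-- The level of the radius `r` in the mapping cylinder. -/
noncomputable def cylLevel (r : ℝ) : ℝ := max 0 (min 1 (2 * r - 1))

lemma coneWeight_mem (r : ℝ) : 0 ≤ coneWeight r ∧ coneWeight r ≤ 1 :=
  ⟨le_max_left _ _, max_le zero_le_one (min_le_left _ _)⟩

lemma cylLevel_mem (r : ℝ) : 0 ≤ cylLevel r ∧ cylLevel r ≤ 1 :=
  ⟨le_max_left _ _, max_le zero_le_one (min_le_left _ _)⟩

lemma radius_cases {r : ℝ} (hr : r ∈ Icc (0 : ℝ) 1) :
    (r ≤ 1 / 2 ∧ coneWeight r = 2 * r ∧ cylLevel r = 0) ∨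
    (1 / 2 ≤ r ∧ coneWeight r = 1 ∧ cylLevel r = 2 * r - 1) := by
  obtain ⟨h0, h1⟩ := hr
  unfold coneWeight cylLevel
  rcases le_total r (1 / 2) with h | h
  · refine Or.inl ⟨h, ?_, ?_⟩
    · rw [min_eq_right (by linarith), max_eq_right (by linarith)]
    · exact max_eq_left (min_le_of_right_le (by linarith))
  · refine Or.inr ⟨h, ?_, ?_⟩
    · rw [min_eq_left (by linarith), max_eq_right (by linarith)]
    · rw [min_eq_right (by linarith), max_eq_right (by linarith)]

/-- Barycentric coordinates of the point of the disk with angle `θ` and radius `r`, with respect to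
the centre (`none`), the vertices of the ring at radius `1/2`, and the vertices of the triangle to
which the boundary is attached. -/
noncomputable def diskCoord (b : S → Fin 3 → ℝ) (π : R → Fin 3) (O : R → Set S) (x : S × ℝ) :
    Option (R ⊕ Fin 3) → ℝ
  | none => 1 - coneWeight x.2
  | some (Sum.inl ρ) => coneWeight x.2 *
      (O ρ ×ˢ univ).indicator (fun x : S × ℝ => b x.1 (π ρ) - lowerPart (b x.1) (cylLevel x.2) (π ρ)) x
  | some (Sum.inr i) => coneWeight x.2 * lowerPart (b x.1) (cylLevel x.2) i

variable {b : S → Fin 3 → ℝ} {π : R → Fin 3} {O : R → Set S}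

omit [TopologicalSpace S] [Fintype R] in
lemma diskCoord_none (x : S × ℝ) : diskCoord b π O x none = 1 - coneWeight x.2 := rfl

omit [TopologicalSpace S] [Fintype R] in
lemma diskCoord_base (x : S × ℝ) (i : Fin 3) : diskCoord b π O x (some (Sum.inr i)) =
    coneWeight x.2 * lowerPart (b x.1) (cylLevel x.2) i := rfl

omit [TopologicalSpace S] [Fintype R] in
lemma diskCoord_ring_of_mem {x : S × ℝ} {ρ : R} (h : x.1 ∈ O ρ) :
    diskCoord b π O x (some (Sum.inl ρ)) =
      coneWeight x.2 * (b x.1 (π ρ) - lowerPart (b x.1) (cylLevel x.2) (π ρ)) := by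
  change coneWeight x.2 * (O ρ ×ˢ univ).indicator _ x = _
  rw [indicator_of_mem (show x ∈ O ρ ×ˢ univ from ⟨h, mem_univ _⟩)]

omit [TopologicalSpace S] [Fintype R] in
lemma diskCoord_ring_of_notMem {x : S × ℝ} {ρ : R} (h : x.1 ∉ O ρ) :
    diskCoord b π O x (some (Sum.inl ρ)) = 0 := by
  change coneWeight x.2 * (O ρ ×ˢ univ).indicator _ x = _
  rw [indicator_of_notMem (show x ∉ O ρ ×ˢ univ from fun h' => h h'.1), mul_zero]

omit [Fintype R] in
lemma IsRing.continuous_diskCoord (h : IsRing b π O) : Continuous (diskCoord b π O) := by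
  have hb : Continuous fun x : S × ℝ => b x.1 := h.continuous.comp continuous_fst
  have hu : Continuous fun x : S × ℝ => coneWeight x.2 := by unfold coneWeight; fun_prop
  have ht : Continuous fun x : S × ℝ => cylLevel x.2 := by unfold cylLevel; fun_prop
  have hlow := continuous_lowerPart hb ht
  refine continuous_pi ?_
  rintro (_ | ρ | i)
  · exact continuous_const.sub hu
  · refine hu.mul (continuous_indicator ?_ (Continuous.continuousOn ?_))
    · rintro x hx
      rw [frontier_prod_univ_eq] at hx
      have h0 := h.frontier ρ x.1 hx.1
      have := lowerPart_mem (h.nonneg x.1) (h.sum_eq_one x.1) (cylLevel_mem x.2).1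
        (cylLevel_mem x.2).2 (π ρ)
      rw [h0] at this ⊢
      linarith
    · exact ((continuous_apply (π ρ)).comp hb).sub ((continuous_apply (π ρ)).comp hlow)
  · exact hu.mul ((continuous_apply i).comp hlow)

omit [Fintype R] in
lemma IsRing.diskCoord_nonneg (h : IsRing b π O) (x : S × ℝ) (v : Option (R ⊕ Fin 3)) :
    0 ≤ diskCoord b π O x v := by
  have hu := coneWeight_mem x.2
  have hlow := lowerPart_mem (h.nonneg x.1) (h.sum_eq_one x.1) (cylLevel_mem x.2).1
    (cylLevel_mem x.2).2
  rcases v with _ | ρ | i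
  · rw [diskCoord_none]; linarith
  · by_cases hx : x.1 ∈ O ρ
    · rw [diskCoord_ring_of_mem hx]
      exact mul_nonneg hu.1 (sub_nonneg.2 (hlow _).2)
    · rw [diskCoord_ring_of_notMem hx]
  · exact mul_nonneg hu.1 (hlow i).1

/-- The ring weights over the vertex `i` of the triangle. -/
lemma IsRing.sum_diskCoord_ring [DecidableEq R] (h : IsRing b π O) (x : S × ℝ) (i : Fin 3) :
    ∑ ρ with π ρ = i, diskCoord b π O x (some (Sum.inl ρ)) =
      coneWeight x.2 * (b x.1 i - lowerPart (b x.1) (cylLevel x.2) i) := by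
  have hlow := lowerPart_mem (h.nonneg x.1) (h.sum_eq_one x.1) (cylLevel_mem x.2).1
    (cylLevel_mem x.2).2 i
  rcases (h.nonneg x.1 i).eq_or_lt with hb | hb
  · rw [show b x.1 i - lowerPart (b x.1) (cylLevel x.2) i = 0 by linarith, mul_zero]
    refine Finset.sum_eq_zero fun ρ hρ => ?_
    have hρ : π ρ = i := (Finset.mem_filter.1 hρ).2
    by_cases hx : x.1 ∈ O ρ
    · rw [diskCoord_ring_of_mem hx, hρ,
        show b x.1 i - lowerPart (b x.1) (cylLevel x.2) i = 0 by linarith, mul_zero]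
    · rw [diskCoord_ring_of_notMem hx]
  · obtain ⟨ρ, hρ, hx, huniq⟩ := h.existsUnique x.1 i hb
    rw [Finset.sum_eq_single ρ, diskCoord_ring_of_mem hx, hρ]
    · intro ρ' hρ' hne
      exact diskCoord_ring_of_notMem fun hx' => hne (huniq ρ' (Finset.mem_filter.1 hρ').2 hx')
    · exact fun hn => (hn (Finset.mem_filter.2 ⟨Finset.mem_univ _, hρ⟩)).elim

omit [TopologicalSpace S] in
lemma sum_option_ring [DecidableEq R] (π : R → Fin 3) (w : Option (R ⊕ Fin 3) → ℝ) :
    ∑ v, w v = w none + ∑ i, (∑ ρ with π ρ = i, w (some (Sum.inl ρ)) + w (some (Sum.inr i))) := by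
  rw [Fintype.sum_option, Fintype.sum_sum_type, Finset.sum_add_distrib,
    Finset.sum_fiberwise]

lemma IsRing.sum_diskCoord [DecidableEq R] (h : IsRing b π O) (x : S × ℝ) :
    ∑ v, diskCoord b π O x v = 1 := by
  rw [sum_option_ring π]
  simp only [h.sum_diskCoord_ring, diskCoord_none, diskCoord_base, ← mul_add, sub_add_cancel]
  rw [← Finset.mul_sum, h.sum_eq_one]
  ring

/-- Points of the disk with the same coordinates are equal, or are both the centre, or lie on the
boundary over the same point of the triangle. -/
lemma IsRing.diskCoord_inj [DecidableEq R] (h : IsRing b π O) {x y : S × ℝ}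
    (hx : x.2 ∈ Icc (0 : ℝ) 1) (hy : y.2 ∈ Icc (0 : ℝ) 1)
    (hxy : diskCoord b π O x = diskCoord b π O y) :
    x = y ∨ (x.2 = 0 ∧ y.2 = 0) ∨ (x.2 = 1 ∧ y.2 = 1 ∧ b x.1 = b y.1) := by
  have hu : coneWeight x.2 = coneWeight y.2 := by
    have := congrFun hxy none
    rw [diskCoord_none, diskCoord_none] at this
    linarith
  rcases (coneWeight_mem x.2).1.eq_or_lt with hu0 | hu0
  · right; left
    rcases radius_cases hx with ⟨a, b', c⟩ | ⟨a, b', c⟩ <;>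
    rcases radius_cases hy with ⟨a', b'', c'⟩ | ⟨a', b'', c'⟩ <;> constructor <;> linarith
  have hlow : lowerPart (b x.1) (cylLevel x.2) = lowerPart (b y.1) (cylLevel y.2) := by
    funext i
    have := congrFun hxy (some (Sum.inr i))
    rw [diskCoord_base, diskCoord_base, ← hu] at this
    exact mul_left_cancel₀ hu0.ne' this
  have hb : b x.1 = b y.1 := by
    funext i
    have := h.sum_diskCoord_ring x i
    rw [hxy, h.sum_diskCoord_ring y i, ← hu, ← hlow] at this
    have := mul_left_cancel₀ hu0.ne' this
    linarith
  have ht : cylLevel x.2 = cylLevel y.2 := by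
    rw [← sum_lowerPart (b := b x.1) (t := cylLevel x.2), hlow, sum_lowerPart]
  have hr : x.2 = y.2 := by
    rcases radius_cases hx with ⟨a, b', c⟩ | ⟨a, b', c⟩ <;>
    rcases radius_cases hy with ⟨a', b'', c'⟩ | ⟨a', b'', c'⟩ <;> linarith
  rcases (cylLevel_mem x.2).2.eq_or_lt with ht1 | ht1
  · right; right
    refine ⟨?_, ?_, hb⟩
    · rcases radius_cases hx with ⟨a, b', c⟩ | ⟨a, b', c⟩ <;> linarith
    · rcases radius_cases hx with ⟨a, b', c⟩ | ⟨a, b', c⟩ <;> linarith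
  · left
    refine Prod.ext ?_ hr
    -- the first vertex of the simplex of the ring is visible below the level 1
    obtain ⟨i, hi, hmin⟩ : ∃ i, 0 < b x.1 i ∧ ∀ k, k < i → b x.1 k = 0 := by
      have hsum := h.sum_eq_one x.1
      rw [Fin.sum_univ_three] at hsum
      rcases (h.nonneg x.1 0).eq_or_lt with h0 | h0
      · rcases (h.nonneg x.1 1).eq_or_lt with h1 | h1
        · refine ⟨2, by linarith, forall_fin_three (fun _ => h0.symm) (fun _ => h1.symm)
            fun h => absurd h (lt_irrefl _)⟩
        · exact ⟨1, h1, forall_fin_three (fun _ => h0.symm) (fun h => absurd h (lt_irrefl _))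
            fun h => absurd h (by decide)⟩
      · exact ⟨0, h0, fun k hk => absurd hk (Fin.not_lt_zero k)⟩
    have hlt := lowerPart_lt (h.nonneg x.1) (h.sum_eq_one x.1) ht1 i hi hmin
    obtain ⟨ρ, rfl, hxρ, -⟩ := h.existsUnique x.1 i hi
    refine h.inj x.1 y.1 ρ hb hxρ ?_ hi hmin
    by_contra hyρ
    have := congrFun hxy (some (Sum.inl ρ))
    rw [diskCoord_ring_of_mem hxρ, diskCoord_ring_of_notMem hyρ] at this
    rcases mul_eq_zero.1 this with h' | h' <;> linarith

/-- The image of the coordinates is a union of closed faces of the standard simplex. -/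
lemma IsRing.exists_diskCoord_eq [DecidableEq R] (h : IsRing b π O) {x : S × ℝ}
    (hx : x.2 ∈ Icc (0 : ℝ) 1) {w : Option (R ⊕ Fin 3) → ℝ} (hw : ∀ v, 0 ≤ w v)
    (hsum : ∑ v, w v = 1) (hsupp : ∀ v, diskCoord b π O x v = 0 → w v = 0) :
    ∃ y : S × ℝ, y.2 ∈ Icc (0 : ℝ) 1 ∧ diskCoord b π O y = w := by
  obtain ⟨j, hj⟩ : ∃ j : Fin 3 → ℝ, j = fun i => w (some (Sum.inr i)) := ⟨_, rfl⟩
  obtain ⟨κ, hκ⟩ : ∃ κ : Fin 3 → ℝ, κ = fun i => ∑ ρ with π ρ = i, w (some (Sum.inl ρ)) :=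
    ⟨_, rfl⟩
  obtain ⟨u, hu⟩ : ∃ u, u = 1 - w none := ⟨_, rfl⟩
  have hj0 : ∀ i, 0 ≤ j i := fun i => by rw [hj]; exact hw _
  have hκ0 : ∀ i, 0 ≤ κ i := fun i => by rw [hκ]; exact Finset.sum_nonneg fun ρ _ => hw _
  have hsum' : ∑ i, (j i + κ i) = u := by
    rw [sum_option_ring π] at hsum
    rw [hu, hj, hκ]
    simp only [add_comm (w _), Finset.sum_add_distrib] at hsum ⊢
    linarith
  have hu0 : 0 ≤ u := hsum' ▸ Finset.sum_nonneg fun i _ => add_nonneg (hj0 i) (hκ0 i)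
  have hle : ∀ ρ, w (some (Sum.inl ρ)) ≤ κ (π ρ) := fun ρ => by
    rw [hκ]
    exact Finset.single_le_sum (f := fun ρ => w (some (Sum.inl ρ))) (fun ρ _ => hw _)
      (Finset.mem_filter.2 ⟨Finset.mem_univ _, rfl⟩)
  rcases hu0.eq_or_lt with hu0 | hu0
  · -- the centre of the disk
    have hz : ∀ i, j i = 0 ∧ κ i = 0 := by
      intro i
      have := (Finset.sum_eq_zero_iff_of_nonneg
        fun i _ => add_nonneg (hj0 i) (hκ0 i)).1 (hsum'.trans hu0.symm) i (Finset.mem_univ i)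
      constructor <;> linarith [hj0 i, hκ0 i]
    have hc : coneWeight 0 = 0 := by simp [coneWeight]
    refine ⟨(x.1, 0), ⟨le_rfl, zero_le_one⟩, funext ?_⟩
    rintro (_ | ρ | i)
    · rw [diskCoord_none, hc]; linarith
    · have h₁ : w (some (Sum.inl ρ)) = 0 :=
        le_antisymm ((hle ρ).trans (hz (π ρ)).2.le) (hw _)
      rw [h₁]
      by_cases hxρ : x.1 ∈ O ρ
      · rw [diskCoord_ring_of_mem (x := (x.1, (0 : ℝ))) hxρ, hc, zero_mul]
      · exact diskCoord_ring_of_notMem (x := (x.1, (0 : ℝ))) hxρ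
    · rw [diskCoord_base, hc, zero_mul]
      have := (hz i).1
      rw [hj] at this
      exact this.symm
  obtain ⟨b', hb'⟩ : ∃ b' : Fin 3 → ℝ, b' = fun i => j i / u + κ i / u := ⟨_, rfl⟩
  have hlow := lowerPart_mem (h.nonneg x.1) (h.sum_eq_one x.1) (cylLevel_mem x.2).1
    (cylLevel_mem x.2).2
  have hjsupp : ∀ i, lowerPart (b x.1) (cylLevel x.2) i = 0 → j i = 0 := fun i hi => by
    rw [hj]
    exact hsupp _ (by rw [diskCoord_base, hi, mul_zero])
  have hκsupp : ∀ i, b x.1 i - lowerPart (b x.1) (cylLevel x.2) i = 0 → κ i = 0 := fun i hi => by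
    rw [hκ]
    refine Finset.sum_eq_zero fun ρ hρ => hsupp _ ?_
    have hρ : π ρ = i := (Finset.mem_filter.1 hρ).2
    by_cases hxρ : x.1 ∈ O ρ
    · rw [diskCoord_ring_of_mem hxρ, hρ, hi, mul_zero]
    · exact diskCoord_ring_of_notMem hxρ
  have hj' : ∀ i, 0 ≤ j i / u := fun i => div_nonneg (hj0 i) hu0.le
  have hκ' : ∀ i, 0 ≤ κ i / u := fun i => div_nonneg (hκ0 i) hu0.le
  obtain ⟨θ, hθ, hO⟩ := h.lift x.1 b' (fun i => by rw [hb']; exact add_nonneg (hj' i) (hκ' i))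
    (by
      rw [hb']
      simp only [← add_div]
      rw [← Finset.sum_div, hsum', div_self hu0.ne'])
    (fun i hi => by
      have := hlow i
      rw [hb']
      simp only
      rw [hjsupp i (by linarith), hκsupp i (by linarith)]
      simp)
  have hstair : lowerPart b' (∑ i, j i / u) = fun i => j i / u := by
    rw [hb']
    refine lowerPart_eq_of_staircase hj' hκ' fun k i hik hk => ?_
    have hk' : κ k ≠ 0 := fun h0 => by rw [h0, zero_div] at hk; exact lt_irrefl _ hk
    have hlt : lowerPart (b x.1) (cylLevel x.2) k < b x.1 k := by
      refine lt_of_le_of_ne (hlow k).2 fun he => hk' (hκsupp k ?_)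
      rw [he, sub_self]
    rw [hjsupp i (lowerPart_eq_zero (h.nonneg x.1) k i hik hlt), zero_div]
  obtain ⟨r, hr, hcone, hlev⟩ : ∃ r ∈ Icc (0 : ℝ) 1, coneWeight r = u ∧
      cylLevel r = ∑ i, j i / u := by
    have hu1 : u ≤ 1 := by linarith [hw none]
    rw [← Finset.sum_div]
    rcases hu1.eq_or_lt with hu1 | hu1
    · have hjsum : 0 ≤ ∑ i, j i := Finset.sum_nonneg fun i _ => hj0 i
      have hjsum' : ∑ i, j i ≤ 1 := by
        rw [← hu1, ← hsum', Finset.sum_add_distrib]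
        linarith [Finset.sum_nonneg fun i (_ : i ∈ Finset.univ) => hκ0 i]
      have hr : (1 + ∑ i, j i) / 2 ∈ Icc (0 : ℝ) 1 := ⟨by linarith, by linarith⟩
      refine ⟨_, hr, ?_, ?_⟩ <;>
      rcases radius_cases hr with ⟨a, b', c⟩ | ⟨a, b', c⟩ <;> rw [hu1] <;>
      first | rw [b'] | rw [c, div_one]
      · linarith
      · linarith
      · linarith
    · -- a positive weight of the centre means that the point is inside the ring
      have hnone : w none ≠ 0 := by linarith
      have hxlt : coneWeight x.2 ≠ 1 := fun h1 => hnone (hsupp none (by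
        rw [diskCoord_none, h1, sub_self]))
      have hlev0 : cylLevel x.2 = 0 := by
        rcases radius_cases hx with ⟨a, b', c⟩ | ⟨a, b', c⟩
        · exact c
        · exact (hxlt b').elim
      have hjz : ∀ i, j i = 0 := fun i => hjsupp i (by
        rw [hlev0, lowerPart_level_zero (h.nonneg x.1) (h.sum_eq_one x.1)]; rfl)
      have hr : u / 2 ∈ Icc (0 : ℝ) 1 := ⟨by linarith, by linarith⟩
      refine ⟨_, hr, ?_, ?_⟩
      · rcases radius_cases hr with ⟨a, b', c⟩ | ⟨a, b', c⟩ <;> linarith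
      · simp only [hjz, Finset.sum_const_zero, zero_div]
        rcases radius_cases hr with ⟨a, b', c⟩ | ⟨a, b', c⟩ <;> linarith
  have hcancel : ∀ a : ℝ, u * (a / u) = a := fun a => mul_div_cancel₀ a hu0.ne'
  refine ⟨(θ, r), hr, funext ?_⟩
  rintro (_ | ρ | i)
  · rw [diskCoord_none, hcone, hu]; ring
  · have hval : ∀ i, u * (b' i - j i / u) = κ i := fun i => by
      rw [hb']
      simp only [add_sub_cancel_left]
      exact hcancel _
    have hpos : 0 < κ (π ρ) → 0 < b' (π ρ) := fun hk => by
      rw [hb']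
      exact add_pos_of_nonneg_of_pos (hj' _) (div_pos hk hu0)
    by_cases hθρ : θ ∈ O ρ
    · rw [diskCoord_ring_of_mem (x := (θ, r)) hθρ]
      simp only
      rw [hcone, hlev, hθ, hstair, hval]
      rcases (hκ0 (π ρ)).eq_or_lt with hk | hk
      · exact (le_antisymm ((hle ρ).trans hk.symm.le) (hw _)).symm ▸ hk.symm
      · -- no other vertex of the ring over the same vertex of the triangle has a weight
        have hxρ : x.1 ∈ O ρ := (hO ρ (hpos hk)).1 hθρ
        have hbx : 0 < b x.1 (π ρ) := by
          refine (h.nonneg x.1 _).lt_of_ne' fun h0 => hk.ne' (hκsupp _ ?_)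
          have := hlow (π ρ)
          linarith
        obtain ⟨ρ₀, -, -, huniq⟩ := h.existsUnique x.1 (π ρ) hbx
        rw [hκ]
        simp only
        refine Finset.sum_eq_single ρ (fun ρ' hρ' hne => hsupp _ ?_)
          fun hn => (hn (Finset.mem_filter.2 ⟨Finset.mem_univ _, rfl⟩)).elim
        refine diskCoord_ring_of_notMem fun hx' => hne ?_
        rw [huniq ρ' (Finset.mem_filter.1 hρ').2 hx', huniq ρ rfl hxρ]
    · rw [diskCoord_ring_of_notMem (x := (θ, r)) hθρ]
      refine le_antisymm (hw _) (not_lt.1 fun hpos' => hθρ ?_)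
      refine (hO ρ (hpos (hpos'.trans_le (hle ρ)))).2 ?_
      by_contra hxρ
      exact hpos'.ne' (hsupp _ (diskCoord_ring_of_notMem hxρ))
  · rw [diskCoord_base, hcone, hlev, hθ, hstair]
    simp only
    rw [hcancel, hj]

end Ring

/-! ### The ring of a dunce hat -/

section DunceRing

universe u

variable {S : Type u} {J : Type*} [TopologicalSpace S] [TopologicalSpace J] {f : S → J} {v : J}

omit [TopologicalSpace J] in
lemma mem_component_self (x : S) (hx : f x ≠ v) :
    x ∈ connectedComponentIn (f ⁻¹' {v})ᶜ x :=
  mem_connectedComponentIn (by simpa using hx)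

omit [TopologicalSpace J] in
lemma apply_ne_of_mem_component {x y : S} (hy : y ∈ connectedComponentIn (f ⁻¹' {v})ᶜ x) :
    f y ≠ v := by
  simpa using connectedComponentIn_subset _ _ hy

lemma IsDunceAttachingMap.injOn_component (hf : IsDunceAttachingMap f v) {x : S} (hx : f x ≠ v) :
    InjOn f (connectedComponentIn (f ⁻¹' {v})ᶜ x) :=
  injOn_iff_injective.2 (hf.isEmbedding_component x hx).injective

lemma IsDunceAttachingMap.exists_mem_component (hf : IsDunceAttachingMap f v) {x : S}
    (hx : f x ≠ v) {y : J} (hy : y ≠ v) :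
    ∃ z ∈ connectedComponentIn (f ⁻¹' {v})ᶜ x, f z = y := by
  have : y ∈ f '' connectedComponentIn (f ⁻¹' {v})ᶜ x := by
    rw [hf.image_component x hx]; exact hy
  exact this

/-- On every component the preimage of a connected subset of `J - {v}` is connected. -/
lemma IsDunceAttachingMap.isPreconnected_component_inter (hf : IsDunceAttachingMap f v) {x : S}
    (hx : f x ≠ v) {E : Set J} (hE : IsPreconnected E) (hvE : v ∉ E) :
    IsPreconnected (connectedComponentIn (f ⁻¹' {v})ᶜ x ∩ f ⁻¹' E) := by
  obtain ⟨C, hC⟩ : ∃ C, C = connectedComponentIn (f ⁻¹' {v})ᶜ x := ⟨_, rfl⟩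
  have hemb := hf.isEmbedding_component x hx
  have himg := hf.image_component x hx
  rw [← hC] at hemb himg ⊢
  have h₁ : C.domRestrict f '' (C.domRestrict f ⁻¹' E) = E := by
    rw [image_preimage_eq_iff]
    intro y hy
    have : y ∈ f '' C := by
      rw [himg]
      rintro rfl
      exact hvE hy
    obtain ⟨z, hz, rfl⟩ := this
    exact ⟨⟨z, hz⟩, rfl⟩
  have h₂ : IsPreconnected (C.domRestrict f ⁻¹' E) := by
    rw [← hemb.isInducing.isPreconnected_image, h₁]
    exact hE
  have h₃ := h₂.image _ continuous_subtype_val.continuousOn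
  convert! h₃ using 1
  ext z
  constructor
  · rintro ⟨hz, hzE⟩
    exact ⟨⟨z, hz⟩, hzE, rfl⟩
  · rintro ⟨⟨z, hz⟩, hzE, rfl⟩
    exact ⟨hz, hzE⟩

/-- The fibres of an attaching map are finite: a fibre over a point other than `v` is compact, and
the components of the complement of the fibre over `v` cover it by open sets that contain at
most one of its points. -/
lemma IsDunceAttachingMap.finite_preimage [CompactSpace S] [LocallyConnectedSpace S] [T2Space J]
    (hf : IsDunceAttachingMap f v) (u : J) : (f ⁻¹' {u}).Finite := by
  by_cases hu : u = v
  · rw [hu]; exact hf.finite_fibre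
  have hcomp : IsCompact (f ⁻¹' {u}) := (isClosed_singleton.preimage hf.continuous).isCompact
  have hopen : IsOpen (f ⁻¹' {v})ᶜ := (isClosed_singleton.preimage hf.continuous).isOpen_compl
  have hne : ∀ x ∈ f ⁻¹' {u}, f x ≠ v := fun x hx => by
    rw [show f x = u from hx]; exact hu
  obtain ⟨t, ht, hcover⟩ := hcomp.elim_nhds_subcover
    (fun x => connectedComponentIn (f ⁻¹' {v})ᶜ x) fun x hx =>
      hopen.connectedComponentIn.mem_nhds (mem_component_self x (hne x hx))
  refine t.finite_toSet.subset fun y hy => ?_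
  obtain ⟨x, hx, hyx⟩ := mem_iUnion₂.1 (hcover hy)
  have hxu := ht x hx
  have : y = x := hf.injOn_component (hne x hxu) hyx
    (mem_component_self x (hne x hxu)) (Eq.trans hy (Eq.symm hxu))
  exact this ▸ hx

lemma IsDunceAttachingMap.surjective [Infinite S] (hf : IsDunceAttachingMap f v) :
    Function.Surjective f := by
  intro y
  by_cases hy : y = v
  · have : (f ⁻¹' {v}).Nonempty := by
      rw [nonempty_iff_ne_empty]
      intro h
      have := hf.three_le_ncard
      rw [h, ncard_empty] at this
      omega
    obtain ⟨x, hx⟩ := this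
    exact ⟨x, hy ▸ hx⟩
  · obtain ⟨x, hx⟩ := hf.finite_fibre.infinite_compl.nonempty
    obtain ⟨z, -, hz⟩ := hf.exists_mem_component (x := x) (by simpa using hx) hy
    exact ⟨z, hz⟩

/-- An attaching map is a simplicial map onto a triangle `v`, 0, 1 with vertex `v` = 2. The vertices
of the source over 0 and 1 are indexed by the components of the complement of the fibre over `v`,
each represented by its point over some fixed `u`; the vertices over 2 are the points of the fibre
over `v`, with disjoint neighbourhoods that contain the preimage of the open star of `v`. -/
theorem IsDunceAttachingMap.exists_isRing [CompactSpace S] [LocallyConnectedSpace S] [T2Space S]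
    [Infinite S] (ψ : Circle ≃ₜ J) (hf : IsDunceAttachingMap f v) :
    ∃ (β : J → Fin 3 → ℝ) (N : Set J) (R : Type u) (_ : Fintype R) (_ : DecidableEq R)
      (π : R → Fin 3) (O : R → Set S),
      IsTriangleCoord β v N ∧ IsRing (fun θ => β (f θ)) π O := by
  classical
  have : T2Space J := ψ.symm.isEmbedding.t2Space
  obtain ⟨F, hF⟩ : ∃ F, F = f ⁻¹' {v} := ⟨_, rfl⟩
  have hFfin : F.Finite := hF ▸ hf.finite_fibre
  have hFmem : ∀ θ, θ ∈ F ↔ f θ = v := fun θ => by rw [hF]; rfl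
  have hopenF : IsOpen Fᶜ := hF ▸ (isClosed_singleton.preimage hf.continuous).isOpen_compl
  obtain ⟨U, hU, hUdisj⟩ := hFfin.t2_separation
  have hUF : ∀ p ∈ F, ∀ q ∈ F, ∀ θ, θ ∈ U p → θ ∈ U q → p = q := by
    intro p hp q hq θ hθp hθq
    by_contra hne
    exact disjoint_left.1 (hUdisj hp hq hne) hθp hθq
  -- a neighbourhood of `v` whose preimage is contained in the chosen neighbourhoods
  obtain ⟨N, hN, hNU⟩ : ∃ N ∈ 𝓝 v, ∀ θ, f θ ∈ N → ∃ p ∈ F, θ ∈ U p := by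
    refine ⟨(f '' (⋃ p ∈ F, U p)ᶜ)ᶜ, ?_, fun θ hθ => ?_⟩
    · refine IsOpen.mem_nhds ?_ ?_
      · refine (hf.continuous.isClosedMap _ ?_).isOpen_compl
        exact (isOpen_biUnion fun p _ => (hU p).2).isClosed_compl
      · rintro ⟨θ, hθ, hθv⟩
        exact hθ (mem_biUnion ((hFmem θ).2 hθv) (hU θ).1)
    · by_contra hcon
      refine hθ ⟨θ, fun h => hcon ?_, rfl⟩
      obtain ⟨p, hp, hθp⟩ := mem_iUnion₂.1 h
      exact ⟨p, hp, hθp⟩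
  obtain ⟨β, hβ⟩ := exists_isTriangleCoord ψ v hN
  have hβv : β v = ![0, 0, 1] := by
    have hsum := hβ.sum_eq_one v
    rw [Fin.sum_univ_three, hβ.apply_vertex] at hsum
    have h0 := hβ.nonneg v 0
    have h1 := hβ.nonneg v 1
    funext i
    revert i
    refine forall_fin_three ?_ ?_ hβ.apply_vertex
    · change β v 0 = 0; linarith
    · change β v 1 = 0; linarith
  have hβ01 : ∀ y i, i ≠ 2 → 0 < β y i → y ≠ v := by
    rintro y i hi hpos rfl
    rw [hβv] at hpos
    revert hi hpos
    revert i
    refine forall_fin_three ?_ ?_ ?_ <;> simp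
  have hβ2 : ∀ y, β y 0 = 0 → β y 1 = 0 → y = v := by
    intro y h0 h1
    apply hβ.injective
    have hsum := hβ.sum_eq_one y
    rw [Fin.sum_univ_three, h0, h1] at hsum
    rw [hβv]
    funext i
    revert i
    refine forall_fin_three h0 h1 ?_
    change β y 2 = 1
    linarith
  -- a point of every component
  obtain ⟨x₀, hx₀⟩ := hFfin.infinite_compl.nonempty
  obtain ⟨u, hu⟩ : ∃ u, u = f x₀ := ⟨_, rfl⟩
  have huv : u ≠ v := fun h => hx₀ ((hFmem x₀).2 (hu ▸ h))
  obtain ⟨G, hG⟩ : ∃ G, G = f ⁻¹' {u} := ⟨_, rfl⟩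
  have hGfin : G.Finite := hG ▸ hf.finite_preimage u
  have hGmem : ∀ θ, θ ∈ G ↔ f θ = u := fun θ => by rw [hG]; rfl
  have hGv : ∀ θ ∈ G, f θ ≠ v := fun θ hθ => by rw [(hGmem θ).1 hθ]; exact huv
  have : Fintype F := hFfin.fintype
  have : Fintype G := hGfin.fintype
  obtain ⟨C, hC⟩ : ∃ C : S → Set S, C = connectedComponentIn Fᶜ := ⟨_, rfl⟩
  have hCf : ∀ x, C x = connectedComponentIn (f ⁻¹' {v})ᶜ x := fun x => by rw [hC, hF]
  have hCopen : ∀ x, IsOpen (C x) := fun x => hC ▸ hopenF.connectedComponentIn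
  have hCself : ∀ θ, f θ ≠ v → θ ∈ C θ := fun θ hθ => by
    rw [hCf]; exact mem_component_self θ hθ
  have hCne : ∀ {x θ}, θ ∈ C x → f θ ≠ v := fun {x θ} h => by
    rw [hCf] at h; exact apply_ne_of_mem_component h
  have hCeq : ∀ {x θ}, θ ∈ C x → C x = C θ := fun {x θ} h => by
    rw [hC] at h ⊢; exact connectedComponentIn_eq h
  have hCinj : ∀ {x θ θ'}, θ ∈ C x → θ' ∈ C x → f θ = f θ' → θ = θ' := by
    intro x θ θ' h h' he
    have e := hCeq h
    have hθ := hCne h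
    rw [e, hCf] at h'
    exact hf.injOn_component hθ (mem_component_self θ hθ) h' he
  let π : (G × Fin 2) ⊕ F → Fin 3 := Sum.elim (fun x => x.2.castSucc) fun _ => 2
  let O : (G × Fin 2) ⊕ F → Set S := Sum.elim (fun x => C x.1) fun p => U p
  have hcast : ∀ i : Fin 2, i.castSucc ≠ (2 : Fin 3) := by decide
  refine ⟨β, N, (G × Fin 2) ⊕ F, inferInstance, inferInstance, π, O, hβ,
    hβ.continuous.comp hf.continuous, fun θ => hβ.nonneg _, fun θ => hβ.sum_eq_one _, ?_, ?_, ?_, ?_⟩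
  · rintro (⟨x, i⟩ | p) θ hθ
    · -- the frontier of a component is contained in the fibre over `v`
      have hθv : f θ = v := by
        by_contra hne
        obtain ⟨z, hz, hz'⟩ := mem_closure_iff.1 (frontier_subset_closure hθ) (C θ) (hCopen θ)
          (hCself θ hne)
        have hzx : z ∈ C x := hz'
        have hθx : θ ∈ C x := by rw [hCeq hzx, ← hCeq hz]; exact hCself θ hne
        exact hθ.2 ((hCopen x).interior_eq.symm ▸ hθx)
      have h := hβ01 v i.castSucc (hcast i)
      change β (f θ) i.castSucc = 0
      rw [hθv]
      exact le_antisymm (not_lt.1 fun hpos => h hpos rfl) (hβ.nonneg _ _)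
    · change β (f θ) 2 = 0
      refine le_antisymm (not_lt.1 fun hpos => ?_) (hβ.nonneg _ _)
      obtain ⟨q, hq, hθq⟩ := hNU θ (hβ.star_subset _ hpos)
      obtain ⟨z, hz, hz'⟩ := mem_closure_iff.1 (frontier_subset_closure hθ) (U q) (hU q).2 hθq
      have hpq := hUF p p.2 q hq z hz' hz
      refine hθ.2 ?_
      change θ ∈ interior (U p)
      rw [(hU p).2.interior_eq, hpq]
      exact hθq
  · intro θ i hpos
    by_cases hi : i = 2
    · subst hi
      obtain ⟨p, hp, hθp⟩ := hNU θ (hβ.star_subset _ hpos)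
      refine ⟨Sum.inr ⟨p, hp⟩, rfl, hθp, ?_⟩
      rintro (⟨x, k⟩ | ⟨q, hq⟩) hk hθ
      · exact (hcast k hk).elim
      · exact congrArg Sum.inr (Subtype.ext (hUF q hq p hp θ hθ hθp))
    · have hθv := hβ01 _ i hi hpos
      obtain ⟨x, hx, hxu⟩ := hf.exists_mem_component hθv huv
      rw [← hCf] at hx
      have hθx : θ ∈ C x := by rw [← hCeq hx]; exact hCself θ hθv
      obtain ⟨k, rfl⟩ : ∃ k : Fin 2, k.castSucc = i := by
        revert hi; clear hpos; revert i; decide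
      refine ⟨Sum.inl (⟨x, (hGmem x).2 hxu⟩, k), rfl, hθx, ?_⟩
      rintro (⟨⟨y, hy⟩, k'⟩ | q) hk hθ
      · have hkk : k' = k := Fin.castSucc_injective 2 hk
        have hθy : θ ∈ C y := hθ
        have hyx : y ∈ C x := by
          rw [hCeq hθx, ← hCeq hθy]; exact hCself y (hGv y hy)
        have : y = x := hCinj hyx (hCself x (by rw [hxu]; exact huv))
          (((hGmem y).1 hy).trans hxu.symm)
        subst this
        rw [hkk]
      · exact (hcast k hk.symm).elim
  · rintro θ θ' (⟨x, k⟩ | p) hb hθ hθ' hpos hlow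
    · exact hCinj hθ hθ' (hβ.injective hb)
    · have h0 : β (f θ) 0 = 0 := hlow 0 (by change (0 : Fin 3) < 2; decide)
      have h1 : β (f θ) 1 = 0 := hlow 1 (by change (1 : Fin 3) < 2; decide)
      have hθv := hβ2 _ h0 h1
      have hθv' : f θ' = v := by rw [← hθv]; exact (hβ.injective hb).symm
      have e₁ := hUF p p.2 θ ((hFmem θ).2 hθv) θ hθ (hU θ).1
      have e₂ := hUF p p.2 θ' ((hFmem θ').2 hθv') θ' hθ' (hU θ').1
      rw [← e₁, ← e₂]
  · intro θ₀ b' hb' hsum hsupp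
    by_cases h01 : b' 0 = 0 ∧ b' 1 = 0
    · -- the vertex 2 lifts to the point of the fibre in the same neighbourhood
      have hb2 : b' 2 = 1 := by
        rw [Fin.sum_univ_three, h01.1, h01.2] at hsum; linarith
      have hpos : 0 < β (f θ₀) 2 := (hβ.nonneg _ _).lt_of_ne' fun h => by
        have := hsupp 2 h; linarith
      obtain ⟨p, hp, hθp⟩ := hNU θ₀ (hβ.star_subset _ hpos)
      refine ⟨p, ?_, ?_⟩
      · rw [(hFmem p).1 hp, hβv]
        funext i
        revert i
        exact forall_fin_three h01.1.symm h01.2.symm hb2.symm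
      · rintro (⟨x, k⟩ | ⟨q, hq⟩) hpos'
        · exfalso
          have : ∀ i : Fin 3, i ≠ 2 → b' i = 0 := forall_fin_three (fun _ => h01.1)
            (fun _ => h01.2) (fun h => absurd rfl h)
          exact hpos'.ne' (this _ (hcast k))
        · change p ∈ U q ↔ θ₀ ∈ U q
          constructor
          · intro h
            rwa [hUF q hq p hp p h (hU p).1]
          · intro h
            rw [hUF q hq p hp θ₀ h hθp]
            exact (hU p).1
    · obtain ⟨i, hi2, hi⟩ : ∃ i : Fin 3, i ≠ 2 ∧ 0 < b' i := by
        by_contra hcon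
        push Not at hcon
        exact h01 ⟨le_antisymm (hcon 0 (by decide)) (hb' 0),
          le_antisymm (hcon 1 (by decide)) (hb' 1)⟩
      have hpos₀ : ∀ k, 0 < b' k → 0 < β (f θ₀) k := fun k hk =>
        (hβ.nonneg _ _).lt_of_ne' fun h => hk.ne' (hsupp k h)
      have hθ₀v := hβ01 _ i hi2 (hpos₀ i hi)
      obtain ⟨k, hk⟩ := hβ.exists_eq_zero (f θ₀)
      obtain ⟨y, hy⟩ := hβ.surj b' hb' hsum ⟨k, hsupp k hk⟩
      have hyv : y ≠ v := hβ01 y i hi2 (hy ▸ hi)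
      obtain ⟨θ, hθ, hθy⟩ := hf.exists_mem_component hθ₀v hyv
      have hθC : θ ∈ C θ₀ := by rwa [hCf]
      refine ⟨θ, by rw [hθy, hy], ?_⟩
      rintro (⟨x, k⟩ | ⟨p, hp⟩) hpos
      · change θ ∈ C x ↔ θ₀ ∈ C x
        constructor
        · intro h
          rw [hCeq h, ← hCeq hθC]; exact hCself θ₀ hθ₀v
        · intro h
          rw [hCeq h]; exact hθC
      · -- both points lie in the preimage of one open edge at the vertex 2, which is connected
        have hpos2 : 0 < b' 2 := hpos
        have hW := hf.isPreconnected_component_inter hθ₀v (hβ.isPreconnected_edge i hi2)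
          fun h => hβ01 v i hi2 h.2 rfl
        rw [← hCf] at hW
        have hmem : θ ∈ C θ₀ ∩ f ⁻¹' {y | 0 < β y 2 ∧ 0 < β y i} :=
          ⟨hθC, by rw [mem_preimage, hθy, mem_ofPred_eq, hy]; exact ⟨hpos2, hi⟩⟩
        have hmem₀ : θ₀ ∈ C θ₀ ∩ f ⁻¹' {y | 0 < β y 2 ∧ 0 < β y i} :=
          ⟨hCself θ₀ hθ₀v, hpos₀ 2 hpos2, hpos₀ i hi⟩
        have hsub : C θ₀ ∩ f ⁻¹' {y | 0 < β y 2 ∧ 0 < β y i} ⊆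
            U p ∪ ⋃ q ∈ F \ {p}, U q := by
          rintro z ⟨-, hz, -⟩
          obtain ⟨q, hq, hzq⟩ := hNU z (hβ.star_subset _ hz)
          by_cases hqp : q = p
          · exact Or.inl (hqp ▸ hzq)
          · exact Or.inr (mem_biUnion (⟨hq, hqp⟩ : q ∈ F \ {p}) hzq)
        have hdisj : Disjoint (U p) (⋃ q ∈ F \ {p}, U q) := by
          rw [disjoint_iUnion₂_right]
          intro q hq
          exact hUdisj hp hq.1 fun h => hq.2 h.symm
        have hopen : IsOpen (⋃ q ∈ F \ {p}, U q) := isOpen_biUnion fun q _ => (hU q).2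
        have key : ∀ z ∈ C θ₀ ∩ f ⁻¹' {y | 0 < β y 2 ∧ 0 < β y i}, z ∈ U p →
            C θ₀ ∩ f ⁻¹' {y | 0 < β y 2 ∧ 0 < β y i} ⊆ U p := fun z hz hzp =>
          hW.subset_left_of_subset_union (hU p).2 hopen hdisj hsub ⟨z, hz, hzp⟩
        exact ⟨fun h => key θ hmem h hmem₀, fun h => key θ₀ hmem₀ h hmem⟩

end DunceRing

/-! ### The dunce hat as a topological space -/

section DunceHat

variable {Δ J : Type*} [TopologicalSpace Δ] [TopologicalSpace J]
  {φ : Metric.closedBall (0 : ℂ) 1 ≃ₜ Δ} {f : boundary φ → J} {v : J}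

/-- The boundary of the disk is a circle. -/
noncomputable def boundaryHomeo (φ : Metric.closedBall (0 : ℂ) 1 ≃ₜ Δ) : Circle ≃ₜ boundary φ where
  toFun z := ⟨φ ⟨z, mem_closedBall_zero_iff.2 z.norm_coe.le⟩, _, z.norm_coe, rfl⟩
  invFun x := ⟨φ.symm x, by
    obtain ⟨_, z, hz, rfl⟩ := x
    simpa [Submonoid.unitSphere] using hz⟩
  left_inv z := by ext; simp
  right_inv x := by ext; simp
  continuous_toFun := by fun_prop
  continuous_invFun := by fun_prop

lemma infinite_boundary (φ : Metric.closedBall (0 : ℂ) 1 ≃ₜ Δ) : Infinite (boundary φ) := by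
  have h : Infinite (Ioc (-Real.pi) Real.pi) :=
    (Ioc_infinite (neg_lt_self Real.pi_pos)).to_subtype
  have : Infinite Circle := Infinite.of_injective
    (fun x : Ioc (-Real.pi) Real.pi => Circle.exp x) fun x y hxy => Subtype.ext <| by
      rw [← Circle.arg_exp x.2.1 x.2.2, ← Circle.arg_exp y.2.1 y.2.2]
      exact congrArg (fun z : Circle => Complex.arg z) hxy
  exact (boundaryHomeo φ).toEquiv.infinite_iff.1 this

lemma mem_boundary_iff {z : Metric.closedBall (0 : ℂ) 1} : φ z ∈ boundary φ ↔ ‖(z : ℂ)‖ = 1 := by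
  constructor
  · rintro ⟨w, hw, hwz⟩
    rwa [← φ.injective hwz]
  · exact fun h => ⟨z, h, rfl⟩

/-- The map from the disk to the dunce hat. -/
def fromDisk (f : boundary φ → J) (x : Δ) : AdjunctionSpace f := Quot.mk _ (Sum.inl x)

/-- The map from the circle `J` to the dunce hat. -/
def fromCircle (f : boundary φ → J) (y : J) : AdjunctionSpace f := Quot.mk _ (Sum.inr y)

omit [TopologicalSpace J] in
lemma fromDisk_boundary (x : boundary φ) : fromDisk f (x : Δ) = fromCircle f (f x) :=
  Quot.sound ⟨x, rfl, rfl⟩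

lemma isQuotientMap_mk : IsQuotientMap (Quot.mk (GlueRel f) : Δ ⊕ J → AdjunctionSpace f) :=
  isQuotientMap_quot_mk

lemma continuous_fromDisk : Continuous (fromDisk f) :=
  isQuotientMap_mk.continuous.comp continuous_inl

omit [TopologicalSpace J] in
lemma fromDisk_surjective (hf : Function.Surjective f) : Function.Surjective (fromDisk f) := by
  rintro ⟨x | y⟩
  · exact ⟨x, rfl⟩
  · obtain ⟨x, rfl⟩ := hf y
    exact ⟨x, fromDisk_boundary x⟩

omit [TopologicalSpace J] in
/-- Points off the boundary are not identified with any other points. -/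
lemma eq_inl_of_mk_eq_fromDisk {x : Δ} (hx : x ∉ boundary φ) {q : Δ ⊕ J}
    (h : (Quot.mk _ q : AdjunctionSpace f) = fromDisk f x) : q = Sum.inl x := by
  classical
  -- the retraction of the dunce hat that collapses the singular circle
  let g : AdjunctionSpace f → Option Δ := Quot.lift
    (Sum.elim (fun x => if x ∈ boundary φ then none else some x) fun _ => none) (by
      rintro _ _ ⟨x, rfl, rfl⟩
      simp)
  have h' := congrArg g h
  rcases q with y | y
  · change (if y ∈ boundary φ then none else some y) =
      (if x ∈ boundary φ then none else some x) at h'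
    rw [if_neg hx] at h'
    split_ifs at h'
    rw [Option.some.inj h']
  · change none = (if x ∈ boundary φ then none else some x) at h'
    rw [if_neg hx] at h'
    cases h'

/-- The inclusion of the open disk into the dunce hat. -/
noncomputable def fromOpenDisk (f : boundary φ → J) (z : Metric.ball (0 : ℂ) 1) : AdjunctionSpace f :=
  fromDisk f (φ ⟨z, Metric.ball_subset_closedBall z.2⟩)

lemma isOpenEmbedding_fromOpenDisk : IsOpenEmbedding (fromOpenDisk f) := by
  have hnot : ∀ z : Metric.ball (0 : ℂ) 1,
      φ ⟨z, Metric.ball_subset_closedBall z.2⟩ ∉ boundary φ := by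
    intro z hz
    rw [mem_boundary_iff] at hz
    exact (mem_ball_zero_iff.1 z.2).ne hz
  have hemb : IsOpenEmbedding (fun z : Metric.ball (0 : ℂ) 1 =>
      φ ⟨z, Metric.ball_subset_closedBall z.2⟩) := by
    refine φ.isOpenEmbedding.comp ⟨⟨?_, ?_⟩, ?_⟩
    · exact (IsEmbedding.inclusion Metric.ball_subset_closedBall).isInducing
    · exact (IsEmbedding.inclusion Metric.ball_subset_closedBall).injective
    · have : range (fun z : Metric.ball (0 : ℂ) 1 =>
          (⟨z, Metric.ball_subset_closedBall z.2⟩ : Metric.closedBall (0 : ℂ) 1)) =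
          Subtype.val ⁻¹' Metric.ball (0 : ℂ) 1 := by
        ext z
        exact ⟨by rintro ⟨w, rfl⟩; exact w.2, fun h => ⟨⟨z, h⟩, rfl⟩⟩
      rw [this]
      exact Metric.isOpen_ball.preimage continuous_subtype_val
  refine IsOpenEmbedding.of_continuous_injective_isOpenMap
    (continuous_fromDisk.comp hemb.continuous) ?_ ?_
  · intro z w h
    exact hemb.injective (Sum.inl.inj (eq_inl_of_mk_eq_fromDisk (hnot w) h))
  · intro U hU
    have : (Quot.mk (GlueRel f) : Δ ⊕ J → AdjunctionSpace f) ⁻¹' (fromOpenDisk f '' U) =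
        Sum.inl '' ((fun z : Metric.ball (0 : ℂ) 1 =>
          φ ⟨z, Metric.ball_subset_closedBall z.2⟩) '' U) := by
      ext q
      constructor
      · rintro ⟨z, hz, hzq⟩
        exact ⟨_, ⟨z, hz, rfl⟩, (eq_inl_of_mk_eq_fromDisk (hnot z) hzq.symm).symm⟩
      · rintro ⟨_, ⟨z, hz, rfl⟩, rfl⟩
        exact ⟨z, hz, rfl⟩
    exact isQuotientMap_quot_mk.isOpen_preimage.1
      ((congrArg IsOpen this).mpr (isOpenMap_inl _ (hemb.isOpenMap U hU)))

lemma denseRange_fromOpenDisk (hf : Function.Surjective f) : DenseRange (fromOpenDisk f) := by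
  have h₁ : DenseRange (fun z : Metric.ball (0 : ℂ) 1 =>
      (⟨z, Metric.ball_subset_closedBall z.2⟩ : Metric.closedBall (0 : ℂ) 1)) := by
    intro z
    rw [IsEmbedding.subtypeVal.isInducing.closure_eq_preimage_closure_image]
    have : Subtype.val '' range (fun z : Metric.ball (0 : ℂ) 1 =>
        (⟨z, Metric.ball_subset_closedBall z.2⟩ : Metric.closedBall (0 : ℂ) 1)) =
        Metric.ball (0 : ℂ) 1 := by
      ext z
      constructor
      · rintro ⟨_, ⟨w, rfl⟩, rfl⟩
        exact w.2
      · exact fun h => ⟨_, ⟨⟨z, h⟩, rfl⟩, rfl⟩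
    rw [this, closure_ball (0 : ℂ) one_ne_zero]
    exact z.2
  exact ((fromDisk_surjective hf).denseRange.comp φ.surjective.denseRange
    continuous_fromDisk).comp h₁ (continuous_fromDisk.comp φ.continuous)

/-- Polar coordinates on the disk: a boundary point, which gives the direction, and a radius. -/
noncomputable def polar (φ : Metric.closedBall (0 : ℂ) 1 ≃ₜ Δ)
    (x : boundary φ × Icc (0 : ℝ) 1) : Δ :=
  φ ⟨(x.2 : ℝ) • (φ.symm x.1 : ℂ), by
    have h₁ := mem_closedBall_zero_iff.1 (φ.symm x.1).2
    rw [mem_closedBall_zero_iff, norm_smul, Real.norm_of_nonneg x.2.2.1]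
    exact mul_le_one₀ x.2.2.2 (norm_nonneg _) h₁⟩

lemma norm_symm_boundary (x : boundary φ) : ‖(φ.symm x : ℂ)‖ = 1 := by
  obtain ⟨_, z, hz, rfl⟩ := x
  simpa using hz

lemma continuous_polar : Continuous (polar φ) := by
  unfold polar
  fun_prop

lemma polar_one (θ : boundary φ) {r : Icc (0 : ℝ) 1} (hr : (r : ℝ) = 1) : polar φ (θ, r) = θ := by
  simp [polar, hr]

lemma polar_zero (θ θ' : boundary φ) {r r' : Icc (0 : ℝ) 1} (hr : (r : ℝ) = 0)
    (hr' : (r' : ℝ) = 0) : polar φ (θ, r) = polar φ (θ', r') := by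
  simp [polar, hr, hr']

lemma polar_surjective : Function.Surjective (polar φ) := by
  intro x
  obtain ⟨⟨z, hz⟩, rfl⟩ := φ.surjective x
  have hz' := mem_closedBall_zero_iff.1 hz
  by_cases h0 : z = 0
  · refine ⟨(boundaryHomeo φ 1, ⟨0, le_rfl, zero_le_one⟩), ?_⟩
    simp [polar, h0]
  · have hn : ‖z‖ ≠ 0 := norm_ne_zero_iff.2 h0
    have hu : ‖(‖z‖⁻¹ : ℝ) • z‖ = 1 := by
      rw [norm_smul, norm_inv, norm_norm, inv_mul_cancel₀ hn]
    refine ⟨(⟨φ ⟨(‖z‖⁻¹ : ℝ) • z, mem_closedBall_zero_iff.2 hu.le⟩, mem_boundary_iff.2 hu⟩,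
      ⟨‖z‖, norm_nonneg z, hz'⟩), ?_⟩
    simp only [polar, Homeomorph.symm_apply_apply, smul_smul]
    simp [hn]

lemma polar_eq_polar {θ θ' : boundary φ} {r r' : Icc (0 : ℝ) 1}
    (h : polar φ (θ, r) = polar φ (θ', r')) : r = r' ∧ ((r : ℝ) = 0 ∨ θ = θ') := by
  have h₁ : (r : ℝ) • (φ.symm θ : ℂ) = (r' : ℝ) • (φ.symm θ' : ℂ) :=
    congrArg Subtype.val (φ.injective h)
  have h₂ : (r : ℝ) = r' := by
    have := congrArg norm h₁
    rwa [norm_smul, norm_smul, norm_symm_boundary, norm_symm_boundary, mul_one, mul_one,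
      Real.norm_of_nonneg r.2.1, Real.norm_of_nonneg r'.2.1] at this
  refine ⟨Subtype.ext h₂, ?_⟩
  by_cases h0 : (r : ℝ) = 0
  · exact Or.inl h0
  · rw [← h₂] at h₁
    exact Or.inr (Subtype.ext (φ.symm.injective (Subtype.ext (smul_right_injective ℂ h0 h₁))))

/-- A generalized dunce hat can be triangulated. -/
theorem nonempty_triangulation (ψ : Circle ≃ₜ J) (hf : IsDunceAttachingMap f v) :
    Nonempty (Triangulation (AdjunctionSpace f)) := by
  have : CompactSpace (boundary φ) := (boundaryHomeo φ).compactSpace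
  have : T2Space Δ := φ.symm.isEmbedding.t2Space
  have : LocallyConnectedSpace Circle :=
    ChartedSpace.locallyConnectedSpace (EuclideanSpace ℝ (Fin 1)) Circle
  have : LocallyConnectedSpace (boundary φ) :=
    (boundaryHomeo φ).symm.isOpenEmbedding.locallyConnectedSpace
  have : Infinite (boundary φ) := infinite_boundary φ
  have hfs := hf.surjective
  obtain ⟨β, N, R, _, _, π, O, hβ, hring⟩ := hf.exists_isRing ψ
  obtain ⟨P, hP⟩ : ∃ P : boundary φ × Icc (0 : ℝ) 1 → Option (R ⊕ Fin 3) → ℝ,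
      P = fun x => diskCoord (fun θ => β (f θ)) π O (x.1, (x.2 : ℝ)) := ⟨_, rfl⟩
  have hPc : Continuous P := by
    rw [hP]
    exact hring.continuous_diskCoord.comp (by fun_prop)
  have hcone0 : coneWeight 0 = 0 := by simp [coneWeight]
  have hcone1 : coneWeight 1 = 1 := by norm_num [coneWeight]
  have hlev1 : cylLevel 1 = 1 := by norm_num [cylLevel]
  -- the coordinates on the circle `J`
  obtain ⟨Q, hQ⟩ : ∃ Q : J → Option (R ⊕ Fin 3) → ℝ, Q = fun y w =>
      match w with
      | none => 0
      | some (Sum.inl _) => 0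
      | some (Sum.inr i) => β y i := ⟨_, rfl⟩
  have hQc : Continuous Q := by
    rw [hQ]
    refine continuous_pi ?_
    rintro (_ | ρ | i)
    · exact continuous_const
    · exact continuous_const
    · exact (continuous_apply i).comp hβ.continuous
  have hP1 : ∀ θ r, ((r : Icc (0 : ℝ) 1) : ℝ) = 1 → P (θ, r) = Q (f θ) := by
    intro θ r hr
    rw [hP, hQ]
    have hlow := lowerPart_level_one (hβ.nonneg (f θ)) (hβ.sum_eq_one (f θ))
    simp only [hr]
    funext w
    rcases w with _ | ρ | i
    · rw [diskCoord_none, hcone1, sub_self]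
    · by_cases hθ : θ ∈ O ρ
      · rw [diskCoord_ring_of_mem (x := (θ, (1 : ℝ))) hθ]
        simp only
        rw [hlev1, hlow, sub_self, mul_zero]
      · exact diskCoord_ring_of_notMem (x := (θ, (1 : ℝ))) hθ
    · rw [diskCoord_base]
      simp only
      rw [hcone1, hlev1, hlow, one_mul]
  have hP0 : ∀ θ θ' r, ((r : Icc (0 : ℝ) 1) : ℝ) = 0 → P (θ, r) = P (θ', r) := by
    intro θ θ' r hr
    have hz : ∀ θ w, P (θ, r) (some w) = 0 := by
      rintro θ (ρ | i)
      · rw [hP]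
        simp only [hr]
        by_cases hθ : θ ∈ O ρ
        · rw [diskCoord_ring_of_mem (x := (θ, (0 : ℝ))) hθ]
          simp only
          rw [hcone0, zero_mul]
        · exact diskCoord_ring_of_notMem (x := (θ, (0 : ℝ))) hθ
      · rw [hP]
        simp only [hr]
        rw [diskCoord_base]
        simp only
        rw [hcone0, zero_mul]
    funext w
    rcases w with _ | w
    · rw [hP]; rfl
    · rw [hz, hz]
  have hPpolar : ∀ x y, polar φ x = polar φ y → P x = P y := by
    rintro ⟨θ, r⟩ ⟨θ', r'⟩ h
    obtain ⟨rfl, h0 | rfl⟩ := polar_eq_polar h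
    · exact hP0 θ θ' r h0
    · rfl
  -- the coordinates on the disk
  have hpq : IsQuotientMap (polar φ) :=
    continuous_polar.isClosedMap.isQuotientMap continuous_polar polar_surjective
  obtain ⟨Gd, hGd⟩ : ∃ Gd : Δ → Option (R ⊕ Fin 3) → ℝ, ∀ x, Gd (polar φ x) = P x := by
    refine ⟨fun x => P (Function.surjInv polar_surjective x), fun x => hPpolar _ _ ?_⟩
    exact Function.surjInv_eq polar_surjective _
  have hGdc : Continuous Gd := by
    rw [hpq.continuous_iff]
    have : Gd ∘ polar φ = P := funext hGd
    rwa [this]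
  let G : AdjunctionSpace f → Option (R ⊕ Fin 3) → ℝ := Quot.lift (Sum.elim Gd Q) (by
    rintro _ _ ⟨θ, rfl, rfl⟩
    have hone : ((⟨1, zero_le_one, le_rfl⟩ : Icc (0 : ℝ) 1) : ℝ) = 1 := rfl
    simp only [Sum.elim_inl, Sum.elim_inr]
    rw [← polar_one θ hone, hGd, hP1 θ _ hone])
  have hGc : Continuous G := isQuotientMap_mk.continuous_iff.2 (hGdc.sumElim hQc)
  have hGP : ∀ x, G (fromDisk f (polar φ x)) = P x := hGd
  have hsurj : ∀ d : AdjunctionSpace f, ∃ x, fromDisk f (polar φ x) = d := fun d => by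
    obtain ⟨x, rfl⟩ := fromDisk_surjective hfs d
    obtain ⟨y, rfl⟩ := polar_surjective (φ := φ) x
    exact ⟨y, rfl⟩
  have hcompact : CompactSpace (AdjunctionSpace f) := by
    rw [← isCompact_univ_iff, ← (show Function.Surjective fun x => fromDisk f (polar φ x) from
      hsurj).range_eq]
    exact isCompact_range (continuous_fromDisk.comp continuous_polar)
  refine nonempty_triangulation_of_coordinates hGc ?_ ?_ ?_ ?_
  · intro d d' h
    obtain ⟨⟨θ, r⟩, rfl⟩ := hsurj d
    obtain ⟨⟨θ', r'⟩, rfl⟩ := hsurj d'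
    rw [hGP, hGP, hP] at h
    rcases hring.diskCoord_inj r.2 r'.2 h with h | ⟨h, h'⟩ | ⟨h, h', hb⟩
    · have hθ : θ = θ' := congrArg Prod.fst h
      have hr : r = r' := Subtype.ext (congrArg Prod.snd h)
      rw [hθ, hr]
    · rw [polar_zero θ θ' h h']
    · rw [polar_one θ h, polar_one θ' h', fromDisk_boundary, fromDisk_boundary,
        hβ.injective hb]
  · intro d w
    obtain ⟨x, rfl⟩ := hsurj d
    rw [hGP, hP]
    exact hring.diskCoord_nonneg _ w
  · intro d
    obtain ⟨x, rfl⟩ := hsurj d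
    rw [hGP, hP]
    exact hring.sum_diskCoord _
  · intro d w hw hsum hsupp
    obtain ⟨x, rfl⟩ := hsurj d
    rw [hGP, hP] at hsupp
    obtain ⟨⟨θ, r⟩, hr, hy⟩ := hring.exists_diskCoord_eq (x := (x.1, (x.2 : ℝ))) x.2.2 hw hsum hsupp
    exact ⟨fromDisk f (polar φ (θ, ⟨r, hr⟩)), by rw [hGP, hP]; exact hy⟩

end DunceHat

end DunceHat

theorem mainTheorem2 {Δ J : Type*} [TopologicalSpace Δ] [TopologicalSpace J]
    (φ : Metric.closedBall (0 : ℂ) 1 ≃ₜ Δ) (ψ : Circle ≃ₜ J)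
    (f : DunceHat.boundary φ → J) (v : J) (hf : DunceHat.IsDunceAttachingMap f v) :
    Nonempty (DunceHat.Triangulation (DunceHat.AdjunctionSpace f)) ∧
    ∀ T : DunceHat.Triangulation (DunceHat.AdjunctionSpace f),
      ∃ A₁ A₂ A₃ : Set (DunceHat.AdjunctionSpace f),
        (∀ A ∈ [A₁, A₂, A₃],
          A ≠ univ ∧ DunceHat.IsSubpolyhedron T A ∧ DunceHat.IsCollapsible T A) ∧
        A₁ ∪ A₂ ∪ A₃ = univ := by
  refine ⟨DunceHat.nonempty_triangulation ψ hf, fun T => ?_⟩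
  have : Infinite (DunceHat.boundary φ) :=
    DunceHat.infinite_boundary φ
  have hconn : ConnectedSpace (Metric.closedBall (0 : ℂ) 1) :=
    isConnected_iff_connectedSpace.1 ((convex_closedBall (0 : ℂ) 1).isConnected ⟨0, by simp⟩)
  have : ConnectedSpace (DunceHat.AdjunctionSpace f) :=
    ((DunceHat.fromDisk_surjective hf.surjective).comp φ.surjective).connectedSpace
      (DunceHat.continuous_fromDisk.comp φ.continuous)
  exact DunceHat.exists_three_collapsible_of_dense_disk DunceHat.isOpenEmbedding_fromOpenDisk
    (DunceHat.denseRange_fromOpenDisk hf.surjective) Metric.isOpen_ball.isOpenEmbedding_subtypeVal T
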